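/- **Setting.** $K$ is an abstract elementary class with strong-submodel relation $\prec$ and Löwenheim–Skolem number $\mathrm{LS}(K)$; $\mathcal F=[\lambda,\theta)$ is an interval of cardinals with $\mathrm{LS}(K)\le\lambda<\theta$, $\theta$ a cardinal or $\infty$; $K_{\mathcal F}$ is the class of models $M\in K$ with $\|M\|\in\mathcal F$. $\mathrm{tp}(\bar a/M;N)$ is the Galois type of $\bar a$ over $M$ in $N$. For a type $p$ of length $\alpha$, $p^{\beta}\restriction M$ is the restriction of $p$ to its first $\beta\le\alpha$ coordinates and to $M$. Sequences are indexed by ordinals, $\ell(\bar a)$ is the length of $\bar a$, and $\bar a\bar b$ is concatenation. **Frames.** A *pre-$(<\alpha,\mathcal F)$-frame* $\mathfrak s$ consists of such a $K$ with a model of size $\lambda$, a family $S^{bs}$ of *basic* types of sequences of length $<\alpha$ over models $M\in K_{\mathcal F}$, all nonalgebraic (no coordinate lies in $M$), and a relation $\bar a\downarrow_{M_0}^{N}M_1$ between $M_0\prec M_1\prec N$ in $K_{\mathcal F}$ and sequences $\bar a$ in $N$ of length $<\alpha$, such that: both notions are invariant under isomorphism; if $\bar a\downarrow_{M_0}^{N}M_1$,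 this remains true for a subsequence of $\bar a$, for $M_0\prec M_0'\prec M_1'\prec M_1$, and for a smaller (still containing $M_1$ and the subsequence) or larger ambient model in $K_{\mathcal F}$; restrictions of basic types to subsequences are basic; if $\bar a\downarrow_{M}^{N}M$, then $\mathrm{tp}(\bar a/M;N)$ is basic. A type $p$ over $M_1$ *does not fork over* $M_0$ if $p=\mathrm{tp}(\bar a/M_1;N)$ with $\bar a\downarrow_{M_0}^{N}M_1$ for some $\bar a,N$. A *good$^-$ $\mathcal F$-frame* is a pre-$(\le1,\mathcal F)$-frame ($\alpha=2$: sequences of length at most one) such that $K_{\mathcal F}$ has amalgamation, joint embedding and no maximal models, and, all models being in $K_{\mathcal F}$: * *Density:* if $M\precneqq N$, some $a\in N$ has $\mathrm{tp}(a/M;N)$ basic. * *Existence:* if $p$ is basic over $M\prec N$ and $\ell(p)\le\beta<\alpha$, there is a basic $q$ of length $\beta$ over $N$ that does not fork over $M$ and satisfies $q^{\ell(p)}\restriction M=p$. * *Uniqueness:* if $p,q$ over $N$ do not fork over $M\prec N$ and $p\restriction M=q\restriction M$, then $p=q$. * *Local character:* if $\delta$ is a limit ordinal, $\langle M_i:i\le\delta\rangle$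 is increasing continuous and $p$ is basic over $M_\delta$ with $\ell(p)<\mathrm{cf}(\delta)$, then $p$ does not fork over $M_i$ for some $i<\delta$. * *Continuity:* let $\delta$ be a limit ordinal, let $\langle M_i:i\le\delta\rangle$ and $\langle\alpha_i<\alpha:i\le\delta\rangle$ be increasing continuous, and let $p_i$ ($i<\delta$) be basic of length $\alpha_i$ over $M_i$ with $p_j=p_i^{\alpha_j}\restriction M_j$ for $j<i<\delta$. Then some basic $p$ of length $\alpha_\delta$ over $M_\delta$ satisfies $p^{\alpha_i}\restriction M_i=p_i$ for all $i<\delta$. Moreover, if each $p_i$ does not fork over $M_0$, then no type $p$ of length $\alpha_\delta$ over $M_\delta$ with $p^{\alpha_i}\restriction M_i=p_i$ for all $i<\delta$ forks over $M_0$. * *Transitivity:* if $M_0\prec M_1\prec M_2$, $p$ over $M_2$ does not fork over $M_1$ and $p\restriction M_1$ does not fork over $M_0$, then $p$ does not fork over $M_0$. Such a frame with length bound $\alpha$ *has symmetry* if, whenever $\bar a_1\downarrow_{M_0}^{N}M_2$, $\bar a_2$ is a sequence in $M_2$ of length $<\alpha$ and $\mathrm{tp}(\bar a_2/M_0;N)$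 is basic, there are $N'\succ N$ and $M_1\prec N'$ containing $\bar a_1$ with $\bar a_2\downarrow_{M_0}^{N'}M_1$. (Symmetry is not required of a good$^-$ frame, nor is the bound $|S^{bs}(M)|\le\|M\|$ on the number of basic 1-types.) **Independence.** Let $M_0\prec M\prec N$ be in $K_{\mathcal F}$. A sequence $\langle a_i:i<\beta\rangle$ in $N$ is *independent from $M$ over $M_0$ in $N$* if there are $N^+\succ N$ in $K_{\mathcal F}$ and an increasing continuous chain $\langle M_i^*:i\le\beta\rangle$ in $K_{\mathcal F}$ with $M\prec M_0^*$, $M_\beta^*\prec N^+$ and $a_i\downarrow_{M_0}^{M_{i+1}^*}M_i^*$ (in particular $a_i\in M_{i+1}^*$) for all $i<\beta$. A set $I\subseteq N$ is *independent from $M$ over $M_0$ in $N$* if some enumeration of it without repetition is. For a cardinal $\mu$, $\mathfrak s^{<\mu}$ is the following data for sequences of length $<\mu$: $\bar a\downarrow_{M_0}^{N}M$ means that $\bar a$ is independent from $M$ over $M_0$ in $N$; a type over $M\in K_{\mathcal F}$ is basic if it is $\mathrm{tp}(\bar a/M;N)$ for some $N$ and some $\bar a$ independent from $M$ over $M$ in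 $N$. **Theorem 4.5.** Let $\mathfrak s$ be a good$^-$ $\mathcal F$-frame, $\mathcal F=[\lambda,\theta)$, and let $\mu\le\theta$ be a cardinal, $\mu\ne2$. The following are equivalent: 1. $\mathfrak s^{<\mu}$ has symmetry. 2. For any $M_0\prec M\prec N$ in $K_{\mathcal F}$ and any sequences $\bar a,\bar b$ in $N$ with $\ell(\bar a\bar b)<\mu$: $\bar a\bar b$ is independent from $M$ over $M_0$ in $N$ if and only if $\bar b\bar a$ is. 3. $\mathfrak s$ has $\mu$-symmetry of independence: for any $M_0\prec M\prec N$ in $K_{\mathcal F}$ and any $I\subseteq N$ with $|I|<\mu$, $I$ is independent from $M$ over $M_0$ in $N$ if and only if every enumeration of $I$ without repetition is independent from $M$ over $M_0$ in $N$. -/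

import Mathlib

open Set
open scoped Cardinal FirstOrder

universe w

/-- An abstract elementary class in the language `L`, with models in `Type w`.
`Mem M` says that the structure `M` belongs to the class, and `Strong A`, for a substructure `A` of
`M`, says that `A` and `M` belong to the class and that `A ≺ M`. -/
structure AEC (L : FirstOrder.Language.{w, w}) where
  Mem : (M : Type w) → [L.Structure M] → Prop
  Strong : {M : Type w} → [L.Structure M] → L.Substructure M → Prop
  mem_sub : ∀ {M : Type w} [L.Structure M] {A : L.Substructure M}, Strong A → Mem A
  mem_ambient : ∀ {M : Type w} [L.Structure M] {A : L.Substructure M}, Strong A → Mem M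
  mem_equiv : ∀ {M N : Type w} [L.Structure M] [L.Structure N], (M ≃[L] N) → Mem M → Mem N
  strong_equiv : ∀ {M N : Type w} [L.Structure M] [L.Structure N] (e : M ≃[L] N)
    {A : L.Substructure M}, Strong A → Strong (A.map e.toEmbedding.toHom)
  strong_top : ∀ {M : Type w} [L.Structure M], Mem M → Strong (⊤ : L.Substructure M)
  strong_trans : ∀ {M : Type w} [L.Structure M] {A : L.Substructure M} {B : L.Substructure A},
    Strong A → Strong B → Strong (B.map A.subtype.toHom)
  coherence : ∀ {M : Type w} [L.Structure M] {A B : L.Substructure M}, A ≤ B → Strong A →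
    Strong B → Strong (A.comap B.subtype.toHom)
  /-- The union `U` of a `≺`-increasing chain belongs to the class, and every member of the chain
  is a strong submodel of it. -/
  chain_union : ∀ {ι : Type w} [LinearOrder ι] [WellFoundedLT ι] [Nonempty ι]
    {U : Type w} [L.Structure U] (A : ι → L.Substructure U),
    (∀ i, Mem (A i)) →
    (∀ i j, i ≤ j → A i ≤ A j ∧ Strong ((A i).comap (A j).subtype.toHom)) →
    (∀ x, ∃ i, x ∈ A i) → Mem U ∧ ∀ i, Strong (A i)
  /-- If all members of an increasing chain are strong submodels of `N`, so is the union. -/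
  chain_smooth : ∀ {ι : Type w} [LinearOrder ι] [WellFoundedLT ι] [Nonempty ι]
    {N : Type w} [L.Structure N] (A : ι → L.Substructure N) (B : L.Substructure N),
    (∀ i j, i ≤ j → A i ≤ A j) → (∀ i, Strong (A i)) →
    (∀ x, x ∈ B ↔ ∃ i, x ∈ A i) → Strong B
  exists_LS : ∃ κ : Cardinal.{w}, ℵ₀ ≤ κ ∧ L.card ≤ κ ∧
    ∀ {M : Type w} [L.Structure M], Mem M → ∀ S : Set M,
      ∃ A : L.Substructure M, Strong A ∧ S ⊆ A ∧ #A ≤ #S + κ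

namespace AEC

variable {L : FirstOrder.Language.{w, w}}

/-- The Löwenheim–Skolem–Tarski number. -/
noncomputable def LS (K : AEC L) : Cardinal.{w} :=
  sInf {κ : Cardinal.{w} | ℵ₀ ≤ κ ∧ L.card ≤ κ ∧
    ∀ (M : Type w) [L.Structure M], K.Mem M → ∀ S : Set M,
      ∃ A : L.Substructure M, K.Strong A ∧ S ⊆ A ∧ #A ≤ #S + κ}

structure Model (K : AEC L) : Type (w + 1) where
  carrier : Type w
  [str : L.Structure carrier]
  mem : K.Mem carrier

instance (K : AEC L) : CoeSort K.Model (Type w) := ⟨Model.carrier⟩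

instance (K : AEC L) (M : K.Model) : L.Structure M := M.str

variable {K : AEC L}

/-- The submodels `A ≺ N` of a model `N`. By transitivity and coherence, for two of them `A ≺ B`
is the same as `A ⊆ B`. -/
@[ext]
structure Submodel (N : K.Model) : Type w where
  sub : L.Substructure N
  strong : K.Strong sub

instance (N : K.Model) : LE (Submodel N) := ⟨fun A B => A.sub ≤ B.sub⟩

instance (N : K.Model) : Membership N (Submodel N) := ⟨fun A x => x ∈ A.sub⟩

def Submodel.toModel {N : K.Model} (A : Submodel N) : K.Model := ⟨A.sub, K.mem_sub A.strong⟩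

/-- The `K`-embeddings: isomorphisms onto a strong submodel. -/
structure Emb (M N : K.Model) : Type w where
  toEmbedding : M ↪[L] N
  strong_range : K.Strong toEmbedding.toHom.range

instance (M N : K.Model) : CoeFun (Emb M N) (fun _ => M → N) := ⟨fun f => f.toEmbedding⟩

theorem strong_map {M N : K.Model} (f : Emb M N) {A : L.Substructure M} (hA : K.Strong A) :
    K.Strong (A.map f.toEmbedding.toHom) := by
  have h := K.strong_trans f.strong_range (K.strong_equiv f.toEmbedding.equivRange hA)
  rw [FirstOrder.Language.Substructure.map_map] at h
  exact h

/-- The image of a submodel. -/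
def Submodel.map {M N : K.Model} (A : Submodel M) (f : Emb M N) : Submodel N :=
  ⟨A.sub.map f.toEmbedding.toHom, strong_map f A.strong⟩

def Emb.range {M N : K.Model} (f : Emb M N) : Submodel N :=
  ⟨f.toEmbedding.toHom.range, f.strong_range⟩

def Emb.comp {M N P : K.Model} (g : Emb N P) (f : Emb M N) : Emb M P where
  toEmbedding := g.toEmbedding.comp f.toEmbedding
  strong_range := by
    have h := strong_map g f.strong_range
    rw [← FirstOrder.Language.Hom.range_comp] at h
    exact h

def Submodel.subtype {N : K.Model} (A : Submodel N) : Emb A.toModel N where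
  toEmbedding := A.sub.subtype
  strong_range := by
    have h := A.strong
    rw [← FirstOrder.Language.Substructure.range_subtype A.sub] at h
    exact h

def Submodel.inclusion {N : K.Model} {A B : Submodel N} (h : A ≤ B) :
    Emb A.toModel B.toModel where
  toEmbedding := FirstOrder.Language.Substructure.inclusion h
  strong_range := by
    have h1 := K.coherence h A.strong B.strong
    have h2 : (FirstOrder.Language.Substructure.inclusion h).toHom.range =
        A.sub.comap B.sub.subtype.toHom := by
      ext x
      constructor
      · rintro ⟨y, rfl⟩
        exact y.2
      · intro hx
        exact ⟨⟨x.1, hx⟩, rfl⟩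
    exact h2 ▸ h1

/-- `A`, regarded as a submodel of a larger submodel `B`. -/
def Submodel.within {N : K.Model} {A B : Submodel N} (h : A ≤ B) : Submodel B.toModel :=
  (Submodel.inclusion h).range

/-- Restriction of a sequence of length `β` to its first `γ` entries. -/
def initialPart {X : Type w} {γ β : Ordinal.{w}} (h : γ ≤ β) (a : Iio β → X) : Iio γ → X :=
  fun i => a ⟨i.1, lt_of_lt_of_le i.2 h⟩

/-- The sequence `a` followed by the sequence `b`. -/
noncomputable def concat {X : Type w} {α β : Ordinal.{w}} (a : Iio α → X) (b : Iio β → X) :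
    Iio (α + β) → X :=
  fun i => if h : i.1 < α then a ⟨i.1, h⟩ else
    b ⟨i.1 - α, (Ordinal.sub_lt_of_le (not_lt.mp h)).mpr i.2⟩

/-- The sequence of length one with entry `x`. -/
def single {X : Type w} (x : X) : Iio (1 : Ordinal.{w}) → X := fun _ => x

/-- A sequence of length `β` in an extension of `M`. -/
structure Rep (M : K.Model) (β : Ordinal.{w}) : Type (w + 1) where
  N : K.Model
  emb : Emb M N
  seq : Iio β → N

/-- Two sequences have the same type over `M` in one step: the extensions they live in can be
amalgamated over `M` so that the sequences are identified. -/
def Rep.Atomic {M : K.Model} {β : Ordinal.{w}} (r s : Rep M β) : Prop :=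
  ∃ (P : K.Model) (g : Emb r.N P) (h : Emb s.N P),
    (∀ x, g (r.emb x) = h (s.emb x)) ∧ ∀ i, g (r.seq i) = h (s.seq i)

/-- The Galois types of sequences of length `β` over `M`: `Quot` takes the quotient by the
equivalence relation generated by `Rep.Atomic`. -/
def GType (M : K.Model) (β : Ordinal.{w}) : Type (w + 1) :=
  Quot (Rep.Atomic : Rep M β → Rep M β → Prop)

/-- The Galois type of `a` over `M` in `N`, where `M` is identified with its image in `N`. -/
def gtp {M N : K.Model} {β : Ordinal.{w}} (f : Emb M N) (a : Iio β → N) : GType M β :=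
  Quot.mk _ ⟨N, f, a⟩

/-- The type over `M` of the first `γ` entries of a sequence of type `p`, where `p` is a type over
an extension of `M`. -/
def GType.restrict {M M' : K.Model} {γ β : Ordinal.{w}} (h : Emb M M') (hγ : γ ≤ β) :
    GType M' β → GType M γ :=
  Quot.map (fun r => ⟨r.N, r.emb.comp h, initialPart hγ r.seq⟩) (by
    rintro r s ⟨P, g, k, h1, h2⟩
    exact ⟨P, g, k, fun x => h1 (h x), fun i => h2 _⟩)

/-- A continuous increasing chain `⟨C i : i ≤ δ⟩` of submodels of `N`
(the values of `C` beyond `δ` are irrelevant). -/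
structure IsContChain {N : K.Model} (C : Ordinal.{w} → Submodel N) (δ : Ordinal.{w}) : Prop where
  mono : ∀ i j, i ≤ j → j ≤ δ → C i ≤ C j
  cont : ∀ j ≤ δ, Order.IsSuccLimit j → ∀ x ∈ C j, ∃ i < j, x ∈ C i

/-- The data of a `(<len, [lam, theta))`-frame with underlying class `K`: a relation
`nf M₀ M₁ a` (in `N`) on `M₀ ≺ M₁ ≺ N` and sequences `a` in `N`, and for each model `M` and each
length a set `bs` of (basic) types over `M`. `theta = ⊤` stands for `∞`. -/
structure FrameData (K : AEC L) : Type (w + 1) where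
  len : Ordinal.{w}
  lam : Cardinal.{w}
  theta : WithTop Cardinal.{w}
  nf : {N : K.Model} → {β : Ordinal.{w}} → Submodel N → Submodel N → (Iio β → N) → Prop
  bs : (M : K.Model) → (β : Ordinal.{w}) → Set (GType M β)

namespace FrameData

variable (s : FrameData K)

/-- `M` belongs to `K_F`, where `F = [lam, theta)`. -/
def InF (M : K.Model) : Prop := s.lam ≤ #M ∧ ((#M : Cardinal.{w}) : WithTop Cardinal.{w}) < s.theta

structure IsPreFrame : Prop where
  lam_lt_theta : (s.lam : WithTop Cardinal.{w}) < s.theta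
  LS_le : K.LS ≤ s.lam
  exists_model : ∃ M : K.Model, #M = s.lam
  bs_dom : ∀ {M : K.Model} {β : Ordinal.{w}} {p : GType M β}, p ∈ s.bs M β → s.InF M ∧ β < s.len
  /-- Basic types are nonalgebraic. -/
  bs_na : ∀ {M N : K.Model} {β : Ordinal.{w}} (f : Emb M N) (a : Iio β → N),
    gtp f a ∈ s.bs M β → ∀ i, a i ∉ f.range
  nf_dom : ∀ {N : K.Model} {β : Ordinal.{w}} {M₀ M₁ : Submodel N} {a : Iio β → N},
    s.nf M₀ M₁ a → M₀ ≤ M₁ ∧ β < s.len ∧ s.InF M₀.toModel ∧ s.InF M₁.toModel ∧ s.InF N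
  /-- Invariance; a surjective `K`-embedding is an isomorphism. -/
  nf_iso : ∀ {N N' : K.Model} (f : Emb N N'), Function.Surjective f →
    ∀ {β : Ordinal.{w}} {M₀ M₁ : Submodel N} {a : Iio β → N},
    s.nf M₀ M₁ a → s.nf (M₀.map f) (M₁.map f) (fun i => f (a i))
  bs_iso : ∀ {N N' : K.Model} (f : Emb N N'), Function.Surjective f →
    ∀ {β : Ordinal.{w}} {M₁ : Submodel N} {a : Iio β → N},
    gtp M₁.subtype a ∈ s.bs M₁.toModel β →
    gtp (M₁.map f).subtype (fun i => f (a i)) ∈ s.bs (M₁.map f).toModel β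
  /-- Monotonicity in the sequence and in the two models: `M₀ ≺ M₀' ≺ M₁' ≺ M₁`, and the
  subsequence is taken along a strictly increasing map of indices. -/
  nf_mono : ∀ {N : K.Model} {β β' : Ordinal.{w}} {M₀ M₀' M₁' M₁ : Submodel N} {a : Iio β → N}
    (g : Iio β' → Iio β), StrictMono g → M₀ ≤ M₀' → M₀' ≤ M₁' → M₁' ≤ M₁ →
    s.nf M₀ M₁ a → s.nf M₀' M₁' (fun i => a (g i))
  /-- Monotonicity: passing to a smaller ambient model `N' ≺ N` that contains `M₁` and `a`. -/
  nf_shrink : ∀ {N : K.Model} {β : Ordinal.{w}} {M₀ M₁ N' : Submodel N} {a : Iio β → N}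
    (h₀ : M₀ ≤ N') (h₁ : M₁ ≤ N') (ha : ∀ i, a i ∈ N'),
    s.nf M₀ M₁ a →
    s.nf (N := N'.toModel) (Submodel.within h₀) (Submodel.within h₁) (fun i => ⟨a i, ha i⟩)
  /-- Monotonicity: passing to a larger ambient model in `K_F`. -/
  nf_extend : ∀ {N N'' : K.Model} (f : Emb N N''), s.InF N'' →
    ∀ {β : Ordinal.{w}} {M₀ M₁ : Submodel N} {a : Iio β → N},
    s.nf M₀ M₁ a → s.nf (M₀.map f) (M₁.map f) (fun i => f (a i))
  bs_mono : ∀ {M N : K.Model} {β β' : Ordinal.{w}} (f : Emb M N) (a : Iio β → N)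
    (g : Iio β' → Iio β), StrictMono g →
    gtp f a ∈ s.bs M β → gtp f (fun i => a (g i)) ∈ s.bs M β'
  /-- Nonforking types are basic. -/
  bs_of_nf : ∀ {N : K.Model} {β : Ordinal.{w}} {M : Submodel N} {a : Iio β → N},
    s.nf M M a → gtp M.subtype a ∈ s.bs M.toModel β

/-- The type `p` over `M₁` does not fork over (the image in `M₁` under `h` of) `M₀`. -/
def DoesNotFork {M₀ M₁ : K.Model} (h : Emb M₀ M₁) {β : Ordinal.{w}} (p : GType M₁ β) : Prop :=
  ∃ (N : K.Model) (f : Emb M₁ N) (a : Iio β → N),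
    p = gtp f a ∧ s.nf (f.comp h).range f.range a

def HasAmalgamation : Prop :=
  ∀ (M₀ M₁ M₂ : K.Model) (f₁ : Emb M₀ M₁) (f₂ : Emb M₀ M₂), s.InF M₀ → s.InF M₁ → s.InF M₂ →
    ∃ (N : K.Model) (g₁ : Emb M₁ N) (g₂ : Emb M₂ N), s.InF N ∧ ∀ x, g₁ (f₁ x) = g₂ (f₂ x)

def HasJointEmbedding : Prop :=
  ∀ M₁ M₂ : K.Model, s.InF M₁ → s.InF M₂ →
    ∃ N : K.Model, s.InF N ∧ Nonempty (Emb M₁ N) ∧ Nonempty (Emb M₂ N)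

def HasNoMaximalModels : Prop :=
  ∀ M : K.Model, s.InF M → ∃ (N : K.Model) (f : Emb M N), s.InF N ∧ ¬ Function.Surjective f

/-- Density of basic types. -/
def HasDensity : Prop :=
  ∀ (M N : K.Model) (f : Emb M N), s.InF M → s.InF N → ¬ Function.Surjective f →
    ∃ a : N, gtp f (single a) ∈ s.bs M 1

/-- Existence of nonforking extensions. -/
def HasExistence : Prop :=
  ∀ (M N : K.Model) (h : Emb M N) (γ β : Ordinal.{w}) (hγ : γ ≤ β) (p : GType M γ),
    p ∈ s.bs M γ → s.InF N → β < s.len →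
    ∃ q ∈ s.bs N β, s.DoesNotFork h q ∧ q.restrict h hγ = p

def HasUniqueness : Prop :=
  ∀ (M N : K.Model) (h : Emb M N) (β : Ordinal.{w}) (p q : GType N β), β < s.len →
    s.DoesNotFork h p → s.DoesNotFork h q →
    p.restrict h le_rfl = q.restrict h le_rfl → p = q

def HasSymmetry : Prop :=
  ∀ (N : K.Model) (M₀ M₂ : Submodel N) (β₁ β₂ : Ordinal.{w}) (a₁ : Iio β₁ → N) (a₂ : Iio β₂ → N),
    s.nf M₀ M₂ a₁ → β₂ < s.len → (∀ i, a₂ i ∈ M₂) → gtp M₀.subtype a₂ ∈ s.bs M₀.toModel β₂ →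
    ∃ (N' : K.Model) (f : Emb N N') (M₁ : Submodel N'),
      (∀ i, f (a₁ i) ∈ M₁) ∧ s.nf (M₀.map f) M₁ (fun i => f (a₂ i))

def HasLocalCharacter : Prop :=
  ∀ (N : K.Model) (δ : Ordinal.{w}) (C : Ordinal.{w} → Submodel N) (hC : IsContChain C δ)
    (β : Ordinal.{w}) (p : GType (C δ).toModel β),
    Order.IsSuccLimit δ → (∀ i ≤ δ, s.InF (C i).toModel) →
    p ∈ s.bs (C δ).toModel β → β < δ.cof.ord →
    ∃ (i : Ordinal.{w}) (hi : i < δ), s.DoesNotFork (Submodel.inclusion (hC.mono i δ hi.le le_rfl)) p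

/-- Continuity: a coherent sequence of basic types `p i` over the models of a continuous chain has
a basic extension over the union; and if no `p i` forks over the first model, then no type over the
union that extends all of them does. -/
def HasContinuity : Prop :=
  ∀ (N : K.Model) (δ : Ordinal.{w}) (C : Ordinal.{w} → Submodel N) (hC : IsContChain C δ)
    (ℓ : Ordinal.{w} → Ordinal.{w}) (hℓ : ∀ i j, i ≤ j → j ≤ δ → ℓ i ≤ ℓ j)
    (p : ∀ i, i < δ → GType (C i).toModel (ℓ i)),
    Order.IsSuccLimit δ → (∀ i ≤ δ, s.InF (C i).toModel) →
    (∀ i ≤ δ, ℓ i < s.len) → (∀ j ≤ δ, Order.IsSuccLimit j → IsLUB (ℓ '' Iio j) (ℓ j)) →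
    (∀ i (hi : i < δ), p i hi ∈ s.bs (C i).toModel (ℓ i)) →
    (∀ j i (hji : j < i) (hi : i < δ), p j (hji.trans hi) =
      (p i hi).restrict (Submodel.inclusion (hC.mono j i hji.le hi.le)) (hℓ j i hji.le hi.le)) →
    (∃ q ∈ s.bs (C δ).toModel (ℓ δ), ∀ i (hi : i < δ), p i hi =
      q.restrict (Submodel.inclusion (hC.mono i δ hi.le le_rfl)) (hℓ i δ hi.le le_rfl)) ∧
    ((∀ i (hi : i < δ),
        s.DoesNotFork (Submodel.inclusion (hC.mono 0 i (zero_le) hi.le)) (p i hi)) →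
      ∀ q : GType (C δ).toModel (ℓ δ),
        (∀ i (hi : i < δ), p i hi =
          q.restrict (Submodel.inclusion (hC.mono i δ hi.le le_rfl)) (hℓ i δ hi.le le_rfl)) →
        s.DoesNotFork (Submodel.inclusion (hC.mono 0 δ (zero_le) le_rfl)) q)

def HasTransitivity : Prop :=
  ∀ (M₀ M₁ M₂ : K.Model) (h₀ : Emb M₀ M₁) (h₁ : Emb M₁ M₂) (β : Ordinal.{w}) (p : GType M₂ β),
    s.DoesNotFork h₁ p → s.DoesNotFork h₀ (p.restrict h₁ le_rfl) → s.DoesNotFork (h₁.comp h₀) p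

/-- A good⁻ frame: all axioms of a good frame, without symmetry and bs-stability. -/
structure IsGoodMinus : Prop extends s.IsPreFrame where
  amalgamation : s.HasAmalgamation
  jointEmbedding : s.HasJointEmbedding
  noMaximalModels : s.HasNoMaximalModels
  density : s.HasDensity
  existence : s.HasExistence
  uniqueness : s.HasUniqueness
  localCharacter : s.HasLocalCharacter
  continuity : s.HasContinuity
  transitivity : s.HasTransitivity

/-- A good⁻ `F`-frame: the types are those of sequences of length at most one. -/
def IsGoodMinusF : Prop := s.IsGoodMinus ∧ s.len = 2

/-- `⟨a i : i < α⟩, ⟨C i : i ≤ α⟩` is independent in `(M, M', N)`. -/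
structure IndepWith {N : K.Model} (M M' : Submodel N) {α : Ordinal.{w}} (a : Iio α → N)
    (C : Ordinal.{w} → Submodel N) : Prop where
  chain : IsContChain C α
  chain_inF : ∀ i ≤ α, s.InF (C i).toModel
  inF : s.InF M.toModel ∧ s.InF M'.toModel ∧ s.InF N
  base_le : M ≤ M'
  le_chain : M' ≤ C 0
  /-- The nonforking is that of the `i`-th entry from `C i` over `M` in `C (i + 1)`. -/
  nf : ∀ i : Iio α, ∃ (hM : M ≤ C (i.1 + 1)) (hC : C i.1 ≤ C (i.1 + 1)) (ha : a i ∈ C (i.1 + 1)),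
    s.nf (N := (C (i.1 + 1)).toModel) (Submodel.within hM) (Submodel.within hC)
      (single (⟨a i, ha⟩ : (C (i.1 + 1)).sub))

/-- The sequence `a` is independent from `M'` over `M` in `N`. -/
def Indep {N : K.Model} (M M' : Submodel N) {α : Ordinal.{w}} (a : Iio α → N) : Prop :=
  ∃ (N' : K.Model) (f : Emb N N') (C : Ordinal.{w} → Submodel N'),
    s.IndepWith (M.map f) (M'.map f) (fun i => f (a i)) C

/-- The elongation of the frame to sequences of length less than `α`: nonforking is independence,
and the basic types are the types of sequences independent from their base over it. -/
def elongation (α : Ordinal.{w}) : FrameData K where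
  len := α
  lam := s.lam
  theta := s.theta
  nf := fun {N} {β} M₀ M₁ a => β < α ∧ s.InF N ∧ s.Indep M₀ M₁ a
  bs := fun M β => {p | β < α ∧ ∃ (N : K.Model) (f : Emb M N) (a : Iio β → N),
    p = gtp f a ∧ s.InF N ∧ s.Indep f.range f.range a}

/-- `a` enumerates the set `I` (without repetition). -/
def Enumerates {X : Type w} (I : Set X) {α : Ordinal.{w}} (a : Iio α → X) : Prop :=
  Function.Injective a ∧ Set.range a = I

/-- The set `I` is independent from `M'` over `M` in `N`: some enumeration is. -/
def IndepSet {N : K.Model} (M M' : Submodel N) (I : Set N) : Prop :=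
  ∃ (α : Ordinal.{w}) (a : Iio α → N), Enumerates I a ∧ s.Indep M M' a

/-- `μ`-symmetry of independence. -/
def SymmetryOfIndependence (μ : Cardinal.{w}) : Prop :=
  ∀ (N : K.Model) (M₀ M : Submodel N), s.InF N → s.InF M.toModel → s.InF M₀.toModel → M₀ ≤ M →
    ∀ I : Set N, #I < μ →
      (s.IndepSet M₀ M I ↔
        ∀ (α : Ordinal.{w}) (a : Iio α → N), Enumerates I a → s.Indep M₀ M a)

/-- Independence of a concatenation of total length less than `μ` does not depend on the order of
the two sequences. -/
def ConcatSymmetry (μ : Cardinal.{w}) : Prop :=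
  ∀ (N : K.Model) (M₀ M : Submodel N), s.InF N → s.InF M.toModel → s.InF M₀.toModel → M₀ ≤ M →
    ∀ (α β : Ordinal.{w}) (a : Iio α → N) (b : Iio β → N), α + β < μ.ord →
      (s.Indep M₀ M (concat a b) ↔ s.Indep M₀ M (concat b a))

end FrameData

end AEC

/-! Everything passes through `ElementSymmetry`, symmetry of nonforking for single elements. For `μ
> 1` it is the case of sequences of length one in the symmetry of the elongation. For `μ > 2` it
also follows from commutation of concatenations: if `b` is free from a model containing `c`, then
`⟨c, b⟩` is independent, and a chain witnessing the independence of `⟨b, c⟩` has a model that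
contains `b` and from which `c` is free. For `μ ≤ 1` only empty sequences and sets occur. At `μ = 2`
the second and third statements concern at most one element and are trivial, while the first is
still element symmetry; hence the exclusion.

Conversely, element symmetry allows independent sequences to be rearranged. The basic move is
`exists_insert`. Let `c j ∈ E (j + 1)` be free over `M₀` from `E j` along a chain `E`, and let `b`
be free over `M₀` from the whole ambient model. To put `b` at place `j₀`, one builds a second chain
of models `F j ⊇ E j`, all containing `b`, such that `b` stays free from `E j` and `c j` is free
even from `F j`. The successor step is `exists_mutual_amalgam`, which is where symmetry is used; the
limit step is continuity of types of single elements. By uniqueness, `b` has the same type over `E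
γ` in the original model as in `F γ`, so the two models can be amalgamated with `b` identified. The
members of `E` up to `j₀`, followed by the members of `F` after `j₀`, form the desired chain.

`exists_interleave` iterates this transfinitely: the entries of a sequence free along a chain `C`
are inserted one by one, in their order, at prescribed places of another chain. When its turn comes,
an entry is first made free from the model built so far, by a nonforking extension of its type over
`C i`. Started from a constant chain, this shows that every enumeration of an independent set is
independent (`indep_of_range_eq`). Started from a chain for `a₂` preceded by idle places, which `a₁`
then fills, it gives a chain for `a₁` followed by `a₂`; the model reached after `a₁` witnesses
symmetry of the elongation.

Two devices keep the constructions under control. Löwenheim–Skolem bounds all models by a fixed `κ`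
below `θ`, so that they stay in the class of the frame. Marking elements by a fixed large set makes
the transition embeddings unique, hence automatically coherent. -/

namespace AEC

variable {L : FirstOrder.Language.{w, w}} {K : AEC L}

/-! ### Submodels and `K`-embeddings -/

namespace Submodel

variable {N : K.Model}

theorem ext_mem {A B : Submodel N} (h : ∀ x : N, x ∈ A ↔ x ∈ B) : A = B :=
  Submodel.ext (FirstOrder.Language.Substructure.ext h)

theorem le_refl (A : Submodel N) : A ≤ A := fun _ h => h

theorem le_trans {A B C : Submodel N} (h₁ : A ≤ B) (h₂ : B ≤ C) : A ≤ C :=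
  fun _ h => h₂ (h₁ h)

theorem mem_map_of_mem {M : K.Model} {A : Submodel M} (f : Emb M N) {x : M} (h : x ∈ A) :
    f x ∈ A.map f := ⟨x, h, rfl⟩

theorem map_mono {M : K.Model} {A B : Submodel M} (f : Emb M N) (h : A ≤ B) :
    A.map f ≤ B.map f := by
  rintro _ ⟨x, hx, rfl⟩
  exact ⟨x, h hx, rfl⟩

/-- An element of a submodel, as an element of the corresponding model. -/
def elem {A : Submodel N} {x : N} (h : x ∈ A) : A.toModel := (⟨x, h⟩ : A.sub)

theorem mem_within {A B : Submodel N} (h : A ≤ B) {x : B.toModel} : x ∈ within h ↔ x.1 ∈ A := by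
  constructor
  · rintro ⟨y, rfl⟩
    exact y.2
  · intro hx
    exact ⟨⟨x.1, hx⟩, rfl⟩

end Submodel

namespace Emb

theorem injective {M N : K.Model} (f : Emb M N) : Function.Injective f :=
  f.toEmbedding.injective

theorem mem_range_self {M N : K.Model} (f : Emb M N) (x : M) : f x ∈ f.range := ⟨x, rfl⟩

@[simp] theorem comp_apply {M N P : K.Model} (g : Emb N P) (f : Emb M N) (x : M) :
    g.comp f x = g (f x) := rfl

theorem ext {M N : K.Model} {f g : Emb M N} (h : ∀ x, f x = g x) : f = g := by
  cases f; cases g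
  congr
  exact FirstOrder.Language.Embedding.ext h

theorem card_le {M N : K.Model} (f : Emb M N) : #M ≤ #N :=
  Cardinal.mk_le_of_injective f.injective

theorem range_subtype {N : K.Model} (A : Submodel N) : A.subtype.range = A :=
  Submodel.ext_mem fun x => ⟨by rintro ⟨y, rfl⟩; exact y.2, fun h => ⟨⟨x, h⟩, rfl⟩⟩

theorem range_comp {M N P : K.Model} (g : Emb N P) (f : Emb M N) :
    (g.comp f).range = f.range.map g :=
  Submodel.ext_mem fun y => ⟨by rintro ⟨x, rfl⟩; exact ⟨f x, ⟨x, rfl⟩, rfl⟩,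
    by rintro ⟨_, ⟨x, rfl⟩, rfl⟩; exact ⟨x, rfl⟩⟩

theorem map_range {M N P : K.Model} (g : Emb N P) (f : Emb M N) :
    f.range.map g = (g.comp f).range := (range_comp g f).symm

theorem map_comp {M N P : K.Model} (g : Emb N P) (f : Emb M N) (A : Submodel M) :
    A.map (g.comp f) = (A.map f).map g :=
  Submodel.ext_mem fun y => ⟨by rintro ⟨x, hx, rfl⟩; exact ⟨f x, ⟨x, hx, rfl⟩, rfl⟩,
    by rintro ⟨_, ⟨x, hx, rfl⟩, rfl⟩; exact ⟨x, hx, rfl⟩⟩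

/-- A `K`-embedding whose range is contained in a submodel, as an embedding into it. -/
def codRestrict {M N : K.Model} (f : Emb M N) (A : Submodel N) (h : ∀ x, f x ∈ A) :
    Emb M A.toModel where
  toEmbedding := f.toEmbedding.codRestrict A.sub h
  strong_range := by
    have h1 := K.coherence (A := f.range.sub) (B := A.sub)
      (by rintro _ ⟨x, rfl⟩; exact h x) f.strong_range A.strong
    have h2 : (f.toEmbedding.codRestrict A.sub h).toHom.range =
        f.range.sub.comap A.sub.subtype.toHom := by
      ext x
      constructor
      · rintro ⟨y, rfl⟩
        exact ⟨y, rfl⟩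
      · rintro ⟨y, hy⟩
        exact ⟨y, Subtype.ext hy⟩
    exact h2 ▸ h1

/-- An isomorphism as a `K`-embedding. -/
def ofEquiv {M N : K.Model} (e : M ≃[L] N) : Emb M N where
  toEmbedding := e.toEmbedding
  strong_range := by
    have h : e.toEmbedding.toHom.range = ⊤ := by
      ext y
      exact ⟨fun _ => trivial, fun _ => ⟨e.symm y, e.apply_symm_apply y⟩⟩
    rw [h]
    exact K.strong_top N.mem

/-- The identity embedding. -/
def id (M : K.Model) : Emb M M := ofEquiv (FirstOrder.Language.Equiv.refl L M)

theorem map_id {M : K.Model} (A : Submodel M) : A.map (id M) = A :=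
  Submodel.ext_mem fun x => ⟨by rintro ⟨y, hy, rfl⟩; exact hy, fun h => ⟨x, h, rfl⟩⟩

/-- The inverse of an embedding, on its range. -/
noncomputable def rangeInv {M N : K.Model} (f : Emb M N) : Emb f.range.toModel M :=
  ofEquiv (M := f.range.toModel) f.toEmbedding.equivRange.symm

theorem apply_rangeInv {M N : K.Model} (f : Emb M N) (y : f.range.toModel) :
    f (f.rangeInv y) = y.1 := by
  have h := f.toEmbedding.equivRange.apply_symm_apply y
  exact congrArg Subtype.val h

theorem rangeInv_apply {M N : K.Model} (f : Emb M N) (x : M) (h : f x ∈ f.range) :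
    f.rangeInv (⟨f x, h⟩ : f.range.sub) = x :=
  f.injective (f.apply_rangeInv ⟨f x, h⟩)

end Emb

namespace Submodel

/-- The whole model as a submodel of itself. -/
def top (N : K.Model) : Submodel N := ⟨⊤, K.strong_top N.mem⟩

theorem mem_top {N : K.Model} (x : N) : x ∈ top N := trivial

theorem le_top {N : K.Model} (A : Submodel N) : A ≤ top N := fun _ _ => trivial

theorem card_le {N : K.Model} (A : Submodel N) : #A.toModel ≤ #N := A.subtype.card_le

theorem card_map {M N : K.Model} (A : Submodel M) (f : Emb M N) :
    #(A.map f).toModel = #A.toModel := by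
  apply le_antisymm
  · refine Cardinal.mk_le_of_surjective
      (f := fun x : A.sub => (⟨f x.1, mem_map_of_mem f x.2⟩ : (A.map f).sub)) ?_
    rintro ⟨_, x, hx, rfl⟩
    exact ⟨⟨x, hx⟩, rfl⟩
  · refine Cardinal.mk_le_of_injective
      (f := fun x : A.sub => (⟨f x.1, mem_map_of_mem f x.2⟩ : (A.map f).sub)) ?_
    intro x y h
    exact Subtype.ext (f.injective (congrArg Subtype.val h))

end Submodel

/-! ### Löwenheim–Skolem and bounds on sequences -/

theorem LS_mem (K : AEC L) : ℵ₀ ≤ K.LS ∧ L.card ≤ K.LS ∧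
    ∀ (M : Type w) [L.Structure M], K.Mem M → ∀ S : Set M,
      ∃ A : L.Substructure M, K.Strong A ∧ S ⊆ A ∧ #A ≤ #S + K.LS := by
  obtain ⟨κ, h1, h2, h3⟩ := K.exists_LS
  exact csInf_mem (s := {κ : Cardinal.{w} | ℵ₀ ≤ κ ∧ L.card ≤ κ ∧
    ∀ (M : Type w) [L.Structure M], K.Mem M → ∀ S : Set M,
      ∃ A : L.Substructure M, K.Strong A ∧ S ⊆ A ∧ #A ≤ #S + κ}) ⟨κ, h1, h2, fun M _ => h3⟩

theorem exists_submodel {κ : Cardinal.{w}} (hκ : K.LS ≤ κ) (N : K.Model) (S : Set N)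
    (hS : #S ≤ κ) : ∃ A : Submodel N, (∀ x ∈ S, x ∈ A) ∧ #A.toModel ≤ κ := by
  obtain ⟨h1, -, h2⟩ := K.LS_mem
  obtain ⟨A, hA, hSA, hc⟩ := h2 N N.mem S
  refine ⟨⟨A, hA⟩, fun x hx => hSA hx, hc.trans ?_⟩
  exact Cardinal.add_le_of_le (h1.trans hκ) hS hκ

/-- The Löwenheim–Skolem hull of the two images replaces `P`. It keeps amalgams small, so that
iterated amalgamation does not leave the class of the frame. -/
theorem exists_shrink_cospan {κ : Cardinal.{w}} (hκ : K.LS ≤ κ) {M N P : K.Model} (f : Emb M P)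
    (g : Emb N P) (hM : #M ≤ κ) (hN : #N ≤ κ) :
    ∃ (P' : K.Model) (j : Emb P' P) (f' : Emb M P') (g' : Emb N P'), #P' ≤ κ ∧
      (∀ x, j (f' x) = f x) ∧ ∀ x, j (g' x) = g x := by
  have hinf : ℵ₀ ≤ κ := K.LS_mem.1.trans hκ
  obtain ⟨A, hA, hc⟩ := exists_submodel hκ P (Set.range f ∪ Set.range g)
    ((Cardinal.mk_union_le _ _).trans (Cardinal.add_le_of_le hinf
      (Cardinal.mk_range_le.trans hM) (Cardinal.mk_range_le.trans hN)))
  exact ⟨A.toModel, A.subtype, f.codRestrict A fun x => hA _ (Or.inl ⟨x, rfl⟩),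
    g.codRestrict A fun x => hA _ (Or.inr ⟨x, rfl⟩), hc, fun _ => rfl, fun _ => rfl⟩

theorem one_pos_mem : (0 : Ordinal.{w}) ∈ Iio (1 : Ordinal.{w}) := mem_Iio.mpr zero_lt_one

theorem eq_single {X : Type w} (a : Iio (1 : Ordinal.{w}) → X) : ∃ x, a = single x :=
  ⟨a ⟨0, one_pos_mem⟩, funext fun i => congrArg a (Subtype.ext (Order.lt_one_iff.mp i.2))⟩

theorem mk_range_seq_le {X : Type w} {β : Ordinal.{w}} (a : Iio β → X) :
    #(Set.range a) ≤ β.card := by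
  have h := Cardinal.mk_range_le_lift (f := a)
  rw [Cardinal.mk_Iio_ordinal, Cardinal.lift_lift] at h
  exact Cardinal.lift_le.{w + 1, w}.mp h

theorem card_le_of_injective_seq {X : Type w} {β : Ordinal.{w}} {a : Iio β → X}
    (h : Function.Injective a) : β.card ≤ #X := by
  have h := Cardinal.mk_le_of_injective (f := fun i => (ULift.up.{w + 1} (a i)))
    (fun i j hij => h (congrArg ULift.down hij))
  rw [Cardinal.mk_Iio_ordinal, Cardinal.mk_uLift] at h
  exact Cardinal.lift_le.{w + 1, w}.mp h

theorem gtp_eq_of_atomic {M N₁ N₂ P : K.Model} {β : Ordinal.{w}} {f₁ : Emb M N₁} {f₂ : Emb M N₂}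
    {a₁ : Iio β → N₁} {a₂ : Iio β → N₂} (u : Emb N₁ P) (v : Emb N₂ P)
    (h : ∀ x, u (f₁ x) = v (f₂ x)) (ha : ∀ i, u (a₁ i) = v (a₂ i)) : gtp f₁ a₁ = gtp f₂ a₂ :=
  Quot.sound ⟨P, u, v, h, ha⟩

/-! ### Nonforking of single elements in a good⁻ frame -/

namespace FrameData

variable {s : FrameData K}

theorem InF.of_card_le {M N P : K.Model} (hM : s.InF M) (hP : s.InF P) (h₁ : #M ≤ #N)
    (h₂ : #N ≤ #P) : s.InF N :=
  ⟨hM.1.trans h₁, lt_of_le_of_lt (WithTop.coe_le_coe.mpr h₂) hP.2⟩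

theorem InF.of_emb {M N P : K.Model} (hM : s.InF M) (hP : s.InF P) (f : Emb M N)
    (g : Emb N P) : s.InF N :=
  hM.of_card_le hP f.card_le g.card_le

theorem InF.of_le_max {M N₁ N₂ P : K.Model} (hM : s.InF M) (h₁ : s.InF N₁) (h₂ : s.InF N₂)
    (hP : #M ≤ #P) (h : #P ≤ max #N₁ #N₂) : s.InF P := by
  rcases le_total (#N₁) (#N₂) with h' | h'
  · rw [max_eq_right h'] at h
    exact hM.of_card_le h₂ hP h
  · rw [max_eq_left h'] at h
    exact hM.of_card_le h₁ hP h

theorem InF.map {M N : K.Model} {A : Submodel M} (h : s.InF A.toModel) (f : Emb M N) :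
    s.InF (A.map f).toModel :=
  h.of_card_le h (A.card_map f).ge (A.card_map f).le

theorem inF_range {M N : K.Model} (f : Emb M N) : s.InF f.range.toModel ↔ s.InF M := by
  have h : #f.range.toModel = #M :=
    le_antisymm f.rangeInv.card_le
      (f.codRestrict f.range f.mem_range_self).card_le
  exact ⟨fun h' => h'.of_card_le h' h.le h.ge, fun h' => h'.of_card_le h' h.ge h.le⟩

/-- Nonforking of single elements. -/
abbrev nf₁ (s : FrameData K) {N : K.Model} (M₀ M₁ : Submodel N) (x : N) : Prop :=
  s.nf M₀ M₁ (single x)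

theorem doesNotFork_incl {N : K.Model} {A B : Submodel N} {x : N} (h : s.nf₁ A B x)
    (hAB : A ≤ B) : s.DoesNotFork (Submodel.inclusion hAB) (gtp B.subtype (single x)) := by
  refine ⟨N, B.subtype, single x, rfl, ?_⟩
  have e : B.subtype.comp (Submodel.inclusion hAB) = A.subtype := rfl
  rw [e, Emb.range_subtype, Emb.range_subtype]
  exact h

namespace IsPreFrame

variable (hs : s.IsPreFrame)
include hs

theorem exists_shrink {M N P : K.Model} (f : Emb M P) (g : Emb N P) (hM : s.InF M)
    (hN : s.InF N) :
    ∃ (P' : K.Model) (j : Emb P' P) (f' : Emb M P') (g' : Emb N P'), s.InF P' ∧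
      #P' ≤ max #M #N ∧ (∀ x, j (f' x) = f x) ∧ ∀ x, j (g' x) = g x := by
  obtain ⟨P', j, f', g', h, h1, h2⟩ := exists_shrink_cospan (κ := max #M #N)
    (hs.LS_le.trans (hM.1.trans (le_max_left _ _))) f g (le_max_left _ _) (le_max_right _ _)
  exact ⟨P', j, f', g', hM.of_le_max hM hN f'.card_le h, h, h1, h2⟩

/-- Going back, one shrinks the ambient model to the range of `f` and pulls back along the inverse
isomorphism. Nonforking can therefore be computed in any convenient ambient model of the class. -/
theorem nf_map_iff {N P : K.Model} (f : Emb N P) (hP : s.InF P) {β : Ordinal.{w}}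
    {M₀ M₁ : Submodel N} {a : Iio β → N} :
    s.nf (M₀.map f) (M₁.map f) (fun i => f (a i)) ↔ s.nf M₀ M₁ a := by
  refine ⟨fun h => ?_, hs.nf_extend f hP⟩
  have key : ∀ A : Submodel N, A.map f ≤ f.range := by
    rintro A _ ⟨x, -, rfl⟩
    exact ⟨x, rfl⟩
  have h1 := hs.nf_shrink (N' := f.range) (key M₀) (key M₁) (fun i => ⟨a i, rfl⟩) h
  have h2 := hs.nf_iso f.rangeInv
    (fun x => ⟨⟨f x, f.mem_range_self x⟩, f.rangeInv_apply x _⟩) h1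
  have h3 : ∀ A : Submodel N, (Submodel.within (key A)).map f.rangeInv = A := by
    intro A
    refine Submodel.ext_mem fun x => ⟨?_, fun hx => ?_⟩
    · rintro ⟨y, hy, rfl⟩
      obtain ⟨z, hz, hzy⟩ := (Submodel.mem_within (key A)).mp hy
      have : f.rangeInv y = z := f.injective ((f.apply_rangeInv y).trans hzy.symm)
      exact this ▸ hz
    · exact ⟨⟨f x, f.mem_range_self x⟩, (Submodel.mem_within (key A)).mpr ⟨x, hx, rfl⟩,
        f.rangeInv_apply x _⟩
  rw [h3, h3] at h2
  have h4 : (fun i => f.rangeInv (⟨f (a i), ⟨a i, rfl⟩⟩ : f.range.sub)) = a :=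
    funext fun i => f.rangeInv_apply (a i) _
  exact h4 ▸ h2

theorem nf₁_map_iff {N P : K.Model} (f : Emb N P) (hP : s.InF P) {M₀ M₁ : Submodel N} {x : N} :
    s.nf₁ (M₀.map f) (M₁.map f) (f x) ↔ s.nf₁ M₀ M₁ x :=
  hs.nf_map_iff f hP (a := single x)

theorem nf₁_mono {N : K.Model} {M₀ M₀' M₁' M₁ : Submodel N} {x : N} (h : s.nf₁ M₀ M₁ x)
    (h₀ : M₀ ≤ M₀') (h₁ : M₀' ≤ M₁') (h₂ : M₁' ≤ M₁) : s.nf₁ M₀' M₁' x :=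
  hs.nf_mono _root_.id strictMono_id h₀ h₁ h₂ h

theorem nf₁_le {N : K.Model} {M₀ M₁ : Submodel N} {x : N} (h : s.nf₁ M₀ M₁ x) : M₀ ≤ M₁ :=
  (hs.nf_dom h).1

theorem gtp_mem_bs {N : K.Model} {M₀ M₁ : Submodel N} {x : N} (h : s.nf₁ M₀ M₁ x) :
    gtp M₁.subtype (single x) ∈ s.bs M₁.toModel 1 :=
  hs.bs_of_nf (hs.nf₁_mono h (hs.nf₁_le h) (Submodel.le_refl _) (Submodel.le_refl _))

theorem notMem_of_nf₁ {N : K.Model} {M₀ M₁ : Submodel N} {x : N} (h : s.nf₁ M₀ M₁ x) :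
    x ∉ M₁ := by
  have h1 := hs.bs_na _ _ (hs.gtp_mem_bs h) ⟨0, one_pos_mem⟩
  rwa [Emb.range_subtype] at h1

end IsPreFrame

namespace IsGoodMinus

variable (hs : s.IsGoodMinus)
include hs

theorem exists_amalgam {M N₁ N₂ : K.Model} (f₁ : Emb M N₁) (f₂ : Emb M N₂) (hM : s.InF M)
    (h₁ : s.InF N₁) (h₂ : s.InF N₂) :
    ∃ (P : K.Model) (u : Emb N₁ P) (v : Emb N₂ P), s.InF P ∧ #P ≤ max #N₁ #N₂ ∧
      ∀ x, u (f₁ x) = v (f₂ x) := by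
  obtain ⟨P, u, v, -, h⟩ := hs.amalgamation M N₁ N₂ f₁ f₂ hM h₁ h₂
  obtain ⟨P', j, u', v', hP', hc, hu, hv⟩ := hs.exists_shrink u v h₁ h₂
  exact ⟨P', u', v', hP', hc, fun x => j.injective (by rw [hu, hv, h])⟩

/-- Amalgamation makes the one-step relation transitive. The representatives linking two equal types
range over all models, possibly outside the class of the frame, so the induction speaks of models of
the class that embed into them. -/
theorem exists_amalgam_of_eqvGen {M : K.Model} {β : Ordinal.{w}} (hM : s.InF M)
    (hβ : ((β.card : Cardinal.{w}) : WithTop Cardinal.{w}) < s.theta) {r t : Rep M β}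
    (h : Relation.EqvGen Rep.Atomic r t) :
    ∀ (N₁ N₂ : K.Model) (u₁ : Emb N₁ r.N) (u₂ : Emb N₂ t.N) (f₁ : Emb M N₁) (f₂ : Emb M N₂)
      (a₁ : Iio β → N₁) (a₂ : Iio β → N₂), s.InF N₁ → s.InF N₂ →
      (∀ x, u₁ (f₁ x) = r.emb x) → (∀ i, u₁ (a₁ i) = r.seq i) →
      (∀ x, u₂ (f₂ x) = t.emb x) → (∀ i, u₂ (a₂ i) = t.seq i) →
      ∃ (P : K.Model) (u : Emb N₁ P) (v : Emb N₂ P), s.InF P ∧ #P ≤ max #N₁ #N₂ ∧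
        (∀ x, u (f₁ x) = v (f₂ x)) ∧ ∀ i, u (a₁ i) = v (a₂ i) := by
  induction h with
  | rel r t h =>
    intro N₁ N₂ u₁ u₂ f₁ f₂ a₁ a₂ hN₁ hN₂ e₁ e₂ e₃ e₄
    obtain ⟨P, g, k, h1, h2⟩ := h
    obtain ⟨P', j, u', v', hP', hc, hu, hv⟩ :=
      hs.exists_shrink (g.comp u₁) (k.comp u₂) hN₁ hN₂
    refine ⟨P', u', v', hP', hc, fun x => j.injective ?_, fun i => j.injective ?_⟩
    · rw [hu, hv, Emb.comp_apply, Emb.comp_apply, e₁, e₃, h1]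
    · rw [hu, hv, Emb.comp_apply, Emb.comp_apply, e₂, e₄, h2]
  | refl r =>
    intro N₁ N₂ u₁ u₂ f₁ f₂ a₁ a₂ hN₁ hN₂ e₁ e₂ e₃ e₄
    obtain ⟨P', j, u', v', hP', hc, hu, hv⟩ := hs.exists_shrink u₁ u₂ hN₁ hN₂
    refine ⟨P', u', v', hP', hc, fun x => j.injective ?_, fun i => j.injective ?_⟩
    · rw [hu, hv, e₁, e₃]
    · rw [hu, hv, e₂, e₄]
  | symm r t h ih =>
    intro N₁ N₂ u₁ u₂ f₁ f₂ a₁ a₂ hN₁ hN₂ e₁ e₂ e₃ e₄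
    obtain ⟨P, u, v, hP, hc, h1, h2⟩ := ih N₂ N₁ u₂ u₁ f₂ f₁ a₂ a₁ hN₂ hN₁ e₃ e₄ e₁ e₂
    exact ⟨P, v, u, hP, by rwa [max_comm], fun x => (h1 x).symm, fun i => (h2 i).symm⟩
  | trans r t q h h' ih ih' =>
    intro N₁ N₂ u₁ u₂ f₁ f₂ a₁ a₂ hN₁ hN₂ e₁ e₂ e₃ e₄
    -- The middle representative is cut down to a hull of `M` and the sequence; `hβ` keeps the hull
    -- below `θ`, so amalgamation over it is available.
    have hl : K.LS ≤ max #M β.card := hs.LS_le.trans (hM.1.trans (le_max_left _ _))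
    obtain ⟨A, hA, hAc⟩ := exists_submodel hl t.N (Set.range t.emb ∪ Set.range t.seq)
      ((Cardinal.mk_union_le _ _).trans (Cardinal.add_le_of_le (K.LS_mem.1.trans hl)
        (Cardinal.mk_range_le.trans (le_max_left _ _))
        ((mk_range_seq_le t.seq).trans (le_max_right _ _))))
    have hA1 : ∀ x, t.emb x ∈ A := fun x => hA _ (Or.inl ⟨x, rfl⟩)
    have hA2 : ∀ i, t.seq i ∈ A := fun i => hA _ (Or.inr ⟨i, rfl⟩)
    let f : Emb M A.toModel := t.emb.codRestrict A hA1
    let a : Iio β → A.toModel := fun i => ⟨t.seq i, hA2 i⟩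
    have hAF : s.InF A.toModel := by
      refine ⟨hM.1.trans f.card_le, lt_of_le_of_lt (WithTop.coe_le_coe.mpr hAc) ?_⟩
      rcases le_total (#M) β.card with h' | h'
      · rwa [max_eq_right h']
      · rw [max_eq_left h']
        exact hM.2
    obtain ⟨P, u, v, hP, -, h1, h2⟩ :=
      ih N₁ A.toModel u₁ A.subtype f₁ f a₁ a hN₁ hAF e₁ e₂ (fun _ => rfl) (fun _ => rfl)
    obtain ⟨P', u', v', hP', -, h1', h2'⟩ :=
      ih' A.toModel N₂ A.subtype u₂ f f₂ a a₂ hAF hN₂ (fun _ => rfl) (fun _ => rfl) e₃ e₄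
    obtain ⟨Q, k, k', -, -, hk⟩ := hs.exists_amalgam v u' hAF hP hP'
    obtain ⟨Q', j, l, l', hQ', hc, hl, hl'⟩ :=
      hs.exists_shrink (k.comp u) (k'.comp v') hN₁ hN₂
    refine ⟨Q', l, l', hQ', hc, fun x => j.injective ?_, fun i => j.injective ?_⟩
    · rw [hl, hl', Emb.comp_apply, Emb.comp_apply, h1, hk, h1']
    · rw [hl, hl', Emb.comp_apply, Emb.comp_apply, h2, hk, h2']

/-- Over a model of the frame, equality of types is witnessed by a single amalgam. -/
theorem exists_amalgam_of_gtp_eq {M N₁ N₂ : K.Model} {β : Ordinal.{w}} (hM : s.InF M)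
    (hβ : ((β.card : Cardinal.{w}) : WithTop Cardinal.{w}) < s.theta)
    (h₁ : s.InF N₁) (h₂ : s.InF N₂) {f₁ : Emb M N₁} {f₂ : Emb M N₂} {a₁ : Iio β → N₁}
    {a₂ : Iio β → N₂} (h : gtp f₁ a₁ = gtp f₂ a₂) :
    ∃ (P : K.Model) (u : Emb N₁ P) (v : Emb N₂ P), s.InF P ∧ #P ≤ max #N₁ #N₂ ∧
      (∀ x, u (f₁ x) = v (f₂ x)) ∧ ∀ i, u (a₁ i) = v (a₂ i) :=
  hs.exists_amalgam_of_eqvGen hM hβ (Quot.eqvGen_exact h) N₁ N₂ (Emb.id _) (Emb.id _) f₁ f₂ a₁ a₂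
    h₁ h₂ (fun _ => rfl) (fun _ => rfl) (fun _ => rfl) (fun _ => rfl)

theorem one_lt_theta : (((1 : Ordinal.{w}).card : Cardinal.{w}) : WithTop Cardinal.{w}) < s.theta := by
  refine lt_of_le_of_lt (WithTop.coe_le_coe.mpr ?_) hs.lam_lt_theta
  rw [Ordinal.card_one]
  exact Cardinal.one_le_aleph0.trans (K.LS_mem.1.trans hs.LS_le)

theorem exists_amalgam_of_gtp_single_eq {M N₁ N₂ : K.Model} (hM : s.InF M)
    (h₁ : s.InF N₁) (h₂ : s.InF N₂) {f₁ : Emb M N₁} {f₂ : Emb M N₂} {x₁ : N₁} {x₂ : N₂}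
    (h : gtp f₁ (single x₁) = gtp f₂ (single x₂)) :
    ∃ (P : K.Model) (u : Emb N₁ P) (v : Emb N₂ P), s.InF P ∧ #P ≤ max #N₁ #N₂ ∧
      (∀ x, u (f₁ x) = v (f₂ x)) ∧ u x₁ = v x₂ := by
  obtain ⟨P, u, v, hP, hc, h1, h2⟩ := hs.exists_amalgam_of_gtp_eq hM hs.one_lt_theta h₁ h₂ h
  exact ⟨P, u, v, hP, hc, h1, h2 ⟨0, one_pos_mem⟩⟩

/-- Both realizations have a common image in one amalgam over `M`, and nonforking passes in and out
of ambient models. -/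
theorem nf₁_of_gtp_eq {M N₁ N₂ : K.Model} (h₂ : s.InF N₂) {f₁ : Emb M N₁}
    {f₂ : Emb M N₂} {x₁ : N₁} {x₂ : N₂} (h : gtp f₁ (single x₁) = gtp f₂ (single x₂))
    {A B : Submodel M} (hA : s.nf₁ (A.map f₁) (B.map f₁) x₁) :
    s.nf₁ (A.map f₂) (B.map f₂) x₂ := by
  have hB := (hs.nf_dom hA).2.2.2.1
  have h₁ := (hs.nf_dom hA).2.2.2.2
  have hM : s.InF M := (hB.of_card_le hB (B.card_map f₁).le (B.card_map f₁).ge).of_emb h₁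
    B.subtype f₁
  obtain ⟨P, u, v, hP, -, h1, h2⟩ := hs.exists_amalgam_of_gtp_single_eq hM h₁ h₂ h
  have h3 := (hs.nf₁_map_iff u hP).mpr hA
  have e : u.comp f₁ = v.comp f₂ := Emb.ext h1
  rw [← Emb.map_comp, ← Emb.map_comp, e, Emb.map_comp, Emb.map_comp, h2] at h3
  exact (hs.nf₁_map_iff v hP).mp h3

theorem nf₁_of_doesNotFork {M₀ M N : K.Model} {h : Emb M₀ M} {f : Emb M N} {x : N}
    (hN : s.InF N) (hd : s.DoesNotFork h (gtp f (single x))) :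
    s.nf₁ (f.comp h).range f.range x := by
  obtain ⟨N', f', a, he, hn⟩ := hd
  obtain ⟨y, rfl⟩ := eq_single a
  have e : f'.range = (Emb.id M).range.map f' := by rw [Emb.map_range]; rfl
  rw [Emb.range_comp, e] at hn
  have := hs.nf₁_of_gtp_eq hN he.symm hn
  rwa [Emb.map_range, Emb.map_range] at this

theorem nf₁_of_doesNotFork_incl {N : K.Model} {A B : Submodel N} {x : N} (hN : s.InF N)
    (hAB : A ≤ B) (h : s.DoesNotFork (Submodel.inclusion hAB) (gtp B.subtype (single x))) :
    s.nf₁ A B x := by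
  have h1 := hs.nf₁_of_doesNotFork hN h
  have e : B.subtype.comp (Submodel.inclusion hAB) = A.subtype := rfl
  rwa [e, Emb.range_subtype, Emb.range_subtype] at h1

theorem nf₁_trans {N : K.Model} {A B C : Submodel N} {x : N} (h₁ : s.nf₁ A B x)
    (h₂ : s.nf₁ B C x) : s.nf₁ A C x := by
  have hAB := hs.nf₁_le h₁
  have hBC := hs.nf₁_le h₂
  exact hs.nf₁_of_doesNotFork_incl (hs.nf_dom h₁).2.2.2.2 (Submodel.le_trans hAB hBC)
    (hs.transitivity _ _ _ (Submodel.inclusion hAB) (Submodel.inclusion hBC) 1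
      (gtp C.subtype (single x)) (doesNotFork_incl h₂ hBC) (doesNotFork_incl h₁ hAB))

/-- Basic types do not fork over their base. -/
theorem nf₁_of_mem_bs {N : K.Model} {A : Submodel N} {x : N} (hN : s.InF N)
    (h : gtp A.subtype (single x) ∈ s.bs A.toModel 1) : s.nf₁ A A x := by
  obtain ⟨hA, h1⟩ := hs.bs_dom h
  obtain ⟨q, -, hd, hq⟩ := hs.existence A.toModel A.toModel (Submodel.inclusion (Submodel.le_refl A))
    1 1 le_rfl _ h hA h1
  have e : q.restrict (Submodel.inclusion (Submodel.le_refl A)) le_rfl = q := by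
    induction q using Quot.inductionOn
    rfl
  rw [e] at hq
  subst hq
  exact hs.nf₁_of_doesNotFork_incl hN (Submodel.le_refl A) hd

/-- Nonforking of a single element is continuous in the larger model. -/
theorem nf₁_limit {N : K.Model} (hN : s.InF N) {δ : Ordinal.{w}} (hδ : Order.IsSuccLimit δ)
    {D : Ordinal.{w} → Submodel N} (hD : IsContChain D δ) {A : Submodel N} {x : N}
    (h : ∀ i < δ, s.nf₁ A (D i) x) : s.nf₁ A (D δ) x := by
  have hpos : 0 < δ := hδ.bot_lt
  have hA0 := hs.nf₁_le (h 0 hpos)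
  -- The continuity axiom is about nonforking over the first model of the chain; the smaller base
  -- `A` is recovered at the end by transitivity.
  have h0 : ∀ i < δ, s.nf₁ (D 0) (D i) x := fun i hi =>
    hs.nf₁_mono (h i hi) hA0 (hD.mono 0 i zero_le hi.le) (Submodel.le_refl _)
  have hF : ∀ i ≤ δ, s.InF (D i).toModel := fun i hi =>
    (hs.nf_dom (h 0 hpos)).2.2.2.1.of_emb hN (Submodel.inclusion (hD.mono 0 i zero_le hi))
      (D i).subtype
  have hlen : (1 : Ordinal.{w}) < s.len := (hs.nf_dom (h 0 hpos)).2.1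
  have key := (hs.continuity N δ D hD (fun _ => 1) (fun _ _ _ _ => le_rfl)
    (fun i _ => gtp (D i).subtype (single x)) hδ hF (fun _ _ => hlen)
    (fun j _ hj => by
      have : (fun _ : Ordinal.{w} => (1 : Ordinal.{w})) '' Iio j = {1} :=
        Set.Nonempty.image_const ⟨0, hj.bot_lt⟩ 1
      rw [this]
      exact isLUB_singleton)
    (fun i hi => hs.gtp_mem_bs (h i hi)) (fun j i hji hi => rfl)).2
    (fun i hi => doesNotFork_incl (h0 i hi) _) (gtp (D δ).subtype (single x))
    (fun i hi => rfl)
  exact hs.nf₁_trans (h 0 hpos) (hs.nf₁_of_doesNotFork_incl hN _ key)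

/-- Nonforking amalgamation of an element: `N ∋ x` and `P` are amalgamated over `M` so that `x` does
not fork from `P` over `M₀`. -/
theorem exists_nf_amalgam {M N P : K.Model} (f : Emb M N) (h : Emb M P) (hP : s.InF P)
    {A : Submodel M} {x : N} (hx : s.nf₁ (A.map f) f.range x) :
    ∃ (Q : K.Model) (u : Emb N Q) (g : Emb P Q), s.InF Q ∧ #Q ≤ max #N #P ∧
      (∀ y, u (f y) = g (h y)) ∧ s.nf₁ ((A.map h).map g) g.range (u x) := by
  have hN := (hs.nf_dom hx).2.2.2.2
  have hR := (hs.nf_dom hx).2.2.2.1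
  have hM : s.InF M := (inF_range f).mp hR
  -- A nonforking extension over `P` of the type of `x` is realized by some `y`. Since `x` and `y`
  -- have the same type over the image of `M`, an amalgam identifies them; transitivity then lowers
  -- the base from `M` to `A`.
  obtain ⟨q, -, hd, hq⟩ := hs.existence f.range.toModel P (h.comp f.rangeInv) 1 1 le_rfl _
    (hs.gtp_mem_bs hx) hP (hs.nf_dom hx).2.1
  have hd' := hd
  obtain ⟨N', f', a, rfl, hn⟩ := hd
  obtain ⟨y, rfl⟩ := eq_single a
  have hN' := (hs.nf_dom hn).2.2.2.2
  have hq' : gtp f.range.subtype (single x) = gtp (f'.comp (h.comp f.rangeInv)) (single y) :=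
    hq.symm
  obtain ⟨Q, u, v, hQ, -, h1, h2⟩ := hs.exists_amalgam_of_gtp_single_eq hR hN hN' hq'
  obtain ⟨Q', j, u', g', hQ', hc, hu, hg⟩ := hs.exists_shrink u (v.comp f') hN hP
  have h1' : ∀ y, u' (f y) = g' (h y) := fun y => j.injective <|
    (hu _).trans ((h1 ⟨f y, f.mem_range_self y⟩).trans
      ((congrArg (fun z => v (f' (h z))) (f.rangeInv_apply y _)).trans (hg _).symm))
  refine ⟨Q', u', g', hQ', hc, h1', ?_⟩
  have e1 : v.comp f' = j.comp g' := Emb.ext fun x => (hg x).symm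
  have n1 := (hs.nf₁_map_iff v hQ).mpr hn
  rw [Emb.map_range, Emb.map_range, ← h2, e1, ← hu x, ← Emb.map_range j g'] at n1
  have e2 : (v.comp (f'.comp (h.comp f.rangeInv))).range = ((g'.comp h).range).map j := by
    refine Submodel.ext_mem fun z => ⟨?_, ?_⟩
    · rintro ⟨t, rfl⟩
      exact ⟨_, ⟨f.rangeInv t, rfl⟩, hg _⟩
    · rintro ⟨_, ⟨t, rfl⟩, rfl⟩
      refine ⟨⟨f t, f.mem_range_self t⟩, ?_⟩
      refine Eq.trans ?_ (hg (h t)).symm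
      exact congrArg (fun z => v (f' (h z))) (f.rangeInv_apply t _)
  rw [e2] at n1
  have n2 := (hs.nf₁_map_iff j hQ).mp n1
  have n3 := (hs.nf₁_map_iff u' hQ').mpr hx
  have e3 : u'.comp f = g'.comp h := Emb.ext h1'
  rw [← Emb.map_comp, Emb.map_range, e3, Emb.map_comp] at n3
  exact hs.nf₁_trans n3 n2

end IsGoodMinus

end FrameData

/-! ### Unions of chains and gluing of embeddings -/

theorem toOrd_lt {δ : Ordinal.{w}} (i : δ.ToType) : (Ordinal.ToType.toOrd i).1 < δ :=
  (Ordinal.ToType.toOrd i).2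

theorem toOrd_le {δ : Ordinal.{w}} {i j : δ.ToType} (h : i ≤ j) :
    (Ordinal.ToType.toOrd i).1 ≤ (Ordinal.ToType.toOrd j).1 :=
  Ordinal.ToType.mk.symm.monotone h

theorem exists_toOrd_eq {δ i : Ordinal.{w}} (h : i < δ) :
    ∃ j : δ.ToType, (Ordinal.ToType.toOrd j).1 = i :=
  ⟨Ordinal.ToType.mk ⟨i, h⟩, congrArg Subtype.val (Ordinal.ToType.mk.symm_apply_apply ⟨i, h⟩)⟩

theorem nonempty_toType {δ : Ordinal.{w}} (h : 0 < δ) : Nonempty δ.ToType :=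
  ⟨Ordinal.ToType.mk ⟨0, h⟩⟩

theorem exists_bound {δ : Ordinal.{w}} (hδ : 0 < δ) {n : ℕ} {r : Fin n → Ordinal.{w} → Prop}
    (hr : ∀ k i j, i ≤ j → j < δ → r k i → r k j) (h : ∀ k, ∃ i < δ, r k i) :
    ∃ i < δ, ∀ k, r k i := by
  choose i hi hri using h
  rcases n with _ | n
  · exact ⟨0, hδ, fun k => k.elim0⟩
  · obtain ⟨k₀, hk₀⟩ := Finite.exists_max i
    exact ⟨i k₀, hi k₀, fun k => hr k _ _ (hk₀ k) (hi k₀) (hri k)⟩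

theorem Submodel.exists_iUnion {N : K.Model} {δ : Ordinal.{w}} (hδ : 0 < δ)
    (A : Ordinal.{w} → Submodel N) (hA : ∀ i j, i ≤ j → j < δ → A i ≤ A j) :
    ∃ B : Submodel N, ∀ x, x ∈ B ↔ ∃ i < δ, x ∈ A i := by
  have := nonempty_toType hδ
  let S : δ.ToType → L.Substructure N := fun i => (A (Ordinal.ToType.toOrd i).1).sub
  have hS : ∀ i j, i ≤ j → S i ≤ S j := fun i j h => hA _ _ (toOrd_le h) (toOrd_lt j)
  have hmem : ∀ x, x ∈ (⨆ i, S i) ↔ ∃ i, x ∈ S i := fun x =>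
    FirstOrder.Language.Substructure.mem_iSup_of_directed
      (directed_of_isDirected_le hS)
  refine ⟨⟨⨆ i, S i, K.chain_smooth S _ hS (fun i => (A _).strong) hmem⟩, fun x => ?_⟩
  refine (hmem x).trans ⟨?_, ?_⟩
  · rintro ⟨i, hi⟩
    exact ⟨_, toOrd_lt i, hi⟩
  · rintro ⟨i, hi, hx⟩
    obtain ⟨j, rfl⟩ := exists_toOrd_eq hi
    exact ⟨j, hx⟩

open FirstOrder.Language.Structure in
/-- Compatible embeddings of the members of a chain have a common extension to the union. -/
theorem Emb.exists_glue {N P : K.Model} {δ : Ordinal.{w}} (hδ : 0 < δ)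
    (A : Ordinal.{w} → Submodel N) (hA : ∀ i j, i ≤ j → j < δ → A i ≤ A j) (B : Submodel N)
    (hB : ∀ x, x ∈ B ↔ ∃ i < δ, x ∈ A i) (e : ∀ i, i < δ → Emb (A i).toModel P)
    (he : ∀ i j (_ : i ≤ j) (hi : i < δ) (hj : j < δ) (x : N) (hx : x ∈ A i) (hx' : x ∈ A j),
      e i hi (Submodel.elem hx) = e j hj (Submodel.elem hx')) :
    ∃ f : Emb B.toModel P, ∀ i (hi : i < δ) (x : N) (hx : x ∈ A i) (hx' : x ∈ B),
      f (Submodel.elem hx') = e i hi (Submodel.elem hx) := by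
  have hv : ∀ x : B.sub, ∃ y : P, ∀ i (hi : i < δ) (hx : x.1 ∈ A i),
      e i hi (⟨x.1, hx⟩ : (A i).sub) = y := by
    intro x
    obtain ⟨i, hi, hx⟩ := (hB x.1).mp x.2
    refine ⟨e i hi (⟨x.1, hx⟩ : (A i).sub), fun j hj hx' => ?_⟩
    rcases le_total i j with h | h
    · exact (he i j h hi hj _ hx hx').symm
    · exact he j i h hj hi _ hx' hx
  choose v hv using hv
  -- Finitely many elements of the union lie in one member of the chain, so injectivity, functions
  -- and relations can be checked there.
  have hbd : ∀ {n : ℕ} (x : Fin n → B.sub), ∃ i < δ, ∀ k, (x k).1 ∈ A i := fun x =>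
    exists_bound hδ (r := fun k i => (x k).1 ∈ A i) (fun k i j hij hj h => hA i j hij hj h)
      (fun k => (hB _).mp (x k).2)
  let f : B.sub ↪[L] P :=
    { toFun := v
      inj' := by
        intro x y hxy
        obtain ⟨i, hi, hx⟩ := hbd ![x, y]
        have h0 : x.1 ∈ A i := hx 0
        have h1 : y.1 ∈ A i := hx 1
        rw [← hv x i hi h0, ← hv y i hi h1] at hxy
        have h2 : (⟨x.1, h0⟩ : (A i).sub) = ⟨y.1, h1⟩ := (e i hi).injective hxy
        exact Subtype.ext (congrArg (fun z : (A i).sub => z.1) h2)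
      map_fun' := by
        intro n F x
        obtain ⟨i, hi, hx⟩ := hbd x
        let y : Fin n → (A i).sub := fun k => ⟨(x k).1, hx k⟩
        have h1 : v (funMap F x) = e i hi (funMap F y : (A i).sub) :=
          (hv _ i hi (funMap F y : (A i).sub).2).symm
        rw [h1]
        refine ((e i hi).toEmbedding.map_fun F y).trans (congrArg (funMap F) ?_)
        exact funext fun k => hv (x k) i hi (hx k)
      map_rel' := by
        intro n R x
        obtain ⟨i, hi, hx⟩ := hbd x
        let y : Fin n → (A i).sub := fun k => ⟨(x k).1, hx k⟩
        have h1 : v ∘ x = (e i hi) ∘ y := funext fun k => (hv (x k) i hi (hx k)).symm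
        rw [h1]
        exact (e i hi).toEmbedding.map_rel R y }
  have hf : K.Strong f.toHom.range := by
    have := nonempty_toType hδ
    refine K.chain_smooth (ι := δ.ToType)
      (fun i => (e _ (toOrd_lt i)).range.sub) _ (fun i j hij => ?_)
      (fun i => (e _ (toOrd_lt i)).strong_range) (fun z => ⟨?_, ?_⟩)
    · rintro _ ⟨x, rfl⟩
      have hx := hA _ _ (toOrd_le hij) (toOrd_lt j) x.2
      exact ⟨⟨x.1, hx⟩, (he _ _ (toOrd_le hij) (toOrd_lt i) (toOrd_lt j) x.1 x.2 hx).symm⟩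
    · rintro ⟨x, rfl⟩
      obtain ⟨i, hi, hx⟩ := (hB x.1).mp x.2
      obtain ⟨j, rfl⟩ := exists_toOrd_eq hi
      exact ⟨j, ⟨x.1, hx⟩, hv x _ hi hx⟩
    · rintro ⟨i, x, rfl⟩
      have hx : x.1 ∈ B := (hB x.1).mpr ⟨_, toOrd_lt i, x.2⟩
      exact ⟨⟨x.1, hx⟩, (hv ⟨x.1, hx⟩ _ (toOrd_lt i) x.2).symm⟩
  exact ⟨⟨f, hf⟩, fun i hi x hx hx' => (hv ⟨x, hx'⟩ i hi hx).symm⟩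

/-- A model whose elements are marked by the elements of a set `X`. The marking makes embeddings
that respect it unique, so that chains of marked models commute automatically. -/
structure Marked (K : AEC L) (X : Type w) where
  Q : K.Model
  mark : Q ↪ X

/-! ### Marked models and their direct limits -/

namespace Marked

variable {X : Type w}

def Le (p q : Marked K X) : Prop := ∃ g : Emb p.Q q.Q, ∀ x, q.mark (g x) = p.mark x

theorem Le.refl (p : Marked K X) : p.Le p := ⟨Emb.id _, fun _ => rfl⟩

theorem Le.trans {p q r : Marked K X} (h₁ : p.Le q) (h₂ : q.Le r) : p.Le r := by
  obtain ⟨g, hg⟩ := h₁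
  obtain ⟨k, hk⟩ := h₂
  exact ⟨k.comp g, fun x => (hk _).trans (hg x)⟩

/-- The embedding that respects the marking. -/
noncomputable def Le.emb {p q : Marked K X} (h : p.Le q) : Emb p.Q q.Q := h.choose

theorem Le.mark_emb {p q : Marked K X} (h : p.Le q) (x : p.Q) : q.mark (h.emb x) = p.mark x :=
  h.choose_spec x

theorem Le.emb_eq {p q : Marked K X} (h : p.Le q) {x : p.Q} {y : q.Q}
    (e : q.mark y = p.mark x) : h.emb x = y :=
  q.mark.injective ((h.mark_emb x).trans e.symm)

theorem Le.emb_emb {p q r : Marked K X} (h₁ : p.Le q) (h₂ : q.Le r) (h₃ : p.Le r) (x : p.Q) :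
    h₂.emb (h₁.emb x) = h₃.emb x :=
  r.mark.injective (by rw [h₂.mark_emb, h₁.mark_emb, h₃.mark_emb])

/-- The chosen embeddings form a directed system because marks determine them. The direct limit is
in the class by the chain axiom, and it inherits a marking since the transition maps preserve marks.
-/
theorem exists_union {δ : Ordinal.{w}} (hδ : 0 < δ) (p : Ordinal.{w} → Marked K X)
    (hp : ∀ i j, i ≤ j → j < δ → (p i).Le (p j)) :
    ∃ q : Marked K X, (∀ i < δ, (p i).Le q) ∧
      ∀ y : q.Q, ∃ i < δ, ∃ x : (p i).Q, (p i).mark x = q.mark y := by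
  have := nonempty_toType hδ
  let o : δ.ToType → Ordinal.{w} := fun i => (Ordinal.ToType.toOrd i).1
  have hle : ∀ i j : δ.ToType, i ≤ j → (p (o i)).Le (p (o j)) :=
    fun i j h => hp _ _ (toOrd_le h) (toOrd_lt j)
  let G : δ.ToType → Type w := fun i => (p (o i)).Q
  let _ : ∀ i, L.Structure (G i) := fun i => (p (o i)).Q.str
  let φ : ∀ i j, i ≤ j → G i ↪[L] G j := fun i j h => (hle i j h).emb.toEmbedding
  have : DirectedSystem G fun i j h => φ i j h :=
    { map_self := fun i x => (hle i i (_root_.le_refl i)).emb_eq rfl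
      map_map := fun k j i hij hjk x => (hle i j hij).emb_emb (hle j k hjk) (hle i k (_root_.le_trans hij hjk)) x }
  let U := FirstOrder.Language.DirectLimit G φ
  let c : ∀ i, G i ↪[L] U := fun i => FirstOrder.Language.DirectLimit.of L δ.ToType G φ i
  have hc : ∀ i j (h : i ≤ j) (x : G i), c j (φ i j h x) = c i x := fun i j h x =>
    FirstOrder.Language.DirectLimit.of_f (hij := h)
  have hex : ∀ z : U, ∃ (i : δ.ToType) (x : G i), c i x = z := fun z =>
    FirstOrder.Language.DirectLimit.exists_of z
  have hmono : ∀ i j, i ≤ j → (c i).toHom.range ≤ (c j).toHom.range := by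
    rintro i j h _ ⟨x, rfl⟩
    exact ⟨φ i j h x, hc i j h x⟩
  have hstrong : ∀ i j, i ≤ j →
      K.Strong ((c i).toHom.range.comap (c j).toHom.range.subtype.toHom) := by
    intro i j h
    have h1 := K.strong_equiv (c j).equivRange (hle i j h).emb.strong_range
    convert h1 using 1
    ext z
    constructor
    · rintro ⟨x, hx⟩
      refine ⟨φ i j h x, ⟨x, rfl⟩, Subtype.ext ?_⟩
      exact (hc i j h x).trans hx
    · rintro ⟨_, ⟨x, rfl⟩, rfl⟩
      exact ⟨x, (hc i j h x).symm⟩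
  obtain ⟨hU, hcs⟩ := K.chain_union (fun i => (c i).toHom.range)
    (fun i => K.mem_equiv (c i).equivRange (p (o i)).Q.mem)
    (fun i j h => ⟨hmono i j h, hstrong i j h⟩)
    (fun z => by obtain ⟨i, x, rfl⟩ := hex z; exact ⟨i, x, rfl⟩)
  have hm : ∀ z : U, ∃ t : X, ∀ (i : δ.ToType) (x : G i), c i x = z → (p (o i)).mark x = t := by
    intro z
    obtain ⟨i, x, rfl⟩ := hex z
    refine ⟨(p (o i)).mark x, fun j y hy => ?_⟩
    rcases le_total i j with h | h
    · have : y = φ i j h x := (c j).injective (hy.trans (hc i j h x).symm)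
      rw [this]
      exact (hle i j h).mark_emb x
    · have : φ j i h y = x := (c i).injective ((hc j i h y).trans hy)
      rw [← this]
      exact ((hle j i h).mark_emb y).symm
  choose m hm using hm
  have hinj : Function.Injective m := by
    intro z z' hz
    obtain ⟨i, x, rfl⟩ := hex z
    obtain ⟨j, y, rfl⟩ := hex z'
    rw [← hm _ i x rfl, ← hm _ j y rfl] at hz
    rcases le_total i j with h | h
    · have : (hle i j h).emb x = y := (hle i j h).emb_eq hz.symm
      rw [← this]
      exact (hc i j h x).symm
    · have : (hle j i h).emb y = x := (hle j i h).emb_eq hz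
      rw [← this]
      exact hc j i h y
  refine ⟨⟨⟨U, hU⟩, ⟨m, hinj⟩⟩, fun i hi => ?_, fun y => ?_⟩
  · obtain ⟨j, rfl⟩ := exists_toOrd_eq hi
    exact ⟨⟨c j, hcs j⟩, fun x => (hm _ j x rfl).symm⟩
  · obtain ⟨i, x, rfl⟩ := hex y
    exact ⟨o i, toOrd_lt i, x, hm _ i x rfl⟩

/-- Markings extend along embeddings when there is enough room. -/
theorem exists_extend {p : Marked K X} {Q : K.Model} (g : Emb p.Q Q) (hX : ℵ₀ ≤ #X)
    (hp : #p.Q < #X) (hQ : #Q ≤ #X) : ∃ m : Q ↪ X, ∀ x, m (g x) = p.mark x := by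
  classical
  have : Infinite X := Cardinal.infinite_iff.mpr hX
  have h1 : #((Set.range p.mark)ᶜ : Set X) = #X :=
    Cardinal.mk_compl_of_infinite (α := X) _
      (Cardinal.mk_range_le.trans_lt hp)
  have h2 : #((Set.range g)ᶜ : Set Q) ≤ #((Set.range p.mark)ᶜ : Set X) :=
    (Cardinal.mk_set_le _).trans (hQ.trans h1.ge)
  obtain ⟨k⟩ := h2
  have hk : ∀ y (h : y ∉ Set.range g) x, (k ⟨y, h⟩).1 ≠ p.mark x := fun y h x e =>
    (k ⟨y, h⟩).2 ⟨x, e.symm⟩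
  let m : Q → X := fun y => if h : y ∈ Set.range g then p.mark h.choose else k ⟨y, h⟩
  have m1 : ∀ x, m (g x) = p.mark x := fun x => by
    have h : g x ∈ Set.range g := ⟨x, rfl⟩
    simp only [m, dif_pos h]
    exact congrArg p.mark (g.injective h.choose_spec)
  have m2 : ∀ y (h : y ∉ Set.range g), m y = k ⟨y, h⟩ := fun y h => by simp only [m, dif_neg h]
  refine ⟨⟨m, ?_⟩, m1⟩
  intro y z hyz
  by_cases hy : y ∈ Set.range g <;> by_cases hz : z ∈ Set.range g
  · obtain ⟨a, rfl⟩ := hy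
    obtain ⟨b, rfl⟩ := hz
    rw [m1, m1] at hyz
    rw [p.mark.injective hyz]
  · obtain ⟨a, rfl⟩ := hy
    rw [m1, m2 z hz] at hyz
    exact absurd hyz.symm (hk _ _ _)
  · obtain ⟨b, rfl⟩ := hz
    rw [m1, m2 y hy] at hyz
    exact absurd hyz (hk _ _ _)
  · rw [m2 y hy, m2 z hz] at hyz
    exact congrArg Subtype.val (k.injective (Subtype.ext hyz))

end Marked

/-- A continuous increasing chain of submodels indexed by all ordinals. -/
structure IsFullChain {N : K.Model} (C : Ordinal.{w} → Submodel N) : Prop where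
  mono : ∀ i j, i ≤ j → C i ≤ C j
  cont : ∀ j, Order.IsSuccLimit j → ∀ x ∈ C j, ∃ i < j, x ∈ C i

theorem IsFullChain.isContChain {N : K.Model} {C : Ordinal.{w} → Submodel N} (h : IsFullChain C)
    (δ : Ordinal.{w}) : IsContChain C δ :=
  ⟨fun i j hij _ => h.mono i j hij, fun j _ => h.cont j⟩

theorem IsContChain.isFullChain {N : K.Model} {C : Ordinal.{w} → Submodel N} {δ : Ordinal.{w}}
    (h : IsContChain C δ) : IsFullChain fun i => C (min i δ) where
  mono i j hij := h.mono _ _ (min_le_min_right δ hij) (min_le_right _ _)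
  cont j hj x hx := by
    rcases le_or_gt j δ with h' | h'
    · rw [min_eq_left h'] at hx
      obtain ⟨i, hi, hx⟩ := h.cont j h' hj x hx
      refine ⟨i, hi, ?_⟩
      rwa [min_eq_left (hi.le.trans h')]
    · refine ⟨δ, h', ?_⟩
      rw [min_eq_right h'.le] at hx
      rwa [min_self]

theorem IsFullChain.map {M N : K.Model} {C : Ordinal.{w} → Submodel M}
    (h : IsFullChain C) (f : Emb M N) : IsFullChain (fun i => (C i).map f) where
  mono i j hij := Submodel.map_mono f (h.mono i j hij)
  cont j hj := by
    rintro _ ⟨x, hx, rfl⟩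
    obtain ⟨i, hi, hx⟩ := h.cont j hj x hx
    exact ⟨i, hi, x, hx, rfl⟩

/-! ### Transfinite systems of embeddings along a chain -/

section System

universe v

variable {N : K.Model}

/-- An embedding of the `i`-th member of a chain into a marked model, together with a family of
distinguished subsets of that model. -/
structure Stage (C : Ordinal.{w} → Submodel N) (J : Type v) (X : Type w) (i : Ordinal.{w}) where
  M : Marked K X
  f : Emb (C i).toModel M.Q
  Y : J → Set M.Q

variable {C : Ordinal.{w} → Submodel N} {J : Type v} {X : Type w}

/-- Compatibility is expressed through marks rather than through a chosen embedding, so it is a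
plain proposition and composes without coherence conditions. -/
structure Stage.Le {i j : Ordinal.{w}} (p : Stage C J X i) (q : Stage C J X j) : Prop where
  le : p.M.Le q.M
  map_f : ∀ (x : N) (hx : x ∈ C i) (hx' : x ∈ C j),
    q.M.mark (q.f (Submodel.elem hx')) = p.M.mark (p.f (Submodel.elem hx))
  map_Y : ∀ k, ∀ y ∈ p.Y k, ∃ z ∈ q.Y k, q.M.mark z = p.M.mark y

theorem Stage.Le.refl {i : Ordinal.{w}} (p : Stage C J X i) : p.Le p :=
  ⟨Marked.Le.refl _, fun _ _ _ => rfl, fun _ y hy => ⟨y, hy, rfl⟩⟩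

theorem Stage.Le.trans {i j k : Ordinal.{w}} {p : Stage C J X i} {q : Stage C J X j}
    {r : Stage C J X k} (hij : C i ≤ C j) (h₁ : p.Le q) (h₂ : q.Le r) : p.Le r where
  le := h₁.le.trans h₂.le
  map_f x hx hx' := (h₂.map_f x (hij hx) hx').trans (h₁.map_f x hx (hij hx))
  map_Y l y hy := by
    obtain ⟨z, hz, e⟩ := h₁.map_Y l y hy
    obtain ⟨t, ht, e'⟩ := h₂.map_Y l z hz
    exact ⟨t, ht, e'.trans e⟩

theorem Stage.Le.emb_f {i j : Ordinal.{w}} {p : Stage C J X i} {q : Stage C J X j}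
    (h : p.Le q) (x : N) (hx : x ∈ C i) (hx' : x ∈ C j) :
    h.le.emb (p.f (Submodel.elem hx)) = q.f (Submodel.elem hx') :=
  h.le.emb_eq (h.map_f x hx hx')

theorem Stage.Le.emb_mem_Y {i j : Ordinal.{w}} {p : Stage C J X i} {q : Stage C J X j}
    (h : p.Le q) {k : J} {y : p.M.Q} (hy : y ∈ p.Y k) : h.le.emb y ∈ q.Y k := by
  obtain ⟨z, hz, e⟩ := h.map_Y k y hy
  rwa [h.le.emb_eq e]

/-- A coherent system of stages up to `δ`, continuous at limits. -/
structure IsSystem (p : ∀ i, Stage C J X i) (δ : Ordinal.{w}) : Prop where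
  le : ∀ i j, i ≤ j → j ≤ δ → (p i).Le (p j)
  cont : ∀ j ≤ δ, Order.IsSuccLimit j → ∀ y : (p j).M.Q,
    ∃ i < j, ∃ x : (p i).M.Q, (p i).M.mark x = (p j).M.mark y
  cont_Y : ∀ j ≤ δ, Order.IsSuccLimit j → ∀ k, ∀ y ∈ (p j).Y k,
    ∃ i < j, ∃ x ∈ (p i).Y k, (p i).M.mark x = (p j).M.mark y

theorem Stage.exists_union (hC : IsFullChain C) {δ : Ordinal.{w}} (hδ : Order.IsSuccLimit δ)
    (p : ∀ i, i < δ → Stage C J X i)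
    (hp : ∀ i j (hij : i ≤ j) (hj : j < δ), (p i (hij.trans_lt hj)).Le (p j hj)) :
    ∃ q : Stage C J X δ, (∀ i hi, (p i hi).Le q) ∧
      (∀ y : q.M.Q, ∃ i, ∃ hi : i < δ, ∃ x, (p i hi).M.mark x = q.M.mark y) ∧
      (∀ k, ∀ y ∈ q.Y k, ∃ i, ∃ hi : i < δ, ∃ x ∈ (p i hi).Y k,
        (p i hi).M.mark x = q.M.mark y) := by
  classical
  have hpos : 0 < δ := hδ.bot_lt
  obtain ⟨q, hq, hqx⟩ := Marked.exists_union hpos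
    (fun i => if h : i < δ then (p i h).M else (p 0 hpos).M) (by
      intro i j hij hj
      rw [dif_pos (hij.trans_lt hj), dif_pos hj]
      exact (hp i j hij hj).le)
  have hq' : ∀ i (hi : i < δ), (p i hi).M.Le q := fun i hi => by
    have := hq i hi
    rwa [dif_pos hi] at this
  have hqx' : ∀ y : q.Q, ∃ i, ∃ hi : i < δ, ∃ x, (p i hi).M.mark x = q.mark y := fun y => by
    obtain ⟨i, hi, h⟩ := hqx y
    rw [dif_pos hi] at h
    exact ⟨i, hi, h⟩
  obtain ⟨f, hf⟩ := Emb.exists_glue (P := q.Q) hpos C (fun i j hij _ => hC.mono i j hij) (C δ)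
    (fun x => ⟨hC.cont δ hδ x, fun ⟨i, hi, hx⟩ => hC.mono i δ hi.le hx⟩)
    (fun i hi => (hq' i hi).emb.comp (p i hi).f) (by
      intro i j hij hi hj x hx hx'
      refine q.mark.injective ?_
      rw [Emb.comp_apply, Emb.comp_apply, Marked.Le.mark_emb, Marked.Le.mark_emb]
      exact ((hp i j hij hj).map_f x hx hx').symm)
  refine ⟨⟨q, f, fun k => {y | ∃ i, ∃ hi : i < δ, ∃ x ∈ (p i hi).Y k,
    (p i hi).M.mark x = q.mark y}⟩, fun i hi => ⟨hq' i hi, fun x hx hx' => ?_, fun k y hy => ?_⟩,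
    hqx', fun k y hy => hy⟩
  · change q.mark (f _) = _
    rw [hf i hi x hx hx', Emb.comp_apply, Marked.Le.mark_emb]
  · exact ⟨(hq' i hi).emb y, ⟨i, hi, y, hy, ((hq' i hi).mark_emb y).symm⟩, (hq' i hi).mark_emb y⟩

/-- Transfinite construction of a coherent system of embeddings of the members of a chain. -/
theorem exists_system (hC : IsFullChain C) {κ : Cardinal.{w}} (hκ : ℵ₀ ≤ κ) (hN : #N ≤ κ)
    {δ : Ordinal.{w}} (hδ : δ.card ≤ κ)
    (Inv : ∀ (i : Ordinal.{w}) {Q : K.Model}, Emb (C i).toModel Q → (J → Set Q) → Prop)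
    (Step : ∀ (i : Ordinal.{w}) {Q Q' : K.Model}, Emb (C (i + 1)).toModel Q' → Emb Q Q' → Prop)
    {Q₀ : K.Model} (hQ₀ : #Q₀ ≤ κ) (f₀ : Emb (C 0).toModel Q₀) (Y₀ : J → Set Q₀)
    (h₀ : Inv 0 f₀ Y₀)
    (hsucc : ∀ i < δ, ∀ (Q : K.Model) (f : Emb (C i).toModel Q) (Y : J → Set Q), #Q ≤ κ →
      Inv i f Y → ∃ (Q' : K.Model) (f' : Emb (C (i + 1)).toModel Q') (Y' : J → Set Q')
        (g : Emb Q Q'), #Q' ≤ κ ∧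
        (∀ (x : N) (hx : x ∈ C i) (hx' : x ∈ C (i + 1)),
          g (f (Submodel.elem hx)) = f' (Submodel.elem hx')) ∧
        (∀ k, ∀ y ∈ Y k, g y ∈ Y' k) ∧ Inv (i + 1) f' Y' ∧ Step i f' g)
    (hlim : ∀ i ≤ δ, Order.IsSuccLimit i → ∀ (X : Type w) (p : ∀ j, Stage C J X j),
      IsSystem p i → (∀ j ≤ i, #(p j).M.Q ≤ κ) → (∀ j < i, Inv j (p j).f (p j).Y) →
      Inv i (p i).f (p i).Y) :
    ∃ (X : Type w) (p : ∀ j, Stage C J X j) (m₀ : Q₀ ↪ X), IsSystem p δ ∧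
      p 0 = ⟨⟨Q₀, m₀⟩, f₀, Y₀⟩ ∧ (∀ j ≤ δ, #(p j).M.Q ≤ κ) ∧
      (∀ j ≤ δ, Inv j (p j).f (p j).Y) ∧
      ∀ j < δ, ∃ h : (p j).Le (p (j + 1)), Step j (p (j + 1)).f h.le.emb := by
  classical
  -- Every stage has size at most `κ`, so with `κ⁺` marks there is always room to extend a marking.
  let X : Type w := (Order.succ κ).out
  have hX : #X = Order.succ κ := Cardinal.mk_out _
  have hXκ : κ < #X := by rw [hX]; exact Order.lt_succ κ
  have hXi : ℵ₀ ≤ #X := hκ.trans hXκ.le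
  -- A junk stage at each index, needed only for the choice operator below.
  have hne : ∀ i, Nonempty (Stage C J X i) := fun i => by
    obtain ⟨m⟩ : Nonempty ((C i).toModel ↪ X) :=
      (((C i).card_le).trans hN).trans hXκ.le
    exact ⟨⟨⟨(C i).toModel, m⟩, Emb.id _, fun _ => ∅⟩⟩
  obtain ⟨m₀⟩ : Nonempty (Q₀ ↪ X) := hQ₀.trans hXκ.le
  let RS : ∀ i, Stage C J X i → Stage C J X (i + 1) → Prop := fun i p q =>
    #q.M.Q ≤ κ ∧ Inv (i + 1) q.f q.Y ∧ ∃ h : p.Le q, Step i q.f h.le.emb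
  let RL : ∀ i, (∀ j, j < i → Stage C J X j) → Stage C J X i → Prop := fun i p q =>
    (∀ j hj, (p j hj).Le q) ∧
      (∀ y : q.M.Q, ∃ j, ∃ hj : j < i, ∃ x, (p j hj).M.mark x = q.M.mark y) ∧
      (∀ k, ∀ y ∈ q.Y k, ∃ j, ∃ hj : j < i, ∃ x ∈ (p j hj).Y k,
        (p j hj).M.mark x = q.M.mark y)
  -- The recursion chooses stages without carrying proofs; `main` then shows by induction that the
  -- choices meet their specifications up to `δ`.
  let p : ∀ i, Stage C J X i := fun i => Ordinal.limitRecOn i ⟨⟨Q₀, m₀⟩, f₀, Y₀⟩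
    (fun i q => @Classical.epsilon _ (hne (i + 1)) (RS i q))
    (fun i _ c => @Classical.epsilon _ (hne i) (RL i c))
  have p0 : p 0 = ⟨⟨Q₀, m₀⟩, f₀, Y₀⟩ := Ordinal.limitRecOn_zero ..
  have pS : ∀ i, p (i + 1) = @Classical.epsilon _ (hne (i + 1)) (RS i (p i)) := fun i =>
    Ordinal.limitRecOn_add_one ..
  have pL : ∀ i, Order.IsSuccLimit i →
      p i = @Classical.epsilon _ (hne i) (RL i fun j _ => p j) := fun i hi =>
    Ordinal.limitRecOn_limit (h := hi) ..
  have hRS : ∀ i < δ, #(p i).M.Q ≤ κ → Inv i (p i).f (p i).Y → RS i (p i) (p (i + 1)) := by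
    intro i hi hc hI
    rw [pS]
    apply Classical.epsilon_spec (p := RS i (p i))
    obtain ⟨Q', f', Y', g, hQ', hf, hY, hI', hstep⟩ := hsucc i hi _ _ _ hc hI
    obtain ⟨m, hm⟩ := Marked.exists_extend g hXi (hc.trans_lt hXκ) (hQ'.trans hXκ.le)
    have hle : (p i).M.Le (⟨Q', m⟩ : Marked K X) := ⟨g, hm⟩
    have hg : hle.emb = g := Emb.ext fun x => hle.emb_eq (hm x)
    refine ⟨⟨⟨Q', m⟩, f', Y'⟩, hQ', hI', ⟨hle, fun x hx hx' => ?_, fun k y hy => ?_⟩, ?_⟩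
    · rw [← hm, ← hf x hx hx']
    · exact ⟨g y, hY k y hy, hm y⟩
    · change Step i f' hle.emb
      rwa [hg]
  have hRL : ∀ i, Order.IsSuccLimit i → (∀ j k, j ≤ k → k < i → (p j).Le (p k)) →
      RL i (fun j _ => p j) (p i) := by
    intro i hi hp
    have h := Classical.epsilon_spec (p := RL i (fun j _ => p j))
      (Stage.exists_union hC hi (fun j _ => p j) hp)
    exact (pL i hi).symm ▸ h
  have main : ∀ i, i ≤ δ → (∀ j ≤ i, (p j).Le (p i)) ∧ #(p i).M.Q ≤ κ ∧
      Inv i (p i).f (p i).Y ∧ (Order.IsSuccLimit i → RL i (fun j _ => p j) (p i)) := by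
    intro i
    induction i using Ordinal.limitRecOn with
    | zero =>
      intro _
      refine ⟨fun j hj => ?_, ?_, ?_, fun h => absurd rfl h.ne_bot⟩
      · obtain rfl : j = 0 := le_antisymm hj zero_le
        exact Stage.Le.refl _
      · rw [p0]
        exact hQ₀
      · rw [p0]
        exact h₀
    | add_one i ih =>
      intro hi
      have hi' : i < δ := lt_of_lt_of_le (Order.lt_add_one_iff.mpr le_rfl) hi
      obtain ⟨h1, h2, h3, -⟩ := ih hi'.le
      obtain ⟨h4, h5, h6, -⟩ := hRS i hi' h2 h3
      refine ⟨fun j hj => ?_, h4, h5, fun h => absurd h (Order.not_isSuccLimit_add_one i)⟩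
      rcases hj.lt_or_eq with hj | rfl
      · have hj' : j ≤ i := Order.lt_add_one_iff.mp hj
        exact Stage.Le.trans (hC.mono j i hj') (h1 j hj') h6
      · exact Stage.Le.refl _
    | limit i hi ih =>
      intro hiδ
      have hL := hRL i hi fun j k hjk hk => (ih k hk (hk.le.trans hiδ)).1 j hjk
      have hle : ∀ j ≤ i, (p j).Le (p i) := fun j hj => by
        rcases hj.lt_or_eq with hj | rfl
        · exact hL.1 j hj
        · exact Stage.Le.refl _
      -- The limit model is covered by the images of at most `κ` models of size at most `κ`.
      have hcard : #(p i).M.Q ≤ κ := by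
        have h1 : #(p i).M.Q ≤ #(Σ j : i.ToType, (p (Ordinal.ToType.toOrd j).1).M.Q) := by
          refine Cardinal.mk_le_of_surjective
            (f := fun z : (Σ j : i.ToType, (p (Ordinal.ToType.toOrd j).1).M.Q) =>
              (hL.1 _ (toOrd_lt z.1)).le.emb z.2) fun y => ?_
          obtain ⟨j, hj, x, hx⟩ := hL.2.1 y
          obtain ⟨l, rfl⟩ := exists_toOrd_eq hj
          exact ⟨⟨l, x⟩, (hL.1 _ hj).le.emb_eq hx.symm⟩
        refine h1.trans ?_
        rw [Cardinal.mk_sigma]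
        refine (Cardinal.sum_le_sum _ (fun _ => κ) fun j =>
          (ih _ (toOrd_lt j) ((toOrd_lt j).le.trans hiδ)).2.1).trans ?_
        rw [Cardinal.sum_const', Cardinal.mk_toType]
        exact Cardinal.mul_le_of_le hκ ((Ordinal.card_le_card hiδ).trans hδ) le_rfl
      have hsys : IsSystem p i := by
        refine ⟨fun j k hjk hk => ?_, fun j hj hjl => ?_, fun j hj hjl => ?_⟩
        · rcases hk.lt_or_eq with hk | rfl
          · exact (ih k hk (hk.le.trans hiδ)).1 j hjk
          · exact hle j hjk
        · have h : RL j (fun j _ => p j) (p j) := by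
            rcases hj.lt_or_eq with hj | rfl
            · exact (ih j hj (hj.le.trans hiδ)).2.2.2 hjl
            · exact hL
          intro y
          obtain ⟨k, hk, h⟩ := h.2.1 y
          exact ⟨k, hk, h⟩
        · have h : RL j (fun j _ => p j) (p j) := by
            rcases hj.lt_or_eq with hj | rfl
            · exact (ih j hj (hj.le.trans hiδ)).2.2.2 hjl
            · exact hL
          intro l y hy
          obtain ⟨k, hk, h⟩ := h.2.2 l y hy
          exact ⟨k, hk, h⟩
      refine ⟨hle, hcard, hlim i hiδ hi X p hsys (fun j hj => ?_)
        (fun j hj => (ih j hj (hj.le.trans hiδ)).2.2.1), fun _ => hL⟩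
      rcases hj.lt_or_eq with hj | rfl
      · exact (ih j hj (hj.le.trans hiδ)).2.1
      · exact hcard
  refine ⟨X, p, m₀, ⟨fun i j hij hj => (main j hj).1 i hij, fun j hj hjl y => ?_,
    fun j hj hjl k y hy => ?_⟩, p0, fun j hj => (main j hj).2.1, fun j hj => (main j hj).2.2.1,
    fun j hj => (hRS j hj (main j hj.le).2.1 (main j hj.le).2.2.1).2.2⟩
  · obtain ⟨k, hk, h⟩ := ((main j hj).2.2.2 hjl).2.1 y
    exact ⟨k, hk, h⟩
  · obtain ⟨l, hl, h⟩ := ((main j hj).2.2.2 hjl).2.2 k y hy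
    exact ⟨l, hl, h⟩

end System

/-! ### Images of nested submodels -/

theorem Submodel.mem_within_map {N P : K.Model} {A B : Submodel N} (h : A ≤ B)
    (f : Emb B.toModel P) {y : P} :
    y ∈ (within h).map f ↔ ∃ (x : N) (hx : x ∈ A), f (elem (h hx)) = y := by
  constructor
  · rintro ⟨z, hz, rfl⟩
    exact ⟨z.1, (mem_within h).mp hz, rfl⟩
  · rintro ⟨x, hx, rfl⟩
    exact ⟨elem (h hx), (mem_within h).mpr hx, rfl⟩

theorem Submodel.within_map_of_eq {N P : K.Model} {A B : Submodel N} (h : A ≤ B)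
    {f : Emb B.toModel P} {k : Emb N P} (hk : ∀ x (hx : x ∈ A), f (elem (h hx)) = k x) :
    (within h).map f = A.map k :=
  ext_mem fun y => (mem_within_map h f).trans
    ⟨by rintro ⟨x, hx, rfl⟩; exact ⟨x, hx, (hk x hx).symm⟩,
      by rintro ⟨x, hx, rfl⟩; exact ⟨x, hx, hk x hx⟩⟩

theorem Submodel.within_map_subtype {N : K.Model} {A B : Submodel N} (h : A ≤ B) :
    (within h).map B.subtype = A :=
  (within_map_of_eq h (k := Emb.id N) fun _ _ => rfl).trans (Emb.map_id A)

theorem Emb.map_eq_of_comp {M N₁ N₂ P : K.Model} {f₁ : Emb M N₁} {f₂ : Emb M N₂} {u : Emb N₁ P}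
    {v : Emb N₂ P} (h : ∀ x, u (f₁ x) = v (f₂ x)) (A : Submodel M) :
    (A.map f₁).map u = (A.map f₂).map v := by
  have e : u.comp f₁ = v.comp f₂ := Emb.ext h
  rw [← Emb.map_comp, ← Emb.map_comp, e]

theorem Emb.range_map_eq_of_comp {M N₁ N₂ P : K.Model} {f₁ : Emb M N₁} {f₂ : Emb M N₂}
    {u : Emb N₁ P} {v : Emb N₂ P} (h : ∀ x, u (f₁ x) = v (f₂ x)) :
    f₁.range.map u = f₂.range.map v := by
  have e : u.comp f₁ = v.comp f₂ := Emb.ext h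
  rw [← Emb.range_comp, ← Emb.range_comp, e]

/-! ### Element symmetry and mutual amalgamation -/

namespace FrameData

variable {s : FrameData K}

/-- Symmetry of nonforking for single elements. -/
def ElementSymmetry (s : FrameData K) : Prop :=
  ∀ (N : K.Model) (M₀ M₁ : Submodel N) (b c : N), s.nf₁ M₀ M₁ b → c ∈ M₁ →
    gtp M₀.subtype (single c) ∈ s.bs M₀.toModel 1 →
    ∃ (N' : K.Model) (f : Emb N N') (M' : Submodel N'),
      f b ∈ M' ∧ s.nf₁ (M₀.map f) M' (f c)

theorem InF.of_card_bound {κ : Cardinal.{w}} (hκ : (κ : WithTop Cardinal.{w}) < s.theta)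
    {M N : K.Model} (hM : s.InF M) (f : Emb M N) (hN : #N ≤ κ) : s.InF N :=
  ⟨hM.1.trans f.card_le, lt_of_le_of_lt (WithTop.coe_le_coe.mpr hN) hκ⟩

namespace IsGoodMinus

variable (hs : s.IsGoodMinus)
include hs

/-- Two elements, each free over `A`, one in `B` and one in `F`: the models `B` and `F` can be
amalgamated over `A` so that each element is free from the other model. -/
theorem exists_mutual_amalgam (hsym : s.ElementSymmetry) {A B F : K.Model} (k : Emb A B)
    (f : Emb A F) {M₀ : Submodel A} {b : F} {c : B} (hb : s.nf₁ (M₀.map f) f.range b)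
    (hc : s.nf₁ (M₀.map k) k.range c) :
    ∃ (F' : K.Model) (g : Emb F F') (f' : Emb B F'), s.InF F' ∧ #F' ≤ max #F #B ∧
      (∀ x, g (f x) = f' (k x)) ∧ s.nf₁ ((M₀.map k).map f') f'.range (g b) ∧
      s.nf₁ ((M₀.map k).map f') g.range (f' c) := by
  have hF := (hs.nf_dom hb).2.2.2.2
  have hB := (hs.nf_dom hc).2.2.2.2
  obtain ⟨Q₁, u₁, g₁, hQ₁, -, e₁, n₁⟩ := hs.exists_nf_amalgam f k hB hb
  have hkr : k.range.map g₁ ≤ g₁.range := by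
    rintro _ ⟨x, -, rfl⟩
    exact ⟨x, rfl⟩
  have hMk : M₀.map k ≤ k.range := by
    rintro _ ⟨x, -, rfl⟩
    exact ⟨x, rfl⟩
  have c₁ := (hs.nf₁_map_iff g₁ hQ₁).mpr hc
  -- Symmetry is applied over `A` rather than over `M₀`, so that the resulting `M'` contains `A` as
  -- well as `b`.
  obtain ⟨N', j, M', hbM', n₂⟩ := hsym Q₁ (k.range.map g₁) g₁.range (u₁ b) (g₁ c)
    (hs.nf₁_mono n₁ (Submodel.map_mono g₁ hMk) hkr (Submodel.le_refl _)) ⟨c, rfl⟩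
    (hs.gtp_mem_bs c₁)
  have hN' := (hs.nf_dom n₂).2.2.2.2
  have hle := hs.nf₁_le n₂
  have n₂' : s.nf₁ ((Submodel.within hle).map M'.subtype) M'.subtype.range (j (g₁ c)) := by
    rwa [Submodel.within_map_subtype, Emb.range_subtype]
  -- `M'` contains `b` but need not contain `F`. Two copies of `N'` are therefore amalgamated over
  -- `M'`, with `c` of the first copy free from the whole second one. Now `B` is taken from the
  -- first copy and `F` from the second. They agree on `A`, and `b` is the same in both copies, so
  -- it remains free from `B`.
  obtain ⟨Q, u, g, hQ, -, e₂, n₃⟩ := hs.exists_nf_amalgam M'.subtype M'.subtype hN' n₂'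
  have e₂' : ∀ y ∈ M', u y = g y := fun y hy => e₂ (Submodel.elem hy)
  have hMA : ∀ a, j (g₁ (k a)) ∈ M' := fun a => hle ⟨_, ⟨_, ⟨a, rfl⟩, rfl⟩, rfl⟩
  obtain ⟨F', i, p, q, hF', hcard, hp, hq⟩ :=
    hs.exists_shrink ((g.comp j).comp u₁) ((u.comp j).comp g₁) hF hB
  have e₃ : ∀ x, p (f x) = q (k x) := fun x => i.injective (by
    rw [hp, hq]
    simp only [Emb.comp_apply]
    rw [e₁, e₂' _ (hMA x)])
  have e₄ : i.comp q = (u.comp j).comp g₁ := Emb.ext hq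
  have e₅ : ∀ A : Submodel B, (A.map q).map i = ((A.map g₁).map j).map u := fun A => by
    rw [← Emb.map_comp, e₄, Emb.map_comp, Emb.map_comp]
  have e₆ : q.range.map i = (g₁.range.map j).map u := by
    rw [← Emb.range_comp, e₄, Emb.range_comp, Emb.map_comp]
  refine ⟨F', p, q, hF', hcard, e₃, ?_, ?_⟩
  · have n₄ := (hs.nf₁_map_iff u hQ).mpr ((hs.nf₁_map_iff j hN').mpr n₁)
    rw [← e₅, ← e₆, e₂' _ hbM'] at n₄
    have e₇ : g (j (u₁ b)) = i (p b) := (hp b).symm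
    rw [e₇] at n₄
    exact (hs.nf₁_map_iff i hQ).mp n₄
  · have n₄ := (hs.nf₁_map_iff u hQ).mpr ((hs.nf₁_map_iff j hN').mpr c₁)
    have e₈ : ((Submodel.within hle).map M'.subtype).map g = ((k.range.map g₁).map j).map u := by
      rw [Submodel.within_map_subtype]
      refine Submodel.ext_mem fun y => ⟨?_, ?_⟩
      · rintro ⟨x, hx, rfl⟩
        exact ⟨x, hx, e₂' x (hle hx)⟩
      · rintro ⟨x, hx, rfl⟩
        exact ⟨x, hx, (e₂' x (hle hx)).symm⟩
    rw [e₈] at n₃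
    -- Freeness of `c` from `A` over `M₀` lowers the base from `A` to `M₀`.
    have n₅ := hs.nf₁_trans n₄ n₃
    have e₉ : u (j (g₁ c)) = i (q c) := (hq c).symm
    rw [← e₅, e₉] at n₅
    refine (hs.nf₁_map_iff i hQ).mp (hs.nf₁_mono n₅ (Submodel.le_refl _) ?_ ?_)
    · rintro _ ⟨_, ⟨_, ⟨a, -, rfl⟩, rfl⟩, rfl⟩
      exact ⟨_, ⟨f a, e₃ a⟩, rfl⟩
    · rintro _ ⟨_, ⟨a, rfl⟩, rfl⟩
      exact ⟨_, (hp a).symm⟩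

end IsGoodMinus

end FrameData

theorem Stage.Le.map_within {N : K.Model} {C : Ordinal.{w} → Submodel N} {J : Type*} {X : Type w}
    {i j : Ordinal.{w}} {p : Stage C J X i} {q : Stage C J X j} (h : p.Le q) {M : Submodel N}
    (hi : M ≤ C i) (hj : M ≤ C j) :
    ((Submodel.within hi).map p.f).map h.le.emb = (Submodel.within hj).map q.f := by
  refine Submodel.ext_mem fun y => ⟨?_, fun hy => ?_⟩
  · rintro ⟨z, hz, rfl⟩
    obtain ⟨x, hx, rfl⟩ := (Submodel.mem_within_map _ _).mp hz
    exact (Submodel.mem_within_map _ _).mpr ⟨x, hx, (h.emb_f x _ _).symm⟩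
  · obtain ⟨x, hx, rfl⟩ := (Submodel.mem_within_map _ _).mp hy
    exact ⟨_, (Submodel.mem_within_map _ _).mpr ⟨x, hx, rfl⟩, h.emb_f x _ _⟩

/-! ### Inserting one free element into a chain -/

namespace FrameData

variable {s : FrameData K}

namespace IsGoodMinus

variable (hs : s.IsGoodMinus)
include hs

theorem nonempty_of_inF {M : K.Model} (h : s.InF M) : Nonempty M :=
  Cardinal.mk_ne_zero_iff.mp
    (Cardinal.aleph0_pos.trans_le ((K.LS_mem.1.trans hs.LS_le).trans h.1)).ne'

/-- The limit step of a system of stages preserves nonforking of an element from the images of the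
chain. -/
theorem nf₁_system_limit {N : K.Model} {C : Ordinal.{w} → Submodel N} (hC : IsFullChain C)
    {J : Type*} {X : Type w} {p : ∀ i, Stage C J X i} {i : Ordinal.{w}} (hi : Order.IsSuccLimit i)
    (hp : IsSystem p i) (hF : s.InF (p i).M.Q) {M₀ : Submodel N} (hM₀ : ∀ j, M₀ ≤ C j)
    {b : ∀ j, (p j).M.Q} (hb : ∀ j < i, (p i).M.mark (b i) = (p j).M.mark (b j))
    (h : ∀ j < i, s.nf₁ ((Submodel.within (hM₀ j)).map (p j).f) (p j).f.range (b j)) :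
    s.nf₁ ((Submodel.within (hM₀ i)).map (p i).f) (p i).f.range (b i) := by
  let D : Ordinal.{w} → Submodel (p i).M.Q := fun j =>
    (Submodel.within (hC.mono (min j i) i (min_le_right _ _))).map (p i).f
  have hDmem : ∀ j, j ≤ i → ∀ y, y ∈ D j ↔
      ∃ (x : N) (_ : x ∈ C j) (hx : x ∈ C i), (p i).f (Submodel.elem hx) = y := by
    intro j hj y
    refine (Submodel.mem_within_map _ _).trans ?_
    constructor
    · rintro ⟨x, hx, e⟩
      rw [min_eq_left hj] at hx
      exact ⟨x, hx, hC.mono j i hj hx, e⟩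
    · rintro ⟨x, hx, hx', e⟩
      refine ⟨x, ?_, e⟩
      rwa [min_eq_left hj]
  have hD : IsContChain D i := by
    refine ⟨fun j k hjk hk y hy => ?_, fun j hj hjl y hy => ?_⟩
    · obtain ⟨x, hx, hx', e⟩ := (hDmem j (hjk.trans hk) y).mp hy
      exact (hDmem k hk y).mpr ⟨x, hC.mono j k hjk hx, hx', e⟩
    · obtain ⟨x, hx, hx', e⟩ := (hDmem j hj y).mp hy
      obtain ⟨k, hk, hx⟩ := hC.cont j hjl x hx
      exact ⟨k, hk, (hDmem k (hk.le.trans hj) y).mpr ⟨x, hx, hx', e⟩⟩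
  have hDi : D i = (p i).f.range := Submodel.ext_mem fun y => (hDmem i le_rfl y).trans
    ⟨by rintro ⟨x, -, hx, e⟩; exact ⟨_, e⟩, by
      rintro ⟨x, rfl⟩; exact ⟨x.1, x.2, x.2, rfl⟩⟩
  rw [← hDi]
  refine hs.nf₁_limit hF hi hD fun j hj => ?_
  have hle := hp.le j i hj.le le_rfl
  have h1 := (hs.nf₁_map_iff hle.le.emb hF).mpr (h j hj)
  have e1 : ((Submodel.within (hM₀ j)).map (p j).f).map hle.le.emb =
      (Submodel.within (hM₀ i)).map (p i).f := hle.map_within _ _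
  have e2 : (p j).f.range.map hle.le.emb = D j := by
    refine Submodel.ext_mem fun y => ⟨?_, fun hy => ?_⟩
    · rintro ⟨_, ⟨x, rfl⟩, rfl⟩
      exact (hDmem j hj.le _).mpr ⟨x.1, x.2, hC.mono j i hj.le x.2,
        (hle.emb_f x.1 x.2 _).symm⟩
    · obtain ⟨x, hx, hx', rfl⟩ := (hDmem j hj.le y).mp hy
      exact ⟨_, ⟨Submodel.elem hx, rfl⟩, hle.emb_f x hx hx'⟩
  rw [e1, e2, hle.le.emb_eq (hb j hj)] at h1
  exact h1

/-- A free element can be inserted into a chain: the chain is extended to one that contains the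
element from a given place on, and the nonforking of a family of elements is preserved. -/
theorem exists_insert (hsym : s.ElementSymmetry) {κ : Cardinal.{w}} (hκ₀ : ℵ₀ ≤ κ)
    (hκ : (κ : WithTop Cardinal.{w}) < s.theta) {Q Q' : K.Model} {E : Ordinal.{w} → Submodel Q}
    (hE : IsFullChain E) {γ : Ordinal.{w}} (hγ : γ.card ≤ κ) {M₀ : Submodel Q} (hM₀ : M₀ ≤ E 0)
    {S : Set Ordinal.{w}} {c : Ordinal.{w} → Q}
    (hc : ∀ j ∈ S, j < γ ∧ c j ∈ E (j + 1) ∧ s.nf₁ M₀ (E j) (c j))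
    (g : Emb Q Q') (hQ' : #Q' ≤ κ) {b : Q'} (hb : s.nf₁ (M₀.map g) g.range b)
    {j₀ : Ordinal.{w}} (hj₀ : j₀ < γ) :
    ∃ (Q'' : K.Model) (h : Emb Q' Q'') (E' : Ordinal.{w} → Submodel Q''), s.InF Q'' ∧ #Q'' ≤ κ ∧
      IsFullChain E' ∧ (∀ j ≤ γ, (E j).map (h.comp g) ≤ E' j) ∧
      (∀ j ∈ S, s.nf₁ (M₀.map (h.comp g)) (E' j) (h (g (c j)))) ∧
      s.nf₁ (M₀.map (h.comp g)) (E' j₀) (h b) ∧ h b ∈ E' (j₀ + 1) := by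
  classical
  have hM : ∀ j, M₀ ≤ E j := fun j => Submodel.le_trans hM₀ (hE.mono 0 j zero_le)
  have hQ'F := (hs.nf_dom hb).2.2.2.2
  have hM₀F : s.InF M₀.toModel := by
    have h1 := (hs.nf_dom hb).2.2.1
    exact h1.of_card_le h1 (M₀.card_map g).le (M₀.card_map g).ge
  have hQF : s.InF Q := hM₀F.of_emb hQ'F M₀.subtype g
  have hEF : ∀ j, s.InF (E j).toModel := fun j =>
    hM₀F.of_emb hQF (Submodel.inclusion (hM j)) (E j).subtype
  have hQκ : #Q ≤ κ := g.card_le.trans hQ'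
  have hbase : ∀ (P : K.Model) (k : Emb Q P) (j : Ordinal.{w}),
      (Submodel.within (hM j)).map (k.comp (E j).subtype) = M₀.map k := fun P k j =>
    Submodel.within_map_of_eq _ fun _ _ => rfl
  have hrange : ∀ (P : K.Model) (k : Emb Q P) (j : Ordinal.{w}),
      (k.comp (E j).subtype).range ≤ k.range := by
    rintro P k j _ ⟨x, rfl⟩
    exact ⟨_, rfl⟩
  have hle' : ∀ (P : K.Model) (j : Ordinal.{w}) (f : Emb (E j).toModel P),
      (Submodel.within (hM j)).map f ≤ f.range := by
    rintro P j f _ ⟨x, -, rfl⟩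
    exact ⟨_, rfl⟩
  have h₀ : s.nf₁ ((Submodel.within (hM 0)).map (g.comp (E 0).subtype))
      (g.comp (E 0).subtype).range b :=
    hs.nf₁_mono hb (by rw [hbase]; exact Submodel.le_refl _) (hle' _ _ _) (hrange _ _ _)
  -- The stages are the models `F i`, starting from `F 0 = Q'`; the single distinguished subset
  -- `{b}` follows the element through the system. `Inv` keeps `b` free from the image of `E i`, and
  -- `Step` makes `c i` free from all of `F i`.
  obtain ⟨X, p, m₀, hp, hp0, hpc, hpI, hpS⟩ := exists_system (J := Unit) hE hκ₀ hQκ hγ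
    (Inv := fun i {Q} f Y => ∃ b : Q, Y = (fun _ => {b}) ∧
      s.nf₁ ((Submodel.within (hM i)).map f) f.range b)
    (Step := fun i {Q Q'} f' g => i ∈ S → ∀ h : c i ∈ E (i + 1),
      s.nf₁ ((Submodel.within (hM (i + 1))).map f') g.range (f' (Submodel.elem h)))
    hQ' (g.comp (E 0).subtype) (fun _ => {b}) ⟨b, rfl, h₀⟩
    (by
      rintro i hi F f Y hFκ ⟨b, rfl, hb⟩
      have hii : i ≤ i + 1 := (Order.lt_add_one_iff.mpr le_rfl).le
      have hinc := hE.mono i (i + 1) hii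
      have hF := (hs.nf_dom hb).2.2.2.2
      have hEκ : #(E (i + 1)).toModel ≤ κ := (E (i + 1)).card_le.trans hQκ
      have hw : (Submodel.within (hM i)).map (Submodel.inclusion hinc) =
          Submodel.within (hM (i + 1)) := Submodel.ext_mem fun y =>
        (Submodel.mem_within_map _ _).trans ⟨by
          rintro ⟨x, hx, rfl⟩
          exact (Submodel.mem_within _).mpr hx, fun hy =>
            ⟨y.1, (Submodel.mem_within _).mp hy, rfl⟩⟩
      by_cases hiS : i ∈ S
      · obtain ⟨-, hci, hcn⟩ := hc i hiS
        have hcn' : s.nf₁ ((Submodel.within (hM i)).map (Submodel.inclusion hinc))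
            (Submodel.inclusion hinc).range (Submodel.elem hci) := by
          refine (hs.nf₁_map_iff (E (i + 1)).subtype hQF).mp ?_
          have e1 : (Submodel.inclusion hinc).range.map (E (i + 1)).subtype = E i :=
            Submodel.within_map_subtype hinc
          rw [hw, Submodel.within_map_subtype, e1]
          exact hcn
        obtain ⟨F', u, f', hF', hcard, e, n1, n2⟩ := hs.exists_mutual_amalgam hsym _ f hb hcn'
        rw [hw] at n1 n2
        exact ⟨F', f', fun _ => {u b}, u, hcard.trans (max_le hFκ hEκ),
          fun x hx hx' => e (Submodel.elem hx), by rintro _ _ rfl; rfl, ⟨_, rfl, n1⟩,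
          fun _ _ => n2⟩
      · obtain ⟨F', u, f', hF', hcard, e, n1⟩ :=
          hs.exists_nf_amalgam f (Submodel.inclusion hinc) (hEF (i + 1)) hb
        rw [hw] at n1
        exact ⟨F', f', fun _ => {u b}, u, hcard.trans (max_le hFκ hEκ),
          fun x hx hx' => e (Submodel.elem hx), by rintro _ _ rfl; rfl, ⟨_, rfl, n1⟩,
          fun h => absurd h hiS⟩)
    (by
      intro i _ hil X p hp hpc hpI
      obtain ⟨b₀, hY₀, n₀⟩ := hpI 0 hil.bot_lt
      have h00 := hp.le 0 i zero_le le_rfl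
      have hFi : s.InF (p i).M.Q :=
        ((hs.nf_dom n₀).2.2.2.2).of_card_bound hκ h00.le.emb (hpc i le_rfl)
      have hbj : ∀ j < i, ∃ y : (p j).M.Q, (p j).M.mark y = (p 0).M.mark b₀ ∧
          (p j).Y = (fun _ => {y}) ∧
          s.nf₁ ((Submodel.within (hM j)).map (p j).f) (p j).f.range y := by
        intro j hj
        obtain ⟨y, hY, n⟩ := hpI j hj
        obtain ⟨z, hz, hmz⟩ := (hp.le 0 j zero_le hj.le).map_Y () b₀ (by rw [hY₀]; rfl)
        rw [hY] at hz
        obtain rfl : z = y := hz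
        exact ⟨z, hmz, hY, n⟩
      have hbi : ∀ j, ∃ y : (p j).M.Q, j ≤ i → (p j).M.mark y = (p 0).M.mark b₀ ∧
          (j < i → (p j).Y = (fun _ => {y}) ∧
            s.nf₁ ((Submodel.within (hM j)).map (p j).f) (p j).f.range y) := by
        intro j
        rcases lt_trichotomy j i with hj | rfl | hj
        · obtain ⟨y, h1, h2⟩ := hbj j hj
          exact ⟨y, fun _ => ⟨h1, fun _ => h2⟩⟩
        · exact ⟨h00.le.emb b₀, fun _ => ⟨h00.le.mark_emb b₀, fun h => absurd h (lt_irrefl _)⟩⟩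
        · have : Nonempty (p j).M.Q := (hs.nonempty_of_inF (hEF j)).map (p j).f
          exact ⟨this.some, fun h => absurd h (not_le.mpr hj)⟩
      choose y hy using hbi
      refine ⟨y i, ?_, hs.nf₁_system_limit hE hil hp hFi hM (b := y)
        (fun j hj => (hy i le_rfl).1.trans (hy j hj.le).1.symm)
        (fun j hj => ((hy j hj.le).2 hj).2)⟩
      funext u
      refine Set.eq_singleton_iff_unique_mem.mpr ⟨?_, fun z hz => ?_⟩
      · obtain ⟨z, hz, hmz⟩ := h00.map_Y u b₀ (by rw [hY₀]; rfl)
        have : z = y i := (p i).M.mark.injective (hmz.trans (hy i le_rfl).1.symm)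
        rwa [← this]
      · obtain ⟨j, hj, x, hx, hmx⟩ := hp.cont_Y i le_rfl hil u z hz
        rw [((hy j hj.le).2 hj).1] at hx
        obtain rfl : x = y j := hx
        exact (p i).M.mark.injective (hmx.symm.trans ((hy j hj.le).1.trans (hy i le_rfl).1.symm)))
  -- the element has the same type over `E γ` in `Q'` and in the last model of the system
  have hL0 : ∀ j ≤ γ, Stage.Le (⟨⟨Q', m₀⟩, g.comp (E 0).subtype, fun _ => {b}⟩ :
      Stage E Unit X 0) (p j) := fun j hj => hp0 ▸ hp.le 0 j zero_le hj
  obtain ⟨bγ, hYγ, nγ⟩ := hpI γ le_rfl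
  have hF := (hs.nf_dom nγ).2.2.2.2
  have hbγ : (hL0 γ le_rfl).le.emb b = bγ := by
    have h1 := (hL0 γ le_rfl).emb_mem_Y (k := ()) (y := b) rfl
    rw [hYγ] at h1
    exact h1
  have n1 : s.nf₁ ((Submodel.within (hM γ)).map (g.comp (E γ).subtype))
      (g.comp (E γ).subtype).range b :=
    hs.nf₁_mono hb (by rw [hbase]; exact Submodel.le_refl _) (hle' _ _ _) (hrange _ _ _)
  have hinc0 := hE.mono 0 γ zero_le
  have hdnf : ∀ (P : K.Model) (f : Emb (E γ).toModel P) (y : P),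
      s.nf₁ ((Submodel.within (hM γ)).map f) f.range y →
      s.DoesNotFork (Submodel.inclusion hinc0) (gtp f (single y)) := by
    intro P f y h
    refine ⟨P, f, single y, rfl, hs.nf₁_mono h ?_ ?_ (Submodel.le_refl _)⟩
    · intro z hz
      obtain ⟨x, hx, rfl⟩ := (Submodel.mem_within_map _ _).mp hz
      exact ⟨Submodel.elem (hM₀ hx), rfl⟩
    · rintro _ ⟨x, rfl⟩
      exact ⟨_, rfl⟩
  -- Neither type forks over `E 0`, and over `E 0` they agree because the system embeds `Q'` into
  -- its last model.
  have htp : gtp (g.comp (E γ).subtype) (single b) = gtp (p γ).f (single bγ) := by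
    refine hs.uniqueness _ _ (Submodel.inclusion hinc0) 1 _ _ (hs.nf_dom nγ).2.1
      (hdnf _ _ _ n1) (hdnf _ _ _ nγ) ?_
    exact gtp_eq_of_atomic (f₁ := (g.comp (E γ).subtype).comp (Submodel.inclusion hinc0))
      (f₂ := (p γ).f.comp (Submodel.inclusion hinc0)) (a₁ := single b) (a₂ := single bγ)
      (hL0 γ le_rfl).le.emb (Emb.id _)
      (fun x => (hL0 γ le_rfl).emb_f x.1 x.2 (hinc0 x.2)) fun _ => hbγ
  obtain ⟨W, u, v, hW, hWc, huv, hub⟩ :=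
    hs.exists_amalgam_of_gtp_single_eq (hEF γ) hQ'F hF htp
  have huv' : ∀ (x : Q) (hx : x ∈ E γ), u (g x) = v ((p γ).f (Submodel.elem hx)) :=
    fun x hx => huv (Submodel.elem hx)
  have hpl : ∀ j, (p (min j γ)).Le (p γ) := fun j => hp.le _ _ (min_le_right _ _) le_rfl
  -- The image of `F j`, frozen from `γ` on, since the system is controlled only up to `γ`.
  let G : Ordinal.{w} → Submodel W := fun j => (v.comp (hpl j).le.emb).range
  have hGmem : ∀ j ≤ γ, ∀ z, z ∈ G j ↔
      ∃ y : (p γ).M.Q, v y = z ∧ ∃ x : (p j).M.Q, (p j).M.mark x = (p γ).M.mark y := by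
    intro j hj z
    have e : min j γ = j := min_eq_left hj
    have h1 : z ∈ G j ↔ ∃ y : (p γ).M.Q, v y = z ∧
        ∃ x : (p (min j γ)).M.Q, (p (min j γ)).M.mark x = (p γ).M.mark y := by
      constructor
      · rintro ⟨x, rfl⟩
        exact ⟨(hpl j).le.emb x, rfl, x, ((hpl j).le.mark_emb x).symm⟩
      · rintro ⟨y, rfl, x, hx⟩
        exact ⟨x, congrArg v ((hpl j).le.emb_eq hx.symm)⟩
    rwa [e] at h1
  have hGcap : ∀ j, γ ≤ j → G j = G γ := by
    intro j hj
    refine Submodel.ext_mem fun z => ?_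
    have e : min j γ = min γ γ := by rw [min_eq_right hj, min_self]
    change (∃ x, v ((hpl j).le.emb x) = z) ↔ ∃ x, v ((hpl γ).le.emb x) = z
    generalize hpl j = h1
    generalize hpl γ = h2
    revert h1 h2
    rw [e]
    exact fun _ _ => Iff.rfl
  have hGmono : ∀ i j, i ≤ j → G i ≤ G j := by
    have h1 : ∀ i j, i ≤ j → j ≤ γ → G i ≤ G j := by
      intro i j hij hj z hz
      obtain ⟨y, rfl, x, hx⟩ := (hGmem i (hij.trans hj) z).mp hz
      exact (hGmem j hj _).mpr ⟨y, rfl, (hp.le i j hij hj).le.emb x,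
        ((hp.le i j hij hj).le.mark_emb x).trans hx⟩
    intro i j hij
    rcases le_total j γ with hj | hj
    · exact h1 i j hij hj
    · rcases le_total i γ with hi | hi
      · rw [hGcap j hj]
        exact h1 i γ hi le_rfl
      · rw [hGcap j hj, hGcap i hi]
        exact Submodel.le_refl _
  have hGcont : ∀ j ≤ γ, Order.IsSuccLimit j → ∀ z ∈ G j, ∃ i < j, z ∈ G i := by
    intro j hj hjl z hz
    obtain ⟨y, rfl, x, hx⟩ := (hGmem j hj z).mp hz
    obtain ⟨i, hi, t, ht⟩ := hp.cont j hj hjl x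
    exact ⟨i, hi, (hGmem i (hi.le.trans hj) _).mpr ⟨y, rfl, t, ht.trans hx⟩⟩
  have hEG : ∀ j ≤ γ, (E j).map (u.comp g) ≤ G j := by
    rintro j hj _ ⟨x, hx, rfl⟩
    refine (hGmem j hj _).mpr ⟨(p γ).f (Submodel.elem (hE.mono j γ hj hx)), (huv' x _).symm,
      (p j).f (Submodel.elem hx), ((hp.le j γ hj le_rfl).map_f x hx _).symm⟩
  -- The switch comes strictly after `j₀`: `b` is free from `E j₀` and belongs to `F (j₀ + 1)`, and
  -- each `c j` with `j > j₀` is free from `F j`.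
  let E' : Ordinal.{w} → Submodel W := fun j => if j ≤ j₀ then (E j).map (u.comp g) else G j
  have hE'1 : ∀ j, j ≤ j₀ → E' j = (E j).map (u.comp g) := fun j hj => if_pos hj
  have hE'2 : ∀ j, j₀ < j → E' j = G j := fun j hj => if_neg (not_le.mpr hj)
  have hj₀1 : j₀ < j₀ + 1 := Order.lt_add_one_iff.mpr le_rfl
  have hj₀1' : j₀ + 1 ≤ γ := Order.add_one_le_iff.mpr hj₀
  refine ⟨W, u, E', hW, hWc.trans (max_le hQ' (hpc γ le_rfl)), ⟨?_, ?_⟩, ?_, ?_, ?_, ?_⟩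
  · intro i j hij
    rcases le_or_gt j j₀ with hj | hj
    · rw [hE'1 j hj, hE'1 i (hij.trans hj)]
      exact Submodel.map_mono _ (hE.mono i j hij)
    · rw [hE'2 j hj]
      rcases le_or_gt i j₀ with hi | hi
      · rw [hE'1 i hi]
        exact Submodel.le_trans (hEG i (hi.trans hj₀.le)) (hGmono i j hij)
      · rw [hE'2 i hi]
        exact hGmono i j hij
  · intro j hjl z hz
    rcases le_or_gt j j₀ with hj | hj
    · rw [hE'1 j hj] at hz
      obtain ⟨i, hi, hz⟩ := (hE.map (u.comp g)).cont j hjl z hz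
      exact ⟨i, hi, by rwa [hE'1 i (hi.le.trans hj)]⟩
    · rw [hE'2 j hj] at hz
      rcases le_or_gt j γ with hjγ | hjγ
      · obtain ⟨i, hi, hz⟩ := hGcont j hjγ hjl z hz
        have h1 : j₀ + 1 < j := hjl.add_one_lt hj
        refine ⟨max i (j₀ + 1), max_lt hi h1, ?_⟩
        rw [hE'2 _ (hj₀1.trans_le (le_max_right _ _))]
        exact hGmono _ _ (le_max_left _ _) hz
      · refine ⟨γ, hjγ, ?_⟩
        rw [hE'2 γ hj₀]
        rwa [hGcap j hjγ.le] at hz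
  · intro j hj
    rcases le_or_gt j j₀ with h | h
    · rw [hE'1 j h]
      exact Submodel.le_refl _
    · rw [hE'2 j h]
      exact hEG j hj
  · intro j hjS
    obtain ⟨hjγ, hcj, hcn⟩ := hc j hjS
    rcases le_or_gt j j₀ with h | h
    · rw [hE'1 j h]
      exact (hs.nf₁_map_iff (u.comp g) hW).mpr hcn
    · rw [hE'2 j h]
      obtain ⟨hlj, hstep⟩ := hpS j hjγ
      have hj1 : j + 1 ≤ γ := Order.add_one_le_iff.mpr hjγ
      have hl1 := hp.le (j + 1) γ hj1 le_rfl
      have h1 := (hs.nf₁_map_iff (v.comp hl1.le.emb) hW).mpr (hstep hjS hcj)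
      have key : ∀ (x : Q) (hx : x ∈ E (j + 1)),
          v.comp hl1.le.emb ((p (j + 1)).f (Submodel.elem hx)) = u (g x) := by
        intro x hx
        rw [Emb.comp_apply, hl1.emb_f x hx (hE.mono _ γ hj1 hx), huv']
      have e1 : ((Submodel.within (hM (j + 1))).map (p (j + 1)).f).map (v.comp hl1.le.emb) =
          M₀.map (u.comp g) := by
        refine Submodel.ext_mem fun z => ⟨?_, ?_⟩
        · rintro ⟨_, ht, rfl⟩
          obtain ⟨x, hx, rfl⟩ := (Submodel.mem_within_map _ _).mp ht
          exact ⟨x, hx, (key x _).symm⟩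
        · rintro ⟨x, hx, rfl⟩
          exact ⟨_, (Submodel.mem_within_map _ _).mpr ⟨x, hx, rfl⟩, key x _⟩
      have e2 : hlj.le.emb.range.map (v.comp hl1.le.emb) = G j := by
        refine Submodel.ext_mem fun z => ⟨?_, fun hz => ?_⟩
        · rintro ⟨_, ⟨x, rfl⟩, rfl⟩
          exact (hGmem j hjγ.le _).mpr ⟨_, rfl, x,
            ((hl1.le.mark_emb _).trans (hlj.le.mark_emb x)).symm⟩
        · obtain ⟨y, rfl, x, hx⟩ := (hGmem j hjγ.le z).mp hz
          refine ⟨_, ⟨x, rfl⟩, congrArg v ?_⟩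
          exact hl1.le.emb_eq (hx.symm.trans (hlj.le.mark_emb x).symm)
      rw [e1, e2, key] at h1
      exact h1
  · rw [hE'1 j₀ le_rfl]
    have h1 := (hs.nf₁_map_iff u hW).mpr hb
    rw [← Emb.map_comp, ← Emb.range_comp] at h1
    refine hs.nf₁_mono h1 (Submodel.le_refl _) (Submodel.map_mono _ (hM j₀)) ?_
    rintro _ ⟨x, -, rfl⟩
    exact ⟨x, rfl⟩
  · rw [hE'2 _ hj₀1]
    refine (hGmem _ hj₀1' _).mpr ⟨bγ, hub.symm, (hL0 _ hj₀1').le.emb b, ?_⟩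
    rw [Marked.Le.mark_emb, ← hbγ, Marked.Le.mark_emb]

end IsGoodMinus

/-- The elements `d j`, `j ∈ S`, are free over `M₀` from the members of the chain `E`, in the order
of their indices, up to the embedding `f`. -/
def FreeAlong (s : FrameData K) {N Q : K.Model} {A : Submodel N} (f : Emb A.toModel Q)
    {M₀ : Submodel N} (hM₀ : M₀ ≤ A) (d : Ordinal.{w} → N) (S : Set Ordinal.{w})
    (E : Ordinal.{w} → Submodel Q) : Prop :=
  ∀ j ∈ S, ∃ h : d j ∈ A, f (Submodel.elem h) ∈ E (j + 1) ∧
    s.nf₁ ((Submodel.within hM₀).map f) (E j) (f (Submodel.elem h))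

/-! ### Interleaving a free sequence with a chain -/

namespace IsGoodMinus

variable (hs : s.IsGoodMinus)
include hs

/-- The successor step of `exists_interleave`. -/
theorem exists_freeAlong_succ (hsym : s.ElementSymmetry) {κ : Cardinal.{w}} (hκ₀ : ℵ₀ ≤ κ)
    (hκ : (κ : WithTop Cardinal.{w}) < s.theta) {N Q : K.Model} (hNF : s.InF N) (hN : #N ≤ κ)
    (hQF : s.InF Q) (hQ : #Q ≤ κ) {A B : Submodel N} (hAB : A ≤ B) (f : Emb A.toModel Q)
    {M₀ : Submodel N} (hM₀ : M₀ ≤ A) {d : Ordinal.{w} → N} {γ : Ordinal.{w}} (hγ : γ.card ≤ κ)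
    {S : Set Ordinal.{w}} (hSγ : ∀ j ∈ S, j < γ) {E : Ordinal.{w} → Submodel Q}
    (hE : IsFullChain E) (hME : (Submodel.within hM₀).map f ≤ E 0)
    (hd : s.FreeAlong f hM₀ d S E) {j₀ : Ordinal.{w}} (hj₀ : j₀ < γ) (hdB : d j₀ ∈ B)
    (hn : s.nf₁ M₀ A (d j₀)) :
    ∃ (Q' : K.Model) (f' : Emb B.toModel Q') (g : Emb Q Q') (E' : Ordinal.{w} → Submodel Q'),
      s.InF Q' ∧ #Q' ≤ κ ∧
      (∀ (x : N) (hx : x ∈ A) (hx' : x ∈ B), g (f (Submodel.elem hx)) = f' (Submodel.elem hx')) ∧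
      IsFullChain E' ∧ (∀ j ≤ γ, (E j).map g ≤ E' j) ∧
      (Submodel.within (Submodel.le_trans hM₀ hAB)).map f' ≤ E' 0 ∧
      s.FreeAlong f' (Submodel.le_trans hM₀ hAB) d (insert j₀ S) E' := by
  classical
  have hMB := Submodel.le_trans hM₀ hAB
  have hw : (Submodel.within hM₀).map (Submodel.inclusion hAB) = Submodel.within hMB :=
    Submodel.ext_mem fun y => (Submodel.mem_within_map _ _).trans ⟨by
      rintro ⟨x, hx, rfl⟩
      exact (Submodel.mem_within _).mpr hx, fun hy =>
        ⟨y.1, (Submodel.mem_within _).mp hy, rfl⟩⟩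
  have hn' : s.nf₁ ((Submodel.within hM₀).map (Submodel.inclusion hAB))
      (Submodel.inclusion hAB).range (Submodel.elem hdB) := by
    refine (hs.nf₁_map_iff B.subtype hNF).mp ?_
    have e1 : (Submodel.inclusion hAB).range.map B.subtype = A := Submodel.within_map_subtype hAB
    rw [hw, Submodel.within_map_subtype, e1]
    exact hn
  -- The new element is made free over `M₀` from all of `Q`, as insertion at an arbitrary place
  -- requires.
  obtain ⟨Q', u, g, hQ', hcard, e, n1⟩ := hs.exists_nf_amalgam _ f hQF hn'
  have hc : ∃ c : Ordinal.{w} → Q, ∀ j (h : d j ∈ A), c j = f (Submodel.elem h) := by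
    obtain ⟨z⟩ := hs.nonempty_of_inF hQF
    exact ⟨fun j => if h : d j ∈ A then f (Submodel.elem h) else z, fun j h => dif_pos h⟩
  obtain ⟨c, hc⟩ := hc
  obtain ⟨Q'', h, E', hQ'', hcard', hE', hEE', hE'c, hE'b, hbE'⟩ := hs.exists_insert hsym hκ₀ hκ
    hE hγ hME (S := S) (c := c) (fun j hj => by
      obtain ⟨hjA, h1, h2⟩ := hd j hj
      rw [hc j hjA]
      exact ⟨hSγ j hj, h1, h2⟩) g
    (hcard.trans (max_le (B.card_le.trans hN) hQ)) n1 hj₀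
  have e' : ∀ (x : N) (hx : x ∈ A) (hx' : x ∈ B),
      h.comp g (f (Submodel.elem hx)) = h.comp u (Submodel.elem hx') := fun x hx hx' =>
    congrArg h (e (Submodel.elem hx)).symm
  have eM : ((Submodel.within hM₀).map f).map (h.comp g) =
      (Submodel.within hMB).map (h.comp u) := by
    rw [← hw, ← Emb.map_comp, ← Emb.map_comp]
    congr 1
    exact Emb.ext fun x => e' x.1 x.2 (hAB x.2)
  refine ⟨Q'', h.comp u, h.comp g, E', hQ'', hcard', e', hE', hEE', ?_, ?_⟩
  · rw [← eM]
    exact Submodel.le_trans (Submodel.map_mono _ hME) (hEE' 0 zero_le)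
  · rintro j (rfl | hj)
    · refine ⟨hdB, hbE', ?_⟩
      rw [← eM]
      exact hE'b
    · obtain ⟨hjA, h1, h2⟩ := hd j hj
      have h3 := hE'c j hj
      have h4 : h (g (c j)) = h.comp u (Submodel.elem (hAB hjA)) := by
        rw [hc j hjA]
        exact e' _ hjA _
      refine ⟨hAB hjA, ?_, ?_⟩
      · rw [← e' _ hjA]
        exact hEE' _ (Order.add_one_le_iff.mpr (hSγ j hj)) ⟨_, h1, rfl⟩
      · rw [← eM, ← h4]
        exact h3

/-- A sequence that is free along a chain `C` can be inserted, element by element and at arbitrary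
places `π i`, into a given chain `E₀` along which some elements are already free. -/
theorem exists_interleave (hsym : s.ElementSymmetry) {κ : Cardinal.{w}} (hκ₀ : ℵ₀ ≤ κ)
    (hκ : (κ : WithTop Cardinal.{w}) < s.theta) {N Q₀ : K.Model} (hNF : s.InF N) (hN : #N ≤ κ)
    (hQF : s.InF Q₀) (hQ : #Q₀ ≤ κ) {C : Ordinal.{w} → Submodel N} (hC : IsFullChain C)
    {M₀ : Submodel N} (hM : ∀ i, M₀ ≤ C i) {α γ : Ordinal.{w}} (hα : α.card ≤ κ)
    (hγ : γ.card ≤ κ) {d : Ordinal.{w} → N} {π : Ordinal.{w} → Ordinal.{w}}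
    (hπ : ∀ i < α, π i < γ ∧ d (π i) ∈ C (i + 1) ∧ s.nf₁ M₀ (C i) (d (π i)))
    (f₀ : Emb (C 0).toModel Q₀) {E₀ : Ordinal.{w} → Submodel Q₀} (hE₀ : IsFullChain E₀)
    (hME : (Submodel.within (hM 0)).map f₀ ≤ E₀ 0) {S : Set Ordinal.{w}} (hSγ : ∀ j ∈ S, j < γ)
    (hS : s.FreeAlong f₀ (hM 0) d S E₀) :
    ∃ (Q : K.Model) (f : Emb (C α).toModel Q) (g : Emb Q₀ Q) (E : Ordinal.{w} → Submodel Q),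
      s.InF Q ∧ (∀ (x : N) (hx : x ∈ C 0) (hx' : x ∈ C α),
        g (f₀ (Submodel.elem hx)) = f (Submodel.elem hx')) ∧
      IsFullChain E ∧ (∀ j ≤ γ, (E₀ j).map g ≤ E j) ∧
      s.FreeAlong f (hM α) d (S ∪ π '' Iio α) E := by
  classical
  let T : Ordinal.{w} → Set Ordinal.{w} := fun i => S ∪ π '' Iio i
  have hTγ : ∀ i ≤ α, ∀ j ∈ T i, j < γ := by
    rintro i hi j (hj | ⟨k, hk, rfl⟩)
    · exact hSγ j hj
    · exact (hπ k (lt_of_lt_of_le hk hi)).1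
  have hTmono : ∀ i j, i ≤ j → T i ⊆ T j := fun i j hij =>
    union_subset_union_right _ (image_mono (Iio_subset_Iio hij))
  have hTsucc : ∀ i, T (i + 1) ⊆ insert (π i) (T i) := by
    rintro i j (hj | ⟨k, hk, rfl⟩)
    · exact Or.inr (Or.inl hj)
    · rcases (Order.lt_add_one_iff.mp (mem_Iio.mp hk)).lt_or_eq with hk | rfl
      · exact Or.inr (Or.inr ⟨k, hk, rfl⟩)
      · exact Or.inl rfl
  have hTlim : ∀ i, Order.IsSuccLimit i → ∀ j ∈ T i, ∃ l < i, j ∈ T l := by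
    rintro i hi j (hj | ⟨k, hk, rfl⟩)
    · exact ⟨0, hi.bot_lt, Or.inl hj⟩
    · exact ⟨k + 1, hi.add_one_lt hk, Or.inr ⟨k, mem_Iio.mpr (Order.lt_add_one_iff.mpr le_rfl), rfl⟩⟩
  -- Stage `i` extends `C i` and carries a whole chain, recorded by the subsets `Y j`. The index is
  -- capped at `γ` because an insertion guarantees inclusion of old members in new ones only up to
  -- `γ`.
  obtain ⟨X, p, m₀, hp, hp0, hpc, hpI, -⟩ := exists_system (J := Ordinal.{w}) hC hκ₀ hN hα
    (Inv := fun i {Q} f Y => ∃ E : Ordinal.{w} → Submodel Q, IsFullChain E ∧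
      (∀ j y, y ∈ Y j ↔ y ∈ E (min j γ)) ∧ (Submodel.within (hM i)).map f ≤ E 0 ∧ s.InF Q ∧
      s.FreeAlong f (hM i) d (T i) E)
    (Step := fun _ {_ _} _ _ => True) hQ f₀ (fun j => {y | y ∈ E₀ (min j γ)})
    ⟨E₀, hE₀, fun _ _ => Iff.rfl, hME, hQF, fun j hj => hS j (by
      rcases hj with hj | ⟨k, hk, -⟩
      · exact hj
      · exact absurd (mem_Iio.mp hk) (not_lt.mpr zero_le))⟩
    (by
      rintro i hi Q f Y hQκ ⟨E, hE, hY, hME, hQF, hfree⟩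
      have hii : i ≤ i + 1 := (Order.lt_add_one_iff.mpr le_rfl).le
      obtain ⟨h1, h2, h3⟩ := hπ i hi
      obtain ⟨Q', f', g, E', hQ'F, hQ'κ, e, hE', hEE', hME', hfree'⟩ :=
        hs.exists_freeAlong_succ hsym hκ₀ hκ hNF hN hQF hQκ (hC.mono i (i + 1) hii) f (hM i) hγ
          (hTγ i hi.le) hE hME hfree h1 h2 h3
      refine ⟨Q', f', fun j => {y | y ∈ E' (min j γ)}, g, hQ'κ, e, fun k y hy => ?_,
        ⟨E', hE', fun _ _ => Iff.rfl, hME', hQ'F, fun j hj => hfree' j (hTsucc i hj)⟩, trivial⟩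
      exact hEE' _ (min_le_right _ _) ⟨y, (hY k y).mp hy, rfl⟩)
    (by
      intro i hiα hil X p hp hpc hpI
      have hpos : 0 < i := hil.bot_lt
      choose E hE hY hME hF hfree using hpI
      have h00 := hp.le 0 i zero_le le_rfl
      have hFi : s.InF (p i).M.Q := (hF 0 hpos).of_card_bound hκ h00.le.emb (hpc i le_rfl)
      -- the image in the limit of the `j`-th submodel at stage `m`
      let U : Ordinal.{w} → Ordinal.{w} → Set (p i).M.Q := fun j m =>
        {y | ∃ x ∈ (p m).Y j, (p m).M.mark x = (p i).M.mark y}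
      have hU : ∀ j m (hm : m < i), ∃ B : Submodel (p i).M.Q, (∀ y, y ∈ B ↔ y ∈ U j m) ∧
          B = (E m hm (min j γ)).map (hp.le m i hm.le le_rfl).le.emb := by
        intro j m hm
        have hle := hp.le m i hm.le le_rfl
        refine ⟨_, fun y => ⟨?_, ?_⟩, rfl⟩
        · rintro ⟨x, hx, rfl⟩
          exact ⟨x, (hY m hm j x).mpr hx, (hle.le.mark_emb x).symm⟩
        · rintro ⟨x, hx, e⟩
          exact ⟨x, (hY m hm j x).mp hx, hle.le.emb_eq e.symm⟩
      have hUmono : ∀ j m m', m ≤ m' → m' ≤ i → U j m ⊆ U j m' := by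
        rintro j m m' h h' y ⟨x, hx, e⟩
        obtain ⟨z, hz, e'⟩ := (hp.le m m' h h').map_Y j x hx
        exact ⟨z, hz, e'.trans e⟩
      have hUi : ∀ j y, y ∈ U j i ↔ y ∈ (p i).Y j := fun j y =>
        ⟨fun ⟨x, hx, e⟩ => (p i).M.mark.injective e ▸ hx, fun h => ⟨y, h, rfl⟩⟩
      have hUcont : ∀ j m, m ≤ i → Order.IsSuccLimit m → ∀ y ∈ U j m, ∃ l < m, y ∈ U j l := by
        rintro j m hm hml y ⟨x, hx, e⟩
        obtain ⟨l, hl, z, hz, e'⟩ := hp.cont_Y m hm hml j x hx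
        exact ⟨l, hl, z, hz, e'.trans e⟩
      -- Before the limit these sets are images of submodels; at the limit the set is their
      -- increasing union.
      have hUsub : ∀ j m, m ≤ i → ∃ B : Submodel (p i).M.Q, ∀ y, y ∈ B ↔ y ∈ U j m := by
        intro j m hm
        rcases hm.lt_or_eq with hm | rfl
        · obtain ⟨B, hB, -⟩ := hU j m hm
          exact ⟨B, hB⟩
        · obtain ⟨B, hB⟩ := Submodel.exists_iUnion hpos
            (fun l => if h : l < m then (E l h (min j γ)).map (hp.le l m h.le le_rfl).le.emb
              else Submodel.top _) (by
              intro l l' hll hl' y hy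
              rw [dif_pos (hll.trans_lt hl')] at hy
              rw [dif_pos hl']
              obtain ⟨B, hB, rfl⟩ := hU j l (hll.trans_lt hl')
              obtain ⟨B', hB', rfl⟩ := hU j l' hl'
              exact (hB' y).mpr (hUmono j l l' hll hl'.le ((hB y).mp hy)))
          refine ⟨B, fun y => (hB y).trans ⟨?_, fun hy => ?_⟩⟩
          · rintro ⟨l, hl, hy⟩
            rw [dif_pos hl] at hy
            obtain ⟨B', hB', rfl⟩ := hU j l hl
            exact hUmono j l m hl.le le_rfl ((hB' y).mp hy)
          · obtain ⟨l, hl, hy⟩ := hUcont j m le_rfl hil y hy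
            obtain ⟨B', hB', rfl⟩ := hU j l hl
            refine ⟨l, hl, ?_⟩
            rw [dif_pos hl]
            exact (hB' y).mpr hy
      have hEi : ∀ j, ∃ B : Submodel (p i).M.Q, ∀ y, y ∈ B ↔ y ∈ (p i).Y j := fun j => by
        obtain ⟨B, hB⟩ := hUsub j i le_rfl
        exact ⟨B, fun y => (hB y).trans (hUi j y)⟩
      choose Ei hEi using hEi
      have hcap : ∀ j y, y ∈ (p i).Y j ↔ y ∈ (p i).Y (min j γ) := by
        have h1 : ∀ j j', min j γ ≤ min j' γ → ∀ y, y ∈ (p i).Y j → y ∈ (p i).Y j' := by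
          intro j j' h y hy
          obtain ⟨l, hl, x, hx, e⟩ := hp.cont_Y i le_rfl hil j y hy
          have hx' := (hY l hl j' x).mpr ((hE l hl).mono _ _ h ((hY l hl j x).mp hx))
          exact (hUi j' y).mp (hUmono j' l i hl.le le_rfl ⟨x, hx', e⟩)
        exact fun j y => ⟨h1 _ _ (by rw [min_assoc, min_self]) y,
          h1 _ _ (by rw [min_assoc, min_self]) y⟩
      have hEich : IsFullChain Ei := by
        refine ⟨fun j j' hj y hy => ?_, fun j hj y hy => ?_⟩
        · obtain ⟨l, hl, x, hx, e⟩ := hp.cont_Y i le_rfl hil j y ((hEi j y).mp hy)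
          have hx' := (hY l hl j' x).mpr
            ((hE l hl).mono _ _ (min_le_min_right γ hj) ((hY l hl j x).mp hx))
          exact (hEi j' y).mpr ((hUi j' y).mp (hUmono j' l i hl.le le_rfl ⟨x, hx', e⟩))
        · obtain ⟨l, hl, x, hx, e⟩ := hp.cont_Y i le_rfl hil j y ((hEi j y).mp hy)
          have hx1 := (hY l hl j x).mp hx
          have : ∃ k < j, x ∈ E l hl (min k γ) := by
            rcases le_or_gt j γ with h | h
            · rw [min_eq_left h] at hx1
              obtain ⟨k, hk, hx2⟩ := (hE l hl).cont j hj x hx1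
              exact ⟨k, hk, by rwa [min_eq_left (hk.le.trans h)]⟩
            · rw [min_eq_right h.le] at hx1
              exact ⟨γ, h, by rwa [min_self]⟩
          obtain ⟨k, hk, hx2⟩ := this
          exact ⟨k, hk, (hEi k y).mpr ((hUi k y).mp (hUmono k l i hl.le le_rfl
            ⟨x, (hY l hl k x).mpr hx2, e⟩))⟩
      refine ⟨Ei, hEich, fun j y => (hcap j y).trans (hEi _ y).symm, ?_, hFi, ?_⟩
      · rw [← h00.map_within (hM 0) (hM i)]
        rintro _ ⟨x, hx, rfl⟩
        refine (hEi 0 _).mpr (h00.emb_mem_Y ((hY 0 hpos 0 x).mpr ?_))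
        rw [min_eq_left zero_le]
        exact hME 0 hpos hx
      · intro j hj
        have hjγ := hTγ i hiα j hj
        obtain ⟨l, hl, hjl⟩ := hTlim i hil j hj
        obtain ⟨hdl, h1, -⟩ := hfree l hl j hjl
        have hdi := hC.mono l i hl.le hdl
        have hli := hp.le l i hl.le le_rfl
        refine ⟨hdi, ?_, ?_⟩
        · rw [← hli.emb_f _ hdl hdi]
          refine (hEi _ _).mpr (hli.emb_mem_Y ((hY l hl _ _).mpr ?_))
          rwa [min_eq_left (Order.add_one_le_iff.mpr hjγ)]
        -- With the place `j` fixed, the successive versions of the `j`-th member form a continuous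
        -- chain with union `Ei j`. It is started at stage `l`, when `d j` is already in place, so
        -- `d j` is free from every version and `nf₁_limit` applies.
        · have hD : ∀ m, ∃ B : Submodel (p i).M.Q, m ≤ i → ∀ y, y ∈ B ↔ y ∈ U j (max m l) := by
            intro m
            by_cases hm : m ≤ i
            · obtain ⟨B, hB⟩ := hUsub j (max m l) (max_le hm hl.le)
              exact ⟨B, fun _ => hB⟩
            · exact ⟨Submodel.top _, fun h => absurd h hm⟩
          choose D hD using hD
          have hDi : D i = Ei j := Submodel.ext_mem fun y => by
            rw [hD i le_rfl, max_eq_left hl.le, hEi]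
            exact hUi j y
          rw [← hDi]
          refine hs.nf₁_limit hFi hil ⟨fun m m' hm hm' y hy => ?_, fun m hm hml y hy => ?_⟩
            fun m hm => ?_
          · exact (hD m' hm' y).mpr (hUmono j _ _ (max_le_max_right l hm) (max_le hm' hl.le)
              ((hD m (hm.trans hm') y).mp hy))
          · have hy' := (hD m hm y).mp hy
            rcases le_total m l with h | h
            · refine ⟨0, hml.bot_lt, (hD 0 zero_le y).mpr ?_⟩
              rw [max_eq_right zero_le]
              rwa [max_eq_right h] at hy'
            · rw [max_eq_left h] at hy'
              obtain ⟨k, hk, hy''⟩ := hUcont j m hm hml y hy'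
              exact ⟨k, hk, (hD k (hk.le.trans hm) y).mpr (hUmono j _ _ (le_max_left _ _)
                (max_le (hk.le.trans hm) hl.le) hy'')⟩
          · have hm' : max m l < i := max_lt hm hl
            have hle := hp.le _ i hm'.le le_rfl
            obtain ⟨hdm, -, h2⟩ := hfree _ hm' j (hTmono _ _ (le_max_right _ _) hjl)
            have h3 := (hs.nf₁_map_iff hle.le.emb hFi).mpr h2
            have e : (E _ hm' j).map hle.le.emb = D m := Submodel.ext_mem fun y => by
              obtain ⟨B, hB, hB'⟩ := hU j _ hm'
              rw [min_eq_left hjγ.le] at hB'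
              rw [← hB', hB, hD m hm.le]
            rw [hle.map_within (hM _) (hM i), e, hle.emb_f _ hdm hdi] at h3
            exact h3)
  obtain ⟨E, hE, hY, -, hF, hfree⟩ := hpI α le_rfl
  have hle : Stage.Le (⟨⟨Q₀, m₀⟩, f₀, fun j => {y | y ∈ E₀ (min j γ)}⟩ :
      Stage C Ordinal.{w} X 0) (p α) := hp0 ▸ hp.le 0 α zero_le le_rfl
  refine ⟨(p α).M.Q, (p α).f, hle.le.emb, E, hF, fun x hx hx' => hle.emb_f x hx hx', hE, ?_,
    hfree⟩
  rintro j hj _ ⟨x, hx, rfl⟩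
  have h1 := hle.emb_mem_Y (k := j) (y := x) (show x ∈ E₀ (min j γ) by rwa [min_eq_left hj])
  have h2 := (hY j _).mp h1
  rwa [min_eq_left hj] at h2

end IsGoodMinus

end FrameData

/-! ### Concatenations and enumerations -/

section Concat

variable {X : Type w} {α β : Ordinal.{w}}

theorem concat_left (a : Iio α → X) (b : Iio β → X) {i : Ordinal.{w}} (h : i < α)
    (h' : i ∈ Iio (α + β)) : concat a b ⟨i, h'⟩ = a ⟨i, mem_Iio.mpr h⟩ := dif_pos h

theorem concat_right (a : Iio α → X) (b : Iio β → X) {k : Ordinal.{w}} (h : k < β)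
    (h' : α + k ∈ Iio (α + β)) : concat a b ⟨α + k, h'⟩ = b ⟨k, mem_Iio.mpr h⟩ := by
  have h1 : ¬ α + k < α := not_lt.mpr le_self_add
  refine (dif_neg h1).trans (congrArg b (Subtype.ext ?_))
  exact Ordinal.add_sub_cancel α k

theorem forall_Iio_add {p : Iio (α + β) → Prop}
    (h₁ : ∀ i (h : i < α), p ⟨i, mem_Iio.mpr (h.trans_le le_self_add)⟩)
    (h₂ : ∀ k (h : k < β), p ⟨α + k, mem_Iio.mpr (by gcongr)⟩) : ∀ i, p i := by
  rintro ⟨i, hi⟩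
  rcases lt_or_ge i α with h | h
  · exact h₁ i h
  · obtain ⟨k, rfl⟩ := exists_add_of_le h
    exact h₂ k (lt_of_add_lt_add_left (mem_Iio.mp hi))

theorem range_concat (a : Iio α → X) (b : Iio β → X) :
    Set.range (concat a b) = Set.range a ∪ Set.range b := by
  apply Subset.antisymm
  · rintro _ ⟨i, rfl⟩
    revert i
    refine forall_Iio_add (fun i h => ?_) fun k h => ?_
    · rw [concat_left a b h]
      exact Or.inl ⟨_, rfl⟩
    · rw [concat_right a b h]
      exact Or.inr ⟨_, rfl⟩
  · rintro _ (⟨⟨i, h⟩, rfl⟩ | ⟨⟨k, h⟩, rfl⟩)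
    · exact ⟨⟨i, mem_Iio.mpr ((mem_Iio.mp h).trans_le le_self_add)⟩, concat_left a b h _⟩
    · exact ⟨⟨α + k, mem_Iio.mpr (by have := mem_Iio.mp h; gcongr)⟩, concat_right a b h _⟩

theorem injective_concat_iff (a : Iio α → X) (b : Iio β → X) :
    Function.Injective (concat a b) ↔
      Function.Injective a ∧ Function.Injective b ∧ Disjoint (Set.range a) (Set.range b) := by
  constructor
  · intro h
    refine ⟨?_, ?_, ?_⟩
    · rintro ⟨i, hi⟩ ⟨j, hj⟩ e
      rw [← concat_left a b hi (mem_Iio.mpr ((mem_Iio.mp hi).trans_le le_self_add)),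
        ← concat_left a b hj (mem_Iio.mpr ((mem_Iio.mp hj).trans_le le_self_add))] at e
      exact Subtype.ext (congrArg Subtype.val (h e) :)
    · rintro ⟨i, hi⟩ ⟨j, hj⟩ e
      rw [← concat_right a b hi (mem_Iio.mpr (by have := mem_Iio.mp hi; gcongr)),
        ← concat_right a b hj (mem_Iio.mpr (by have := mem_Iio.mp hj; gcongr))] at e
      exact Subtype.ext (add_left_cancel (congrArg Subtype.val (h e) :))
    · rw [Set.disjoint_left]
      rintro _ ⟨⟨i, hi⟩, rfl⟩ ⟨⟨j, hj⟩, e⟩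
      rw [← concat_left a b hi (mem_Iio.mpr ((mem_Iio.mp hi).trans_le le_self_add)),
        ← concat_right a b hj (mem_Iio.mpr (by have := mem_Iio.mp hj; gcongr))] at e
      have h1 : α + j = i := congrArg Subtype.val (h e)
      exact absurd (mem_Iio.mp hi) (not_lt.mpr (h1 ▸ le_self_add))
  · rintro ⟨ha, hb, hd⟩
    rw [Set.disjoint_left] at hd
    refine forall_Iio_add (fun i hi => ?_) fun k hk => ?_
    · refine forall_Iio_add (fun j hj e => ?_) fun l hl e => ?_
      · rw [concat_left a b hi, concat_left a b hj] at e
        exact Subtype.ext (congrArg Subtype.val (ha e) :)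
      · rw [concat_left a b hi, concat_right a b hl] at e
        exact absurd ⟨_, e.symm⟩ (hd ⟨_, rfl⟩)
    · refine forall_Iio_add (fun j hj e => ?_) fun l hl e => ?_
      · rw [concat_right a b hk, concat_left a b hj] at e
        exact absurd ⟨_, e⟩ (hd ⟨_, rfl⟩)
      · rw [concat_right a b hk, concat_right a b hl] at e
        have h1 : k = l := congrArg Subtype.val (hb e)
        exact Subtype.ext (congrArg (α + ·) h1)

theorem Enumerates.concat_comm {a : Iio α → X} {b : Iio β → X}
    (h : Function.Injective (concat a b)) :
    FrameData.Enumerates (Set.range (concat a b)) (concat b a) := by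
  obtain ⟨ha, hb, hd⟩ := (injective_concat_iff a b).mp h
  exact ⟨(injective_concat_iff b a).mpr ⟨hb, ha, hd.symm⟩, by
    rw [range_concat, range_concat, union_comm]⟩

theorem exists_enumerates (I : Set X) :
    ∃ a : Iio (#I).ord → X, FrameData.Enumerates I a := by
  have h : #(#I).ord.ToType = #I := by rw [Cardinal.mk_toType, Cardinal.card_ord]
  obtain ⟨e⟩ := Cardinal.eq.mp h
  refine ⟨fun i => (e (Ordinal.ToType.mk i)).1, ?_, ?_⟩
  · intro i j hij
    exact Ordinal.ToType.mk.injective (e.injective (Subtype.ext hij))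
  · ext x
    constructor
    · rintro ⟨i, rfl⟩
      exact (e _).2
    · intro hx
      refine ⟨Ordinal.ToType.mk.symm (e.symm ⟨x, hx⟩), ?_⟩
      simp

end Concat

/-! ### Independent sequences and the extraction of element symmetry -/

namespace FrameData

variable {s : FrameData K}

theorem InF.of_submodel_le {N P : K.Model} {A : Submodel N} (hA : s.InF A.toModel)
    (hP : s.InF P) {f : Emb N P} {B : Submodel P} (h : A.map f ≤ B) : s.InF B.toModel :=
  (hA.map f).of_emb hP (Submodel.inclusion h) B.subtype

namespace IsPreFrame

variable (hs : s.IsPreFrame)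
include hs

/-- Independence, with all nonforking taken in one ambient model. -/
theorem indep_iff {N : K.Model} {M M' : Submodel N} {α : Ordinal.{w}} {a : Iio α → N} :
    s.Indep M M' a ↔ s.InF M.toModel ∧ s.InF M'.toModel ∧ M ≤ M' ∧
      ∃ (P : K.Model) (f : Emb N P) (C : Ordinal.{w} → Submodel P), s.InF P ∧ IsFullChain C ∧
        M'.map f ≤ C 0 ∧
        ∀ i (hi : i < α), f (a ⟨i, mem_Iio.mpr hi⟩) ∈ C (i + 1) ∧
          s.nf₁ (M.map f) (C i) (f (a ⟨i, mem_Iio.mpr hi⟩)) := by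
  constructor
  · rintro ⟨P, f, C, hC⟩
    have hMM : M ≤ M' := fun x hx => by
      obtain ⟨y, hy, e⟩ := hC.base_le (Submodel.mem_map_of_mem f hx)
      exact f.injective e ▸ hy
    have hcard : ∀ A : Submodel N, s.InF (A.map f).toModel → s.InF A.toModel := fun A h =>
      h.of_card_le h (A.card_map f).le (A.card_map f).ge
    refine ⟨hcard M hC.inF.1, hcard M' hC.inF.2.1, hMM, P, f, fun i => C (min i α), hC.inF.2.2,
      hC.chain.isFullChain, ?_, fun i hi => ?_⟩
    · beta_reduce
      rw [min_eq_left zero_le]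
      exact hC.le_chain
    · have hi' : i + 1 ≤ α := Order.add_one_le_iff.mpr hi
      beta_reduce
      rw [min_eq_left hi', min_eq_left hi.le]
      obtain ⟨h1, h2, h3, h4⟩ := hC.nf ⟨i, hi⟩
      refine ⟨h3, ?_⟩
      have h5 := (hs.nf₁_map_iff (C (i + 1)).subtype hC.inF.2.2).mpr h4
      rw [Submodel.within_map_subtype, Submodel.within_map_subtype] at h5
      exact h5
  · rintro ⟨hM, hM', hle, P, f, C, hP, hC, h0, h⟩
    have hCF : ∀ i, s.InF (C i).toModel := fun i =>
      hM'.of_submodel_le hP (Submodel.le_trans h0 (hC.mono 0 i zero_le))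
    refine ⟨P, f, C, hC.isContChain α, fun i _ => hCF i, ⟨hM.map f, hM'.map f, hP⟩,
      Submodel.map_mono f hle, h0, fun i => ?_⟩
    obtain ⟨h1, h2⟩ := h i.1 i.2
    have hii : i.1 ≤ i.1 + 1 := (Order.lt_add_one_iff.mpr le_rfl).le
    have hCC := hC.mono _ _ hii
    have hMC := Submodel.le_trans (hs.nf₁_le h2) hCC
    refine ⟨hMC, hCC, h1, (hs.nf₁_map_iff (C (i.1 + 1)).subtype hP).mp ?_⟩
    rw [Submodel.within_map_subtype, Submodel.within_map_subtype]
    exact h2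

/-- Each entry lies outside the chain member it is free from, while that member contains all earlier
entries. -/
theorem injective_of_indep {N : K.Model} {M M' : Submodel N} {α : Ordinal.{w}} {a : Iio α → N}
    (h : s.Indep M M' a) : Function.Injective a := by
  obtain ⟨-, -, -, P, f, C, -, hC, -, h⟩ := hs.indep_iff.mp h
  have key : ∀ i j (hi : i < α) (hj : j < α), i < j →
      a ⟨i, mem_Iio.mpr hi⟩ ≠ a ⟨j, mem_Iio.mpr hj⟩ := by
    intro i j hi hj hij e
    have h1 := hC.mono _ _ (Order.add_one_le_iff.mpr hij) (h i hi).1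
    rw [e] at h1
    exact hs.notMem_of_nf₁ (h j hj).2 h1
  rintro ⟨i, hi⟩ ⟨j, hj⟩ e
  rcases lt_trichotomy i j with hij | rfl | hij
  · exact absurd e (key i j hi hj hij)
  · rfl
  · exact absurd e.symm (key j i hj hi hij)

theorem indep_zero {N : K.Model} {M M' : Submodel N} (hN : s.InF N) (hM : s.InF M.toModel)
    (hM' : s.InF M'.toModel) (hle : M ≤ M') {α : Ordinal.{w}} (hα : α = 0) (a : Iio α → N) :
    s.Indep M M' a :=
  hs.indep_iff.mpr ⟨hM, hM', hle, N, Emb.id N, fun _ => Submodel.top N, hN,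
    ⟨fun _ _ _ => Submodel.le_refl _, fun _ hj _ hx => ⟨0, hj.bot_lt, hx⟩⟩, Submodel.le_top _,
    fun _ hi => absurd (hα ▸ hi) (not_lt.mpr zero_le)⟩

theorem indep_single {N : K.Model} {M M' : Submodel N} {x : N} (h : s.nf₁ M M' x) :
    s.Indep M M' (single x) := by
  have hd := hs.nf_dom h
  let C : Ordinal.{w} → Submodel N := fun i => if i = 0 then M' else Submodel.top N
  have C0 : C 0 = M' := if_pos rfl
  have C1 : ∀ i, i ≠ 0 → C i = Submodel.top N := fun i hi => if_neg hi
  refine hs.indep_iff.mpr ⟨hd.2.2.1, hd.2.2.2.1, hd.1, N, Emb.id N, C, hd.2.2.2.2,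
    ⟨fun i j hij => ?_, ?_⟩, ?_, ?_⟩
  · by_cases hj : j = 0
    · subst hj
      obtain rfl : i = 0 := le_antisymm hij zero_le
      exact Submodel.le_refl _
    · rw [C1 j hj]
      exact Submodel.le_top _
  · intro j hj x _
    have h1 : (1 : Ordinal.{w}) < j := by
      have := hj.add_one_lt hj.bot_lt
      rwa [Ordinal.bot_eq_zero, zero_add] at this
    exact ⟨1, h1, by rw [C1 1 one_ne_zero]; exact Submodel.mem_top x⟩
  · rw [Emb.map_id, C0]
    exact Submodel.le_refl _
  · intro i hi
    obtain rfl : i = 0 := Order.lt_one_iff.mp hi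
    rw [zero_add, C1 1 one_ne_zero, C0, Emb.map_id]
    exact ⟨Submodel.mem_top _, h⟩

/-- The witnessing chain is `M'`, `M''`, then the whole model. -/
theorem indep_concat_single {N : K.Model} {M M' M'' : Submodel N} {x y : N} (hx : s.nf₁ M M' x)
    (hxM : x ∈ M'') (hM : M' ≤ M'') (hy : s.nf₁ M M'' y) :
    s.Indep M M' (concat (single x) (single y)) := by
  have hd := hs.nf_dom hx
  let C : Ordinal.{w} → Submodel N := fun i =>
    if i = 0 then M' else if i = 1 then M'' else Submodel.top N
  have C0 : C 0 = M' := if_pos rfl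
  have C1 : C 1 = M'' := (if_neg one_ne_zero).trans (if_pos rfl)
  have C2 : ∀ i, 1 < i → C i = Submodel.top N := fun i hi =>
    (if_neg (zero_lt_one.trans hi).ne').trans (if_neg hi.ne')
  have cases : ∀ i : Ordinal.{w}, i = 0 ∨ i = 1 ∨ 1 < i := fun i => by
    rcases lt_trichotomy i 1 with h | h | h
    · exact Or.inl (Order.lt_one_iff.mp h)
    · exact Or.inr (Or.inl h)
    · exact Or.inr (Or.inr h)
  have h12 : (1 : Ordinal.{w}) < 1 + 1 := Order.lt_add_one_iff.mpr le_rfl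
  refine hs.indep_iff.mpr ⟨hd.2.2.1, hd.2.2.2.1, hd.1, N, Emb.id N, C, hd.2.2.2.2,
    ⟨fun i j hij => ?_, ?_⟩, ?_, ?_⟩
  · rcases cases j with rfl | rfl | hj
    · obtain rfl : i = 0 := le_antisymm hij zero_le
      exact Submodel.le_refl _
    · rcases cases i with rfl | rfl | hi
      · rw [C0, C1]
        exact hM
      · exact Submodel.le_refl _
      · exact absurd hi (not_lt.mpr hij)
    · rw [C2 j hj]
      exact Submodel.le_top _
  · intro j hj x _
    have h1 : (1 : Ordinal.{w}) < j := by
      have := hj.add_one_lt hj.bot_lt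
      rwa [Ordinal.bot_eq_zero, zero_add] at this
    exact ⟨1 + 1, hj.add_one_lt h1, by rw [C2 _ h12]; exact Submodel.mem_top x⟩
  · rw [Emb.map_id, C0]
    exact Submodel.le_refl _
  · intro i hi
    rw [Emb.map_id]
    rcases cases i with rfl | rfl | h
    · rw [zero_add, C0, C1, concat_left _ _ zero_lt_one]
      exact ⟨hxM, hx⟩
    · rw [C1, C2 _ h12]
      refine ⟨Submodel.mem_top _, ?_⟩
      have e : concat (single x) (single y) ⟨1, hi⟩ = y := by
        have h1 : (1 : Ordinal.{w}) + 0 ∈ Iio ((1 : Ordinal.{w}) + 1) := by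
          rw [add_zero]
          exact hi
        have h2 := concat_right (single x) (single y) zero_lt_one h1
        simp only [add_zero] at h2
        exact h2
      rw [e]
      exact hy
    · exact absurd (Order.lt_add_one_iff.mp hi) (not_le.mpr h)

theorem concatSymmetry_of_symmetryOfIndependence {μ : Cardinal.{w}}
    (h : s.SymmetryOfIndependence μ) : s.ConcatSymmetry μ := by
  intro N M₀ M hN hM hM₀ hle α β a b hαβ
  have key : ∀ {α β : Ordinal.{w}} (a : Iio α → N) (b : Iio β → N),
      #(Set.range (concat a b)) < μ → s.Indep M₀ M (concat a b) →
      s.Indep M₀ M (concat b a) := by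
    intro α β a b hc hi
    have hinj := hs.injective_of_indep hi
    exact (h N M₀ M hN hM hM₀ hle _ hc).mp ⟨_, _, ⟨hinj, rfl⟩, hi⟩ _ _
      (Enumerates.concat_comm hinj)
  have hc : #(Set.range (concat a b)) < μ :=
    (mk_range_seq_le _).trans_lt (Cardinal.lt_ord.mp hαβ)
  refine ⟨key a b hc, key b a ?_⟩
  rwa [range_concat, union_comm, ← range_concat]

end IsPreFrame

namespace IsGoodMinus

variable (hs : s.IsGoodMinus)
include hs

/-- The model `M₁` witnesses that `⟨c, b⟩` is independent from `M₀` over `M₀`. In a chain for `⟨b,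
c⟩`, the member at index `1` contains `b`, and `c` is free from it. -/
theorem elementSymmetry_of_concatSymmetry {μ : Cardinal.{w}} (hμ : 2 < μ)
    (h : s.ConcatSymmetry μ) : s.ElementSymmetry := by
  intro N M₀ M₁ b c hb hc hbs
  have hd := hs.nf_dom hb
  have h2 : (1 : Ordinal.{w}) + 1 < μ.ord := by
    rw [Cardinal.lt_ord, Ordinal.card_add, Ordinal.card_one, one_add_one_eq_two]
    exact hμ
  have hi := (h N M₀ M₀ hd.2.2.2.2 hd.2.2.1 hd.2.2.1 (Submodel.le_refl _) 1 1 (single c)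
    (single b) h2).mp (hs.indep_concat_single (hs.nf₁_of_mem_bs hd.2.2.2.2 hbs) hc hd.1 hb)
  obtain ⟨-, -, -, P, f, C, -, -, -, hC⟩ := hs.indep_iff.mp hi
  have h01 : (0 : Ordinal.{w}) < 1 + 1 := zero_lt_one.trans_le le_self_add
  have h11 : (1 : Ordinal.{w}) + 0 < 1 + 1 := by
    rw [add_zero]
    exact Order.lt_add_one_iff.mpr le_rfl
  refine ⟨P, f, C 1, ?_, ?_⟩
  · have := (hC 0 h01).1
    rwa [concat_left _ _ zero_lt_one, zero_add] at this
  · have := (hC (1 + 0) h11).2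
    rw [concat_right _ _ zero_lt_one, add_zero] at this
    exact this

theorem elementSymmetry_of_hasSymmetry {μ : Cardinal.{w}} (hμ : 1 < μ)
    (h : (s.elongation μ.ord).HasSymmetry) : s.ElementSymmetry := by
  intro N M₀ M₁ b c hb hc hbs
  have hd := hs.nf_dom hb
  have h1 : (1 : Ordinal.{w}) < μ.ord := by
    rwa [Cardinal.lt_ord, Ordinal.card_one]
  have hcn := hs.nf₁_of_mem_bs hd.2.2.2.2 hbs
  obtain ⟨N', f, M', hbM', -, hN', hi⟩ := h N M₀ M₁ 1 1 (single b) (single c)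
    ⟨h1, hd.2.2.2.2, hs.indep_single hb⟩ h1 (fun _ => hc)
    ⟨h1, N, M₀.subtype, single c, rfl, hd.2.2.2.2, by
      rw [Emb.range_subtype]
      exact hs.indep_single hcn⟩
  obtain ⟨-, -, hle, P, k, C, hP, hC, h0, h⟩ := hs.indep_iff.mp hi
  refine ⟨N', f, M', hbM' ⟨0, one_pos_mem⟩, (hs.nf₁_map_iff k hP).mp ?_⟩
  exact hs.nf₁_mono (h 0 zero_lt_one).2 (Submodel.le_refl _) (Submodel.map_mono k hle) h0

end IsGoodMinus

end FrameData

/-- Truncated subtraction makes the chain wait at `C 0` up to index `β` and then run through `C`;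
the waiting places are left for another sequence. -/
theorem IsFullChain.comp_sub {N : K.Model} {C : Ordinal.{w} → Submodel N} (h : IsFullChain C)
    (β : Ordinal.{w}) : IsFullChain fun j => C (j - β) where
  mono i j hij := h.mono _ _ (Ordinal.sub_le.mpr (hij.trans (Ordinal.le_add_sub j β)))
  cont j hj x hx := by
    rcases le_or_gt j β with h' | h'
    · refine ⟨0, hj.bot_lt, ?_⟩
      rw [Ordinal.sub_eq_zero_iff_le.mpr h'] at hx
      rwa [Ordinal.zero_sub]
    · obtain ⟨i, hi, hx⟩ := h.cont _ (Ordinal.isSuccLimit_sub hj.isSuccPrelimit h') x hx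
      exact ⟨β + i, Ordinal.lt_sub.mp hi, by rwa [Ordinal.add_sub_cancel]⟩

theorem IsFullChain.comp_add {N : K.Model} {C : Ordinal.{w} → Submodel N} (h : IsFullChain C)
    (β : Ordinal.{w}) : IsFullChain fun k => C (β + k) where
  mono i j hij := h.mono _ _ (by gcongr)
  cont k hk x hx := by
    obtain ⟨i, hi, hx⟩ := h.cont _ (Ordinal.isSuccLimit_add β hk) x hx
    rcases lt_or_ge i β with h' | h'
    · exact ⟨0, hk.bot_lt, h.mono _ _ (h'.le.trans le_self_add) hx⟩
    · obtain ⟨l, rfl⟩ := exists_add_of_le h'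
      exact ⟨l, lt_of_add_lt_add_left hi, hx⟩

/-! ### From element symmetry to sequences and sets -/

namespace FrameData

variable {s : FrameData K}

theorem IsPreFrame.aleph0_le_card (hs : s.IsPreFrame) {N : K.Model} (hN : s.InF N) : ℵ₀ ≤ #N :=
  K.LS_mem.1.trans (hs.LS_le.trans hN.1)

namespace IsGoodMinus

variable (hs : s.IsGoodMinus)
include hs

/-- Interleaving yields an extension of the last chain member `A` only; amalgamating over `A` brings
the conclusion back to an extension of `N`. -/
theorem exists_amalgam_freeAlong {N Q : K.Model} {A : Submodel N} {f : Emb A.toModel Q}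
    (hN : s.InF N) (hA : s.InF A.toModel) (hQ : s.InF Q) {M₀ : Submodel N} {hM₀ : M₀ ≤ A}
    {d : Ordinal.{w} → N} {S : Set Ordinal.{w}} {E : Ordinal.{w} → Submodel Q}
    (h : s.FreeAlong f hM₀ d S E) :
    ∃ (W : K.Model) (u : Emb N W) (v : Emb Q W), s.InF W ∧
      (∀ (x : N) (hx : x ∈ A), u x = v (f (Submodel.elem hx))) ∧
      ∀ j ∈ S, u (d j) ∈ (E (j + 1)).map v ∧ s.nf₁ (M₀.map u) ((E j).map v) (u (d j)) := by
  obtain ⟨W, u, v, hW, -, huv⟩ := hs.exists_amalgam A.subtype f hA hN hQ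
  have huv' : ∀ (x : N) (hx : x ∈ A), u x = v (f (Submodel.elem hx)) :=
    fun x hx => huv (Submodel.elem hx)
  refine ⟨W, u, v, hW, huv', fun j hj => ?_⟩
  obtain ⟨hd, h1, h2⟩ := h j hj
  rw [huv' _ hd]
  refine ⟨Submodel.mem_map_of_mem v h1, ?_⟩
  have h3 := (hs.nf₁_map_iff v hW).mpr h2
  have e : ((Submodel.within hM₀).map f).map v = M₀.map u := by
    rw [← Emb.map_comp]
    exact Submodel.within_map_of_eq hM₀ fun x hx => (huv' x (hM₀ hx)).symm
  rwa [e] at h3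

/-- A witnessing extension of `N` is amalgamated with `W` over `N`; in the other direction it is
simply composed with `u`. -/
theorem indep_map_iff {N W : K.Model} (u : Emb N W) (hW : s.InF W) {M M' : Submodel N}
    {α : Ordinal.{w}} {a : Iio α → N} :
    s.Indep (M.map u) (M'.map u) (fun i => u (a i)) ↔ s.Indep M M' a := by
  have hcard : ∀ A : Submodel N, s.InF (A.map u).toModel → s.InF A.toModel := fun A h =>
    h.of_card_le h (A.card_map u).le (A.card_map u).ge
  constructor
  · intro h
    obtain ⟨hM, hM', hle, P, f, C, hP, hC, h0, h⟩ := hs.indep_iff.mp h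
    refine hs.indep_iff.mpr ⟨hcard M hM, hcard M' hM', fun x hx => ?_, P, f.comp u, C, hP, hC,
      ?_, ?_⟩
    · obtain ⟨y, hy, e⟩ := hle (Submodel.mem_map_of_mem u hx)
      exact u.injective e ▸ hy
    · rwa [Emb.map_comp]
    · rw [Emb.map_comp]
      exact h
  · intro h
    obtain ⟨hM, hM', hle, P, f, C, hP, hC, h0, h⟩ := hs.indep_iff.mp h
    have hN : s.InF N := hM.of_emb hW M.subtype u
    obtain ⟨V, p, q, hV, -, hpq⟩ := hs.exists_amalgam f u hN hP hW
    have e : ∀ A : Submodel N, (A.map u).map q = (A.map f).map p := fun A =>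
      (Emb.map_eq_of_comp hpq A).symm
    refine hs.indep_iff.mpr ⟨hM.map u, hM'.map u, Submodel.map_mono u hle, V, q,
      fun i => (C i).map p, hV, hC.map p, ?_, fun i hi => ?_⟩
    · rw [e]
      exact Submodel.map_mono p h0
    · rw [e, ← hpq]
      exact ⟨Submodel.mem_map_of_mem p (h i hi).1, (hs.nf₁_map_iff p hV).mpr (h i hi).2⟩

/-- A basic type of the elongation comes with some independent realization; this moves independence
to any other realization in the class. -/
theorem indep_of_gtp_eq {M N₁ N₂ : K.Model} {β : Ordinal.{w}}
    (hβ : ((β.card : Cardinal.{w}) : WithTop Cardinal.{w}) < s.theta) (h₁ : s.InF N₁)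
    (h₂ : s.InF N₂) {f₁ : Emb M N₁} {f₂ : Emb M N₂} {a₁ : Iio β → N₁} {a₂ : Iio β → N₂}
    (h : gtp f₁ a₁ = gtp f₂ a₂) (hi : s.Indep f₁.range f₁.range a₁) :
    s.Indep f₂.range f₂.range a₂ := by
  have hM : s.InF M := (inF_range f₁).mp (hs.indep_iff.mp hi).1
  obtain ⟨W, u, v, hW, -, hf, ha⟩ := hs.exists_amalgam_of_gtp_eq hM hβ h₁ h₂ h
  have h3 := (hs.indep_map_iff u hW).mpr hi
  rw [Emb.range_map_eq_of_comp hf, funext ha] at h3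
  exact (hs.indep_map_iff v hW).mp h3

/-- The entries are inserted in the order of `a`, each at the place it has in `a'`. -/
theorem indep_of_range_eq (hsym : s.ElementSymmetry) {N : K.Model}
    {M M' : Submodel N} {α α' : Ordinal.{w}} {a : Iio α → N} {a' : Iio α' → N}
    (h : s.Indep M M' a) (ha' : Function.Injective a') (hr : Set.range a' = Set.range a) :
    s.Indep M M' a' := by
  have ha := hs.injective_of_indep h
  obtain ⟨hM, hM', hle, P, f, C, hP, hC, h0, h⟩ := hs.indep_iff.mp h
  have hMC : ∀ i, M.map f ≤ C i := fun i =>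
    Submodel.le_trans (Submodel.map_mono f hle) (Submodel.le_trans h0 (hC.mono 0 i zero_le))
  have hCF : ∀ i, s.InF (C i).toModel := fun i =>
    hM'.of_submodel_le hP (Submodel.le_trans h0 (hC.mono 0 i zero_le))
  obtain ⟨x₀⟩ := hs.nonempty_of_inF hP
  let d : Ordinal.{w} → P := fun j =>
    open Classical in if h : j < α' then f (a' ⟨j, mem_Iio.mpr h⟩) else x₀
  have hd : ∀ j (h : j < α'), d j = f (a' ⟨j, mem_Iio.mpr h⟩) := fun j h => dif_pos h
  have hidx : ∀ i : Ordinal.{w}, ∃ j : Ordinal.{w}, ∀ hi : i < α, ∃ hj : j < α',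
      a' ⟨j, mem_Iio.mpr hj⟩ = a ⟨i, mem_Iio.mpr hi⟩ := by
    intro i
    by_cases hi : i < α
    · obtain ⟨⟨j, hj⟩, e⟩ : a ⟨i, mem_Iio.mpr hi⟩ ∈ Set.range a' := hr ▸ ⟨_, rfl⟩
      exact ⟨j, fun _ => ⟨mem_Iio.mp hj, e⟩⟩
    · exact ⟨0, fun h => absurd h hi⟩
  choose π hπ using hidx
  have hsurj : ∀ j < α', j ∈ π '' Iio α := by
    intro j hj
    obtain ⟨⟨i, hi⟩, e⟩ : a' ⟨j, mem_Iio.mpr hj⟩ ∈ Set.range a := hr ▸ ⟨_, rfl⟩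
    obtain ⟨hj', e'⟩ := hπ i (mem_Iio.mp hi)
    exact ⟨i, hi, congrArg Subtype.val (ha' (e'.trans e))⟩
  -- The starting chain is constantly `C 0`, with no element placed yet.
  obtain ⟨Q, k, g, E, hQ, hgk, hE, hgE, hfree⟩ := hs.exists_interleave hsym
    (hs.aleph0_le_card hP) hP.2 hP le_rfl (hCF 0) (C 0).card_le hC hMC
    ((card_le_of_injective_seq ha).trans f.card_le)
    ((card_le_of_injective_seq ha').trans f.card_le) (d := d) (π := π) (fun i hi => by
      obtain ⟨hj, e⟩ := hπ i hi
      rw [hd _ hj, e]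
      exact ⟨hj, h i hi⟩) (Emb.id _) (E₀ := fun _ => Submodel.top _)
    ⟨fun _ _ _ => Submodel.le_refl _, fun _ hj _ hx => ⟨0, hj.bot_lt, hx⟩⟩
    (Submodel.le_top _) (S := ∅) (fun _ h => absurd h (notMem_empty _))
    (fun _ h => absurd h (notMem_empty _))
  obtain ⟨W, u, v, hW, huv, hfree⟩ := hs.exists_amalgam_freeAlong hP (hCF α) hQ hfree
  refine hs.indep_iff.mpr ⟨hM, hM', hle, W, u.comp f, fun j => (E j).map v, hW, hE.map v, ?_,
    fun j hj => ?_⟩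
  · rintro _ ⟨x, hx, rfl⟩
    have h1 : f x ∈ C 0 := h0 (Submodel.mem_map_of_mem f hx)
    have h2 : f x ∈ C α := hC.mono 0 α zero_le h1
    have h3 : u (f x) = v (g (Submodel.elem h1)) := (huv _ h2).trans (congrArg v (hgk _ h1 h2).symm)
    exact h3 ▸ Submodel.mem_map_of_mem v
      (hgE 0 zero_le (Submodel.mem_map_of_mem g (Submodel.mem_top _)))
  · have h1 := hfree j (Or.inr (hsurj j hj))
    rw [hd j hj] at h1
    rw [Emb.map_comp]
    exact h1

theorem symmetryOfIndependence_of_elementSymmetry (hsym : s.ElementSymmetry) (μ : Cardinal.{w}) :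
    s.SymmetryOfIndependence μ := by
  intro N M₀ M hN hM hM₀ hle I _
  constructor
  · rintro ⟨α, a, ha, hi⟩ α' a' ha'
    exact hs.indep_of_range_eq hsym hi ha'.1 (ha'.2.trans ha.2.symm)
  · intro h
    obtain ⟨a, ha⟩ := exists_enumerates I
    exact ⟨_, a, ha, h _ a ha⟩

/-- `a₁` is free along a chain starting above `M₂`, which contains `a₂`, and `a₂` is free along a
chain over `M₀`. Inserting `a₁` before `a₂` produces a model that contains `a₁` and from which `a₂`
is independent. -/
theorem hasSymmetry_of_elementSymmetry (hsym : s.ElementSymmetry) {μ : Cardinal.{w}}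
    (hμ : (μ : WithTop Cardinal.{w}) ≤ s.theta) : (s.elongation μ.ord).HasSymmetry := by
  rintro N M₀ M₂ β₁ β₂ a₁ a₂ ⟨hβ₁, hN, hI₁⟩ hβ₂ ha₂ ⟨-, N₁, k₁, a', he, hN₁, hI'⟩
  -- Here `μ ≤ θ` enters: sequences this short have hulls in the class of the frame, so equality of
  -- their types is witnessed by an amalgam there.
  have hβ₂θ : ((β₂.card : Cardinal.{w}) : WithTop Cardinal.{w}) < s.theta :=
    lt_of_lt_of_le (WithTop.coe_lt_coe.mpr (Cardinal.lt_ord.mp hβ₂)) hμ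
  have hI₂ := hs.indep_of_gtp_eq hβ₂θ hN₁ hN he.symm hI'
  rw [Emb.range_subtype] at hI₂
  have hinj₁ := hs.injective_of_indep hI₁
  have hinj₂ := hs.injective_of_indep hI₂
  obtain ⟨hM₀, hM₂, hle, P, f, C, hP, hC, hC0, h₁⟩ := hs.indep_iff.mp hI₁
  obtain ⟨-, -, -, P₂, f₂, D, hP₂, hD, hD0, h₂⟩ := hs.indep_iff.mp hI₂
  obtain ⟨Q₀, u, v, hQ₀, -, huv⟩ := hs.exists_amalgam f f₂ hN hP hP₂
  have hMC : ∀ i, M₀.map f ≤ C i := fun i =>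
    Submodel.le_trans (Submodel.map_mono f hle) (Submodel.le_trans hC0 (hC.mono 0 i zero_le))
  have hCF : ∀ i, s.InF (C i).toModel := fun i =>
    hM₂.of_submodel_le hP (Submodel.le_trans hC0 (hC.mono 0 i zero_le))
  obtain ⟨x₀⟩ := hs.nonempty_of_inF hP
  let d : Ordinal.{w} → P := fun j =>
    open Classical in if h : j < β₁ + β₂ then f (concat a₁ a₂ ⟨j, mem_Iio.mpr h⟩) else x₀
  have hd₁ : ∀ i (h : i < β₁), d i = f (a₁ ⟨i, mem_Iio.mpr h⟩) := fun i h =>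
    (dif_pos (h.trans_le le_self_add)).trans (congrArg f (concat_left a₁ a₂ h _))
  have hd₂ : ∀ k (h : k < β₂), d (β₁ + k) = f (a₂ ⟨k, mem_Iio.mpr h⟩) := fun k h =>
    (dif_pos (by gcongr)).trans (congrArg f (concat_right a₁ a₂ h _))
  have hbase : (Submodel.within (hMC 0)).map (u.comp (C 0).subtype) = (M₀.map f₂).map v := by
    rw [← Emb.map_eq_of_comp huv]
    exact Submodel.within_map_of_eq (hMC 0) fun _ _ => rfl
  have hκ₀ := hs.aleph0_le_card hQ₀
  have hNQ : #N ≤ #Q₀ := (u.comp f).card_le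
  have hβ₁c : β₁.card ≤ #Q₀ := (card_le_of_injective_seq hinj₁).trans hNQ
  have hβ₂c : β₂.card ≤ #Q₀ := (card_le_of_injective_seq hinj₂).trans hNQ
  -- In the starting chain the places below `β₁` idle at `D 0`, and `a₂` already occupies the places
  -- from `β₁` on; entry `i` of `a₁` goes to place `i`.
  obtain ⟨Q, k, g, E, hQ, hgk, hE, hgE, hfree⟩ := hs.exists_interleave hsym hκ₀ hQ₀.2 hP u.card_le
    hQ₀ le_rfl hC hMC hβ₁c (γ := β₁ + β₂)
    (by rw [Ordinal.card_add]; exact Cardinal.add_le_of_le hκ₀ hβ₁c hβ₂c) (d := d)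
    (π := fun i => i) (fun i hi => by
      rw [hd₁ i hi]
      exact ⟨hi.trans_le le_self_add, h₁ i hi⟩) (u.comp (C 0).subtype)
    ((hD.comp_sub β₁).map v) (by
      rw [hbase, Ordinal.zero_sub]
      exact Submodel.map_mono v hD0) (S := Ico β₁ (β₁ + β₂)) (fun j hj => hj.2) (by
      rintro j ⟨hj, hj'⟩
      obtain ⟨k, rfl⟩ := exists_add_of_le hj
      have hk : k < β₂ := lt_of_add_lt_add_left hj'
      have hmem : d (β₁ + k) ∈ C 0 := by
        rw [hd₂ k hk]
        exact hC0 (Submodel.mem_map_of_mem f (ha₂ _))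
      have e : u.comp (C 0).subtype (Submodel.elem hmem) = v (f₂ (a₂ ⟨k, mem_Iio.mpr hk⟩)) := by
        rw [← huv, ← hd₂ k hk]
        rfl
      refine ⟨hmem, ?_⟩
      rw [e, hbase]
      beta_reduce
      rw [add_assoc, Ordinal.add_sub_cancel, Ordinal.add_sub_cancel]
      exact ⟨Submodel.mem_map_of_mem v (h₂ k hk).1, (hs.nf₁_map_iff v hQ₀).mpr (h₂ k hk).2⟩)
  obtain ⟨W, p, q, hW, hpq, hfree⟩ := hs.exists_amalgam_freeAlong hP (hCF β₁) hQ hfree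
  have hM₀E : M₀.map (p.comp f) ≤ (E β₁).map q := by
    rintro _ ⟨x, hx, rfl⟩
    have h1 : f x ∈ C 0 := hMC 0 (Submodel.mem_map_of_mem f hx)
    have h2 : f x ∈ C β₁ := hC.mono 0 β₁ zero_le h1
    have h3 : p (f x) = q (g (v (f₂ x))) := by
      rw [hpq _ h2, ← hgk _ h1 h2, ← huv]
      rfl
    refine h3 ▸ Submodel.mem_map_of_mem q
      (hgE β₁ le_self_add (Submodel.mem_map_of_mem g (Submodel.mem_map_of_mem v ?_)))
    rw [Ordinal.sub_self]
    exact hD0 (Submodel.mem_map_of_mem f₂ hx)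
  -- The member at `β₁` has absorbed all of `a₁`, and the tail of the chain from there on witnesses
  -- the independence of `a₂` from it.
  refine ⟨W, p.comp f, (E β₁).map q, ?_, hβ₂, hW, hs.indep_iff.mpr ⟨hM₀.map _,
    hM₀.of_submodel_le hW hM₀E, hM₀E, W, Emb.id W, fun k => (E (β₁ + k)).map q, hW,
    (hE.comp_add β₁).map q, ?_, fun k hk => ?_⟩⟩
  · rintro ⟨i, hi⟩
    have hi' := mem_Iio.mp hi
    have h3 := (hfree i (Or.inr ⟨i, hi, rfl⟩)).1
    rw [hd₁ i hi'] at h3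
    exact Submodel.map_mono q (hE.mono _ _ (Order.add_one_le_iff.mpr hi')) h3
  · beta_reduce
    rw [Emb.map_id, add_zero]
    exact Submodel.le_refl _
  · have h3 := hfree (β₁ + k) (Or.inl ⟨le_self_add, by gcongr⟩)
    rw [hd₂ k hk, add_assoc] at h3
    rw [Emb.map_id, Emb.map_comp]
    exact h3

end IsGoodMinus

/-! ### The degenerate case of empty sequences -/

namespace IsPreFrame

variable (hs : s.IsPreFrame) {μ : Cardinal.{w}} (hμ : μ ≤ 1)
include hs hμ

theorem hasSymmetry_of_le_one : (s.elongation μ.ord).HasSymmetry := by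
  have h0 : ∀ β : Ordinal.{w}, β < μ.ord → β = 0 := fun β h =>
    Ordinal.card_eq_zero.mp (Cardinal.lt_one_iff.mp ((Cardinal.lt_ord.mp h).trans_le hμ))
  rintro N M₀ M₂ β₁ β₂ a₁ a₂ ⟨hβ₁, hN, hI⟩ hβ₂ - -
  obtain ⟨hM₀, hM₂, hle, -⟩ := hs.indep_iff.mp hI
  refine ⟨N, Emb.id N, M₂, fun i => absurd ((mem_Iio.mp i.2).trans_eq (h0 β₁ hβ₁)) (not_lt.mpr zero_le),
    hβ₂, hN, hs.indep_zero hN (hM₀.map _) hM₂ ?_ (h0 β₂ hβ₂) _⟩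
  rwa [Emb.map_id]

theorem concatSymmetry_of_le_one : s.ConcatSymmetry μ := by
  intro N M₀ M hN hM hM₀ hle α β a b hαβ
  have h : α.card + β.card = 0 := by
    rw [← Ordinal.card_add]
    exact Cardinal.lt_one_iff.mp ((Cardinal.lt_ord.mp hαβ).trans_le hμ)
  obtain ⟨hα, hβ⟩ := add_eq_zero.mp h
  rw [Ordinal.card_eq_zero] at hα hβ
  subst hα hβ
  exact iff_of_true (hs.indep_zero hN hM₀ hM hle (add_zero 0) _)
    (hs.indep_zero hN hM₀ hM hle (add_zero 0) _)

theorem symmetryOfIndependence_of_le_one : s.SymmetryOfIndependence μ := by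
  intro N M₀ M hN hM hM₀ hle I hI
  have hI0 : #I = 0 := Cardinal.lt_one_iff.mp (hI.trans_le hμ)
  have h : ∀ (α : Ordinal.{w}) (a : Iio α → N), Enumerates I a → s.Indep M₀ M a := by
    intro α a ha
    refine hs.indep_zero hN hM₀ hM hle ?_ a
    by_contra hα
    have h1 : a ⟨0, mem_Iio.mpr (pos_iff_ne_zero.mpr hα)⟩ ∈ I := ha.2 ▸ ⟨_, rfl⟩
    exact Cardinal.mk_ne_zero_iff.mpr ⟨⟨_, h1⟩⟩ hI0
  obtain ⟨a, ha⟩ := exists_enumerates I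
  exact iff_of_true ⟨_, a, ha, h _ a ha⟩ h

end IsPreFrame

end FrameData

end AEC

theorem theorem4p5 {L : FirstOrder.Language.{w, w}} (K : AEC L) (s : AEC.FrameData K)
    (hs : s.IsGoodMinusF) (μ : Cardinal.{w}) (hμ : (μ : WithTop Cardinal.{w}) ≤ s.theta)
    (hμ2 : μ ≠ 2) :
    List.TFAE [(s.elongation μ.ord).HasSymmetry, s.ConcatSymmetry μ, s.SymmetryOfIndependence μ] := by
  obtain ⟨hs, -⟩ := hs
  rcases le_or_gt μ 1 with h1 | h1
  · exact List.tfae_of_forall True _ (by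
      simp only [List.forall_mem_cons, iff_true]
      exact ⟨hs.hasSymmetry_of_le_one h1, hs.concatSymmetry_of_le_one h1,
        hs.symmetryOfIndependence_of_le_one h1, fun _ h => nomatch h⟩)
  · have h2 : 2 < μ := lt_of_le_of_ne (Cardinal.two_le_iff_one_lt.mpr h1) hμ2.symm
    tfae_have 1 → 3 := fun h =>
      hs.symmetryOfIndependence_of_elementSymmetry (hs.elementSymmetry_of_hasSymmetry h1 h) μ
    tfae_have 3 → 2 := hs.concatSymmetry_of_symmetryOfIndependence
    tfae_have 2 → 1 := fun h =>
      hs.hasSymmetry_of_elementSymmetry (hs.elementSymmetry_of_concatSymmetry h2 h) hμ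
    tfae_finish
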